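/- Let $\alpha,\beta,\gamma>0$ with $\gamma^2-\alpha\beta>0$, and consider the six-vertex model with weights $$a_1=1,\quad a_2=\gamma^2-\alpha\beta,\quad b_1=\beta,\quad b_2=\alpha,\quad c_1=c_2=\gamma .$$ A six-vertex configuration on $\mathbb Z^2$, or on the torus $(\mathbb Z/n)^2$, is an orientation of all nearest-neighbour edges with indegree and outdegree $2$ at every vertex. The type of a vertex is determined by the arrows on its (west, south, east, north) edges. Writing $R,L,U,D$ for arrows pointing right, left, up, down, the types $1,\dots,6$ are $$1:(R,U,R,U),\quad 2:(L,D,L,D),\quad 3:(R,D,R,D),\quad 4:(L,U,L,U),\quad 5:(R,D,L,U),\quad 6:(L,U,R,D),$$ with weights $(w_1,\dots,w_6)=(a_1,a_2,b_1,b_2,c_1,c_2)$ respectively. Let $\mathbb P_n$ be the probability measure on configurations on the $n\times n$ torus that gives each configuration a probability proportional to the product of its vertex weights, regarded, by periodic extension, as a measure on configurations on $\mathbb Z^2$. Mid-edges are the points of $\mathbb M=((\mathbb Z+\frac12)\times\mathbb Z)\sqcup(\mathbb Z\times(\mathbb Z+\frac12))$; those of the first kind (midpoints of horizontal edges) have colour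 $c(x)=B$, those of the second kind have colour $c(x)=W$. For $v\in\mathbb Z^2$ put $W_v=v-(\frac12,0)$, $S_v=v-(0,\frac12)$, $E_v=v+(\frac12,0)$, $N_v=v+(0,\frac12)$. With rows and columns indexed by $B,W$ in this order, let $$M(w_1,w_2)=\begin{pmatrix}1+\alpha w_1&\gamma w_1^{1/2}w_2^{1/2}\\ \gamma w_1^{1/2}w_2^{1/2}&1+\beta w_2\end{pmatrix},\qquad \det M(w_1,w_2)=\Delta(w_1,w_2)=(1+\alpha w_1)(1+\beta w_2)-\gamma^2w_1w_2,$$ and, for $x,y\in\mathbb M$, $$L(x,y)=\oint\!\!\oint_{|w_1|=|w_2|=1}\frac{dw_1}{2\pi i w_1}\frac{dw_2}{2\pi i w_2}\,w_1^{y_1-x_1}w_2^{y_2-x_2}\,\big[M(w_1,w_2)^{-1}\big]_{c(x),c(y)},$$ where the half-integer powers, taken with one fixed branch, combine to integer powers. Then: 1. The measures $\mathbb P_n$ converge weakly, as $n\to\infty$, to a unique probability measure $\mathbb P$ on six-vertex configurations on $\mathbb Z^2$. 2. The double integrals defining $L(x,y)$, for $x,y\in\mathbb M$, converge absolutely. 3.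 For every $k\ge0$, all distinct $v^1,\dots,v^k\in\mathbb Z^2$ and all types $t_1,\dots,t_k\in\{1,\dots,6\}$, $$\mathbb P\Big(\bigcap_{i=1}^k\{v^i\text{ has type }t_i\}\Big)=\Big(\prod_{i=1}^k w_{t_i}\Big)\det\big[L(x^i,y^j)\big]_{i,j=1}^{2k},$$ where $x^{2i-1}=W_{v^i}$, $x^{2i}=S_{v^i}$, and $(y^{2i-1},y^{2i})$ equals $(W_{v^i},S_{v^i})$, $(N_{v^i},E_{v^i})$, $(W_{v^i},N_{v^i})$, $(E_{v^i},S_{v^i})$, $(W_{v^i},E_{v^i})$, $(N_{v^i},S_{v^i})$ for $t_i=1,2,3,4,5,6$ respectively. -/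

import Mathlib

open MeasureTheory Filter Topology

namespace SixVertex

/-! ### Lattice, mid-edges and configurations

`R` is `ℤ` (the lattice `ℤ²`) or `ZMod n` (the discrete torus). -/

/-- Colours of mid-edges: `black` for midpoints of horizontal edges, `white` for midpoints of
vertical edges. -/
inductive Colour
  | black
  | white
  deriving DecidableEq

instance : Fintype Colour := ⟨{.black, .white}, fun c => by cases c <;> decide⟩

/-- Mid-edges (equivalently, edges): `(black, v)` is the point `v + e¹/2`, the midpoint of the
horizontal edge from `v` to `v + e¹`; `(white, v)` is the point `v + e²/2`, the midpoint of the
vertical edge from `v` to `v + e²`. -/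
abbrev MidEdge (R : Type) : Type := Colour × R × R

/-- The mid-edge `v - e¹/2`. -/
def west {R : Type} [CommRing R] (v : R × R) : MidEdge R := (Colour.black, v.1 - 1, v.2)

/-- The mid-edge `v - e²/2`. -/
def south {R : Type} [CommRing R] (v : R × R) : MidEdge R := (Colour.white, v.1, v.2 - 1)

/-- The mid-edge `v + e¹/2`. -/
def east {R : Type} (v : R × R) : MidEdge R := (Colour.black, v)

/-- The mid-edge `v + e²/2`. -/
def north {R : Type} (v : R × R) : MidEdge R := (Colour.white, v)

/-- Number of arrows at `v` pointing into `v`. An orientation is a function `o` on edges, `true`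
meaning right (horizontal edges) or up (vertical edges), `false` meaning left or down. -/
def inDegree {R : Type} [CommRing R] (o : MidEdge R → Bool) (v : R × R) : ℕ :=
  (o (west v)).toNat + (o (south v)).toNat + (!o (east v)).toNat + (!o (north v)).toNat

/-- Number of arrows at `v` pointing out of `v`. -/
def outDegree {R : Type} [CommRing R] (o : MidEdge R → Bool) (v : R × R) : ℕ :=
  (!o (west v)).toNat + (!o (south v)).toNat + (o (east v)).toNat + (o (north v)).toNat

/-- Six-vertex configurations: orientations of all edges with indegree and outdegree two at every
vertex. As a subtype of `MidEdge R → Bool` it carries the product topology and the cylinder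
σ-algebra. -/
abbrev Config (R : Type) [CommRing R] : Type :=
  {o : MidEdge R → Bool // ∀ v : R × R, inDegree o v = 2 ∧ outDegree o v = 2}

/-- The six vertex types, numbered `1, …, 6` in this order. -/
inductive VertexType
  | a₁
  | a₂
  | b₁
  | b₂
  | c₁
  | c₂
  deriving DecidableEq

instance : Fintype VertexType :=
  ⟨{.a₁, .a₂, .b₁, .b₂, .c₁, .c₂}, fun t => by cases t <;> decide⟩

/-- `HasType o v t`: the arrows on the west, south, east and north edges of `v` form the pattern
of type `t` (`true` is right or up, `false` is left or down). -/
def HasType {R : Type} [CommRing R] (o : MidEdge R → Bool) (v : R × R) (t : VertexType) : Prop :=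
  (o (west v), o (south v), o (east v), o (north v)) =
    match t with
    | .a₁ => (true, true, true, true)
    | .a₂ => (false, false, false, false)
    | .b₁ => (true, false, true, false)
    | .b₂ => (false, true, false, true)
    | .c₁ => (true, false, false, true)
    | .c₂ => (false, true, true, false)

theorem existsUnique_hasType {R : Type} [CommRing R] (σ : Config R) (v : R × R) :
    ∃! t, HasType σ.1 v t := by
  have h := (σ.2 v).1
  unfold inDegree at h
  unfold HasType
  revert h
  generalize σ.1 (west v) = W
  generalize σ.1 (south v) = S
  generalize σ.1 (east v) = E
  generalize σ.1 (north v) = N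
  revert W S E N
  unfold ExistsUnique
  decide

/-- The local vertex type of the configuration `σ` at `v`. -/
noncomputable def vertexType {R : Type} [CommRing R] (σ : Config R) (v : R × R) : VertexType :=
  (existsUnique_hasType σ v).choose

theorem vertexType_eq_iff {R : Type} [CommRing R] (σ : Config R) (v : R × R) (t : VertexType) :
    vertexType σ v = t ↔ HasType σ.1 v t := by
  have h := (existsUnique_hasType σ v).choose_spec
  exact ⟨fun e => e ▸ h.1, fun ht => (h.2 t ht).symm⟩

/-! ### Boltzmann measure on the torus and its infinite-volume limit -/

/-- The weight of a torus configuration: product over all vertices of the local weights. -/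
noncomputable def weight (a : VertexType → ℝ) {n : ℕ} [NeZero n] (σ : Config (ZMod n)) : ℝ :=
  ∏ v : ZMod n × ZMod n, a (vertexType σ v)

/-- The partition function of the `n × n` torus. -/
noncomputable def partitionFunction (a : VertexType → ℝ) (n : ℕ) [NeZero n] : ℝ :=
  ∑ σ : Config (ZMod n), weight a σ

theorem weight_pos {a : VertexType → ℝ} (ha : ∀ t, 0 < a t) {n : ℕ} [NeZero n]
    (σ : Config (ZMod n)) : 0 < weight a σ :=
  Finset.prod_pos fun v _ => ha (vertexType σ v)

theorem partitionFunction_pos {a : VertexType → ℝ} (ha : ∀ t, 0 < a t) (n : ℕ) [NeZero n] :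
    0 < partitionFunction a n :=
  Finset.sum_pos (fun σ _ => weight_pos ha σ)
    ⟨⟨fun _ => true, fun _ => ⟨rfl, rfl⟩⟩, Finset.mem_univ _⟩

/-- The Boltzmann probability measure on the six-vertex configurations of the `n × n` torus:
`σ` has probability `weight a σ / partitionFunction a n`. -/
noncomputable def torusMeasure (a : VertexType → ℝ) (ha : ∀ t, 0 < a t) (n : ℕ) [NeZero n] :
    ProbabilityMeasure (Config (ZMod n)) :=
  ⟨∑ σ : Config (ZMod n),
      ENNReal.ofReal (weight a σ / partitionFunction a n) • Measure.dirac σ, by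
    have hZ := partitionFunction_pos ha n
    constructor
    simp only [Measure.coe_finsetSum, Finset.sum_apply, Measure.smul_apply, smul_eq_mul,
      measure_univ, mul_one]
    rw [← ENNReal.ofReal_sum_of_nonneg fun σ _ => (div_pos (weight_pos ha σ) hZ).le,
      ← Finset.sum_div]
    change ENNReal.ofReal (partitionFunction a n / partitionFunction a n) = 1
    rw [div_self hZ.ne', ENNReal.ofReal_one]⟩

/-- The `(n, n)`-periodic extension of a torus configuration to `ℤ²`. -/
def periodicExtension {n : ℕ} (σ : Config (ZMod n)) : Config ℤ :=
  ⟨fun e => σ.1 (e.1, (e.2.1 : ZMod n), (e.2.2 : ZMod n)), fun v => by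
    have h := σ.2 ((v.1 : ZMod n), (v.2 : ZMod n))
    simpa [inDegree, outDegree, west, south, east, north] using h⟩

theorem measurable_periodicExtension {n : ℕ} :
    Measurable (periodicExtension : Config (ZMod n) → Config ℤ) :=
  Measurable.subtype_mk <| measurable_pi_lambda _ fun e =>
    (measurable_pi_apply (e.1, (e.2.1 : ZMod n), (e.2.2 : ZMod n))).comp measurable_subtype_coe

/-- The torus measure regarded as a probability measure on (periodic) configurations on `ℤ²`. -/
noncomputable def periodicMeasure (a : VertexType → ℝ) (ha : ∀ t, 0 < a t) (n : ℕ) [NeZero n] :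
    ProbabilityMeasure (Config ℤ) :=
  (torusMeasure a ha n).map measurable_periodicExtension.aemeasurable

/-- `P` is the infinite-volume six-vertex measure on `ℤ²` with weights `a`: the weak limit of the
Boltzmann measures on the tori of side `n + 1` as `n → ∞`. -/
def IsInfiniteVolumeMeasure (a : VertexType → ℝ) (ha : ∀ t, 0 < a t)
    (P : ProbabilityMeasure (Config ℤ)) : Prop :=
  Tendsto (fun n : ℕ => periodicMeasure a ha (n + 1)) atTop (𝓝 P)

/-- The weights in the free-fermion regime with parameters `α, β, γ`. -/
def freeFermionWeight (α β γ : ℝ) : VertexType → ℝ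
  | .a₁ => 1
  | .a₂ => γ ^ 2 - α * β
  | .b₁ => β
  | .b₂ => α
  | .c₁ => γ
  | .c₂ => γ

theorem freeFermionWeight_pos {α β γ : ℝ} (hα : 0 < α) (hβ : 0 < β) (hγ : 0 < γ)
    (h : α * β < γ ^ 2) (t : VertexType) : 0 < freeFermionWeight α β γ t := by
  cases t <;> simp [freeFermionWeight, hα, hβ, hγ, h]

/-! ### The correlation kernel -/

/-- First coordinate of a mid-edge of `ℤ²`. -/
def coord₁ : MidEdge ℤ → ℚ
  | (.black, v) => v.1 + 1 / 2
  | (.white, v) => v.1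

/-- Second coordinate of a mid-edge of `ℤ²`. -/
def coord₂ : MidEdge ℤ → ℚ
  | (.black, v) => v.2
  | (.white, v) => v.2 + 1 / 2

/-- The matrix `M(w₁, w₂)`, with rows and columns indexed by colours. -/
noncomputable def kernelMatrix (α β γ : ℝ) (w₁ w₂ : ℂ) : Matrix Colour Colour ℂ
  | .black, .black => 1 + α * w₁
  | .black, .white => γ * w₁ ^ (1 / 2 : ℂ) * w₂ ^ (1 / 2 : ℂ)
  | .white, .black => γ * w₁ ^ (1 / 2 : ℂ) * w₂ ^ (1 / 2 : ℂ)
  | .white, .white => 1 + β * w₂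

/-- The integrand of the correlation kernel,
`(2πi w₁)⁻¹ (2πi w₂)⁻¹ w₁ ^ (y₁ - x₁) w₂ ^ (y₂ - x₂) [M(w₁, w₂)⁻¹]_{c(x), c(y)}`.
Half-integer powers are the principal ones, both here and in `M`; for `|w₁| = |w₂| = 1` they
combine to integer powers. -/
noncomputable def kernelIntegrand (α β γ : ℝ) (x y : MidEdge ℤ) (w : Fin 2 → ℂ) : ℂ :=
  1 / (2 * Real.pi * Complex.I * w 0) * (1 / (2 * Real.pi * Complex.I * w 1)) *
    (w 0 ^ ((coord₁ y - coord₁ x : ℚ) : ℂ) * w 1 ^ ((coord₂ y - coord₂ x : ℚ) : ℂ) *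
      (kernelMatrix α β γ (w 0) (w 1))⁻¹ x.1 y.1)

/-- The correlation kernel `L(x, y)`: the double contour integral over `|w₁| = |w₂| = 1`. -/
noncomputable def kernel (α β γ : ℝ) (x y : MidEdge ℤ) : ℂ :=
  torusIntegral (kernelIntegrand α β γ x y) 0 1

/-- The mid-edges `x^{2i-1}` (`j = 0`) and `x^{2i}` (`j = 1`) attached to the vertex `v = v^i`. -/
def source (v : ℤ × ℤ) : Fin 2 → MidEdge ℤ := ![west v, south v]

/-- The mid-edges `y^{2i-1}` (`j = 0`) and `y^{2i}` (`j = 1`) attached to `v = v^i` and the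
type `t_i`. -/
def target (v : ℤ × ℤ) : VertexType → Fin 2 → MidEdge ℤ
  | .a₁ => ![west v, south v]
  | .a₂ => ![north v, east v]
  | .b₁ => ![west v, north v]
  | .b₂ => ![east v, south v]
  | .c₁ => ![west v, east v]
  | .c₂ => ![north v, south v]

end SixVertex

/-!
The six-vertex model at these weights is a model of free fermions, and the proof solves it on every
torus and then controls the limit. Call a mid-edge occupied if its arrow points left or down. The
occupied mid-edges form paths, and sending every occupied mid-edge to the next one on its path, and
every other mid-edge to itself, is a permutation of the mid-edges. Expanding the determinant of
`pathMatrix`, which is `1` plus a transfer matrix for one step of a path, over the two rows attached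
to each vertex produces exactly the six vertex weights, because `γ ^ 2 - α * β` is a two by two
minor (`det_expand_vertex`, `det_constrainedMatrix`). The sign of the path permutation depends only
on the numbers `h` and `v` of paths crossing the two seams of the torus (`sign_pathPerm`). Hence
`∑ σ, (-1) ^ (h v) * weight σ * ε ^ h * η ^ v` is a determinant, and with prescribed types at some
vertices it is the determinant with the rows of these vertices replaced, which Jacobi's identity
turns into a minor of the inverse. Diagonalizing by Fourier series and summing over the second
frequency in closed form gives a determinantal formula on the torus (`signedSum_typeEvent`), and
factorizes the signed partition function into `∏ k, (A k + B k * η)`, where `A k` and `B k` are the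
`n`-th powers of the coefficients of `Δ(w₁, w₂) = coeffA w₁ + coeffB w₁ * w₂` (`signedSum_univ`). If
no factor is small compared with `max ‖A k‖ ‖B k‖`, the torus kernel is a Riemann sum converging to
the infinite-volume kernel (`tendsto_torusKernel`).

The true partition function is a combination of the four signed sums with `ε = ±1` and `η = ±1`
(`parity_identity`), any of which may have small or vanishing factors. On the unit circle
`‖coeffA‖ ^ 2 - ‖coeffB‖ ^ 2` is affine in the cosine, which leaves two cases.

If it changes sign, only boundedly many factors are nearly resonant. The signed sum over the event
minus the predicted probability times the signed partition function is a polynomial in `η`. By the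
maximum principle it is bounded at `±1` by its values on a small circle about `±1` that avoids all
resonances, where it is negligible (`tendsto_deviation_of_rough`); the comparison uses the lower bound `∏ k, max ‖A k‖ ‖B k‖` for the
partition function, which is Jensen's inequality (`exists_prod_max_le`).

Otherwise one coefficient dominates on the whole circle. Weighting each path that crosses the
horizontal seam by `2` or `1 / 2`, in the direction of the dominating coefficient, removes all
resonances, so the tilted probabilities converge to the predicted value. All partition functions are
known up to subexponential factors, hence with and without tilt the expected density of mid-edges
that do not point in one fixed direction per colour tends to zero; for the horizontal ones this
follows by transposing the lattice. By translation invariance both measures become deterministic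
near any finite set of vertices and have the same limit (`tendsto_tiltedSum_of_not_rough`).

The configuration space is compact and the cylinder events form a π-system of clopen sets, so
convergence of cylinder probabilities gives weak convergence. The double integral converges
absolutely by interpolating between two lower bounds for `|Δ|` with integrable negative powers, and
integrating out the second variable by Fubini's theorem identifies it with the limit of the torus
kernel (`kernel_eq_limitKernel`).
-/

set_option linter.unusedSectionVars false

namespace SixVertex

/-! ### Expanding the determinant over vertex types -/

theorem sum_sum_update {V T : Type*} [Fintype V] [DecidableEq V] [Fintype T] (F : (V → T) → ℂ)
    (v : V) :
    ∑ t : V → T, ∑ x : T, F (Function.update t v x) = Fintype.card T * ∑ t : V → T, F t := by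
  let e : (V → T) × T ≃ (V → T) × T :=
    { toFun := fun p => (Function.update p.1 v p.2, p.1 v)
      invFun := fun p => (Function.update p.1 v p.2, p.1 v)
      left_inv := fun p => by simp
      right_inv := fun p => by simp }
  calc ∑ t : V → T, ∑ x : T, F (Function.update t v x)
      = ∑ p : (V → T) × T, F (e p).1 := by rw [Fintype.sum_prod_type]; rfl
    _ = ∑ p : (V → T) × T, F p.1 := e.sum_comp fun p => F p.1
    _ = _ := by rw [Fintype.sum_prod_type]; simp [Finset.mul_sum]

/-- If a function of `V`-indexed families expands at each single argument as a linear combination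
over `T`, it expands at all arguments at once. -/
theorem expand_all {V T P : Type*} [Fintype V] [DecidableEq V] [Fintype T] [Nonempty T]
    (D : (V → P) → ℂ) (r : V → P) (b : V → T → P) (c : V → T → ℂ)
    (H : ∀ v g, D (Function.update g v (r v)) = ∑ t, c v t * D (Function.update g v (b v t))) :
    D r = ∑ t : V → T, (∏ v, c v (t v)) * D (fun v => b v (t v)) := by
  have hq : (Fintype.card T : ℂ) ≠ 0 := by simp
  -- Induction on the set of arguments already expanded. The sum runs over all of `V → T`, which
  -- overcounts by the choices at the other arguments; the powers of the cardinality record this.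
  have key : ∀ s : Finset V, ∀ g : V → P,
      ((Fintype.card T : ℂ) ^ s.card) * ∑ t : V → T,
        (∏ v ∈ s, c v (t v)) * D (s.piecewise (fun v => b v (t v)) g) =
      (Fintype.card T : ℂ) ^ Fintype.card V * D (s.piecewise r g) := by
    intro s
    induction s using Finset.induction_on with
    | empty => intro g; simp
    | insert v s hv ih =>
      intro g
      have h2 := ih (Function.update g v (r v))
      have e1 : s.piecewise r (Function.update g v (r v)) = (insert v s).piecewise r g := by
        ext w; by_cases hw : w = v
        · subst hw; simp [hv]
        · simp [Finset.piecewise, hw]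
      rw [e1] at h2
      rw [← h2, Finset.card_insert_of_notMem hv, pow_succ, mul_assoc, ← sum_sum_update _ v]
      congr 1
      refine Finset.sum_congr rfl fun t _ => ?_
      have e2 : s.piecewise (fun w => b w (t w)) (Function.update g v (r v)) =
          Function.update (s.piecewise (fun w => b w (t w)) g) v (r v) := by
        ext w; by_cases hw : w = v
        · subst hw; simp [hv]
        · simp [Finset.piecewise, hw]
      rw [e2, H, Finset.mul_sum]
      refine Finset.sum_congr rfl fun x _ => ?_
      have e3 : (insert v s).piecewise (fun w => b w (Function.update t v x w)) g =
          Function.update (s.piecewise (fun w => b w (t w)) g) v (b v x) := by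
        ext w; by_cases hw : w = v
        · subst hw; simp
        · simp [Finset.piecewise, hw]
      rw [e3, Finset.prod_insert hv, Function.update_self]
      have e4 : ∏ w ∈ s, c w (Function.update t v x w) = ∏ w ∈ s, c w (t w) :=
        Finset.prod_congr rfl fun w hw => by
          rw [Function.update_of_ne (ne_of_mem_of_not_mem hw hv)]
      rw [e4]; ring
  have h := key Finset.univ r
  rw [Finset.card_univ] at h
  simpa using (mul_left_cancel₀ (pow_ne_zero _ hq) h).symm

/-- The two mid-edges entering `v` from the west and from the south. -/
def inEdges {R : Type} [CommRing R] (v : R × R) : Fin 2 → MidEdge R := ![west v, south v]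

/-- The two mid-edges selected at `v` by a vertex type: the unoccupied ones among west and south,
and the occupied ones among north and east. The order says which of them the incoming mid-edges are
sent to; for type `a₂` the two paths touch without crossing, so that the minor of `pathMatrix` is
the positive weight `γ ^ 2 - α * β`. -/
def outEdges {R : Type} [CommRing R] (v : R × R) : VertexType → Fin 2 → MidEdge R
  | .a₁ => ![west v, south v]
  | .a₂ => ![north v, east v]
  | .b₁ => ![west v, north v]
  | .b₂ => ![east v, south v]
  | .c₁ => ![west v, east v]
  | .c₂ => ![north v, south v]

/-- The vertex into which the arrow along a mid-edge points when it is unoccupied. -/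
def headVertex {R : Type} [CommRing R] : MidEdge R → R × R
  | (.black, u) => (u.1 + 1, u.2)
  | (.white, u) => (u.1, u.2 + 1)

/-- The index of a mid-edge among the two incoming mid-edges of its head. -/
def headIndex {R : Type} : MidEdge R → Fin 2
  | (.black, _) => 0
  | (.white, _) => 1

section
variable {R : Type} [CommRing R]

@[simp] theorem headVertex_west (v : R × R) : headVertex (west v) = v := by
  simp [headVertex, west]
@[simp] theorem headVertex_south (v : R × R) : headVertex (south v) = v := by
  simp [headVertex, south]
@[simp] theorem headIndex_west (v : R × R) : headIndex (west v) = 0 := rfl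
@[simp] theorem headIndex_south (v : R × R) : headIndex (south v) = 1 := rfl
@[simp] theorem west_headVertex (u : R × R) : west (headVertex (.black, u)) = (.black, u) := by
  simp [headVertex, west]
@[simp] theorem south_headVertex (u : R × R) : south (headVertex (.white, u)) = (.white, u) := by
  simp [headVertex, south]

theorem inEdges_head (e : MidEdge R) : inEdges (headVertex e) (headIndex e) = e := by
  rcases e with ⟨c, u⟩
  cases c <;> simp [inEdges, headIndex]

theorem head_inEdges (v : R × R) (j : Fin 2) :
    headVertex (inEdges v j) = v ∧ headIndex (inEdges v j) = j := by
  fin_cases j <;> simp [inEdges]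

theorem inEdges_injective : Function.Injective fun p : (R × R) × Fin 2 => inEdges p.1 p.2 := by
  rintro ⟨v, j⟩ ⟨v', j'⟩ h
  simp only at h
  have h1 := head_inEdges v j
  rw [h] at h1
  have h2 := head_inEdges v' j'
  exact Prod.ext (h1.1.symm.trans h2.1) (h1.2.symm.trans h2.2)

/-- The map sending each incoming mid-edge of a vertex to the mid-edge selected by its type. -/
def edgeMap (t : R × R → VertexType) (e : MidEdge R) : MidEdge R :=
  outEdges (headVertex e) (t (headVertex e)) (headIndex e)

/-- The four arrows of a vertex type, in the order west, south, east, north. -/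
def arrows : VertexType → Bool × Bool × Bool × Bool
  | .a₁ => (true, true, true, true)
  | .a₂ => (false, false, false, false)
  | .b₁ => (true, false, true, false)
  | .b₂ => (false, true, false, true)
  | .c₁ => (true, false, false, true)
  | .c₂ => (false, true, true, false)

theorem hasType_iff (o : MidEdge R → Bool) (v : R × R) (t : VertexType) :
    HasType o v t ↔ (o (west v), o (south v), o (east v), o (north v)) = arrows t := by
  unfold HasType
  cases t <;> rfl

theorem arrows_vertexType (σ : Config R) (v : R × R) :
    arrows (vertexType σ v) = (σ.1 (west v), σ.1 (south v), σ.1 (east v), σ.1 (north v)) :=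
  ((hasType_iff _ _ _).1 ((vertexType_eq_iff σ v _).1 rfl)).symm

theorem vertexType_injective : Function.Injective (vertexType : Config R → R × R → VertexType) := by
  intro σ τ h
  apply Subtype.ext
  funext e
  have h1 := arrows_vertexType σ (headVertex e)
  rw [h, arrows_vertexType τ] at h1
  rcases e with ⟨c, u⟩
  cases c
  · have := congrArg (fun p => p.1) h1
    simpa using this.symm
  · have := congrArg (fun p => p.2.1) h1
    simpa using this.symm

theorem edgeMap_surjective (σ : Config R) : Function.Surjective (edgeMap (vertexType σ)) := by
  intro e
  by_cases he : σ.1 e = true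
  · refine ⟨e, ?_⟩
    rcases e with ⟨c, u⟩
    have h := arrows_vertexType σ (headVertex (c, u))
    cases c
    · rw [west_headVertex, he] at h
      unfold edgeMap
      revert h
      cases vertexType σ (headVertex (Colour.black, u)) <;> simp [arrows, outEdges, headIndex]
    · rw [south_headVertex, he] at h
      unfold edgeMap
      revert h
      cases vertexType σ (headVertex (Colour.white, u)) <;> simp [arrows, outEdges, headIndex]
  · rw [Bool.not_eq_true] at he
    rcases e with ⟨c, u⟩
    have h := arrows_vertexType σ u
    have hw : ∀ t, vertexType σ u = t → edgeMap (vertexType σ) (west u) = outEdges u t 0 := by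
      intro t ht; simp [edgeMap, ht]
    have hs : ∀ t, vertexType σ u = t → edgeMap (vertexType σ) (south u) = outEdges u t 1 := by
      intro t ht; simp [edgeMap, ht]
    cases c
    · have he' : σ.1 (east u) = false := he
      rw [he'] at h
      match ht : vertexType σ u with
      | .a₁ => rw [ht] at h; simp [arrows] at h
      | .a₂ => exact ⟨south u, by rw [hs _ ht]; rfl⟩
      | .b₁ => rw [ht] at h; simp [arrows] at h
      | .b₂ => exact ⟨west u, by rw [hw _ ht]; rfl⟩
      | .c₁ => exact ⟨south u, by rw [hs _ ht]; rfl⟩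
      | .c₂ => rw [ht] at h; simp [arrows] at h
    · have he' : σ.1 (north u) = false := he
      rw [he'] at h
      match ht : vertexType σ u with
      | .a₁ => rw [ht] at h; simp [arrows] at h
      | .a₂ => exact ⟨west u, by rw [hw _ ht]; rfl⟩
      | .b₁ => exact ⟨south u, by rw [hs _ ht]; rfl⟩
      | .b₂ => rw [ht] at h; simp [arrows] at h
      | .c₁ => rw [ht] at h; simp [arrows] at h
      | .c₂ => exact ⟨west u, by rw [hw _ ht]; rfl⟩

end

/-! ### The path permutation and the path matrix -/

theorem outEdges_eq_west {R : Type} [CommRing R] (v : R × R) (t : VertexType)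
    (h : (arrows t).1 = true) : outEdges v t 0 = west v := by
  revert h; cases t <;> simp [arrows, outEdges]

theorem outEdges_eq_south {R : Type} [CommRing R] (v : R × R) (t : VertexType)
    (h : (arrows t).2.1 = true) : outEdges v t 1 = south v := by
  revert h; cases t <;> simp [arrows, outEdges]

theorem exists_outEdges_eq_east {R : Type} [CommRing R] (v : R × R) (t : VertexType)
    (h : (arrows t).2.2.1 = false) : ∃ j, outEdges v t j = east v ∧
      (j = 0 → (arrows t).1 = false) := by
  revert h
  cases t <;> simp [arrows, outEdges, Fin.exists_fin_two]

theorem exists_outEdges_eq_north {R : Type} [CommRing R] (v : R × R) (t : VertexType)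
    (h : (arrows t).2.2.2 = false) : ∃ j, outEdges v t j = north v ∧
      (j = 1 → (arrows t).2.1 = false) := by
  revert h
  cases t <;> simp [arrows, outEdges, Fin.exists_fin_two]

theorem outEdges_black {R : Type} [CommRing R] {v u : R × R} {t : VertexType} {j : Fin 2}
    (h : outEdges v t j = (Colour.black, u)) :
    ((arrows t).1 = true ∧ west v = (Colour.black, u)) ∨ ((arrows t).2.2.1 = false ∧ v = u) := by
  revert h
  cases t <;> fin_cases j <;> simp [arrows, outEdges, west, south, east, north] <;> tauto

theorem outEdges_white {R : Type} [CommRing R] {v u : R × R} {t : VertexType} {j : Fin 2}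
    (h : outEdges v t j = (Colour.white, u)) :
    ((arrows t).2.1 = true ∧ south v = (Colour.white, u)) ∨
      ((arrows t).2.2.2 = false ∧ v = u) := by
  revert h
  cases t <;> fin_cases j <;> simp [arrows, outEdges, west, south, east, north] <;> tauto

theorem edgeMap_inEdges {R : Type} [CommRing R] (t : R × R → VertexType) (v : R × R) (j : Fin 2) :
    edgeMap t (inEdges v j) = outEdges v (t v) j := by
  rw [edgeMap, (head_inEdges v j).1, (head_inEdges v j).2]

/-- If following the types moves the mid-edges bijectively, neighbouring types agree on the arrow of
their common mid-edge, so they are the types of a configuration. All other assignments of types have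
two equal rows and drop out of the determinant on the torus. -/
theorem exists_config_of_bijective {R : Type} [CommRing R] (t : R × R → VertexType)
    (h : Function.Bijective (edgeMap t)) : ∃ σ : Config R, vertexType σ = t := by
  have hE : ∀ v : R × R, (arrows (t (headVertex (Colour.black, v)))).1 = (arrows (t v)).2.2.1 := by
    intro v
    rw [Bool.eq_iff_iff, ← not_iff_not, Bool.not_eq_true, Bool.not_eq_true]
    constructor
    · intro h1
      obtain ⟨e, he⟩ := h.2 (Colour.black, v)
      rcases outEdges_black he with ⟨h2, h3⟩ | ⟨h2, h3⟩
      · rw [← h3, headVertex_west, h2] at h1; cases h1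
      · rwa [h3] at h2
    · intro h1
      by_contra h2
      rw [Bool.not_eq_false] at h2
      obtain ⟨j, hj, hj'⟩ := exists_outEdges_eq_east v (t v) h1
      have h3 : edgeMap t (inEdges v j) = edgeMap t (inEdges (headVertex (Colour.black, v)) 0) := by
        rw [edgeMap_inEdges, edgeMap_inEdges, outEdges_eq_west _ _ h2, hj, west_headVertex]; rfl
      have h4 := inEdges_injective (a₁ := (v, j)) (a₂ := (_, _)) (h.1 h3)
      rw [Prod.mk.injEq] at h4
      have h5 : v = headVertex (Colour.black, v) := h4.1
      rw [← h5, hj' h4.2] at h2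
      cases h2
  have hN : ∀ v : R × R, (arrows (t (headVertex (Colour.white, v)))).2.1 =
      (arrows (t v)).2.2.2 := by
    intro v
    rw [Bool.eq_iff_iff, ← not_iff_not, Bool.not_eq_true, Bool.not_eq_true]
    constructor
    · intro h1
      obtain ⟨e, he⟩ := h.2 (Colour.white, v)
      rcases outEdges_white he with ⟨h2, h3⟩ | ⟨h2, h3⟩
      · rw [← h3, headVertex_south, h2] at h1; cases h1
      · rwa [h3] at h2
    · intro h1
      by_contra h2
      rw [Bool.not_eq_false] at h2
      obtain ⟨j, hj, hj'⟩ := exists_outEdges_eq_north v (t v) h1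
      have h3 : edgeMap t (inEdges v j) = edgeMap t (inEdges (headVertex (Colour.white, v)) 1) := by
        rw [edgeMap_inEdges, edgeMap_inEdges, outEdges_eq_south _ _ h2, hj, south_headVertex]; rfl
      have h4 := inEdges_injective (a₁ := (v, j)) (a₂ := (_, _)) (h.1 h3)
      rw [Prod.mk.injEq] at h4
      have h5 : v = headVertex (Colour.white, v) := h4.1
      rw [← h5, hj' h4.2] at h2
      cases h2
  let o : MidEdge R → Bool := fun e =>
    match e with
    | (.black, u) => (arrows (t (headVertex (Colour.black, u)))).1
    | (.white, u) => (arrows (t (headVertex (Colour.white, u)))).2.1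
  have ho : ∀ v, HasType o v (t v) := by
    intro v
    rw [hasType_iff]
    have h1 : o (west v) = (arrows (t v)).1 := by
      change (arrows (t (headVertex (west v)))).1 = _
      rw [headVertex_west]
    have h2 : o (south v) = (arrows (t v)).2.1 := by
      change (arrows (t (headVertex (south v)))).2.1 = _
      rw [headVertex_south]
    rw [h1, h2, show o (east v) = _ from hE v, show o (north v) = _ from hN v]
  refine ⟨⟨o, fun v => ?_⟩, ?_⟩
  · have h1 := ho v
    rw [hasType_iff] at h1
    simp only [Prod.ext_iff] at h1
    unfold inDegree outDegree
    rw [h1.1, h1.2.1, h1.2.2.1, h1.2.2.2]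
    cases t v <;> simp [arrows]
  · funext v
    exact (vertexType_eq_iff _ _ _).2 (ho v)

section torus
variable {n : ℕ} [NeZero n]

/-- The permutation of the mid-edges of the torus that fixes the unoccupied mid-edges (arrow right
or up) and moves each occupied one (arrow left or down) one step along its path. -/
noncomputable def pathPerm (σ : Config (ZMod n)) : Equiv.Perm (MidEdge (ZMod n)) :=
  Equiv.ofBijective _ (Finite.injective_iff_bijective.1
    (Finite.injective_iff_surjective.2 (edgeMap_surjective σ)))

theorem pathPerm_apply (σ : Config (ZMod n)) (e : MidEdge (ZMod n)) :
    pathPerm σ e = edgeMap (vertexType σ) e := rfl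

/-- The local weight of a vertex type, with a factor `z₁` (`z₂`) if the west (south) mid-edge is
occupied. -/
noncomputable def twistedWeight (α β γ : ℝ) (z₁ z₂ : ℂ) (t : VertexType) : ℂ :=
  freeFermionWeight α β γ t * (if (arrows t).1 then 1 else z₁) * (if (arrows t).2.1 then 1 else z₂)

/-- The matrix `1 + Z T` on the mid-edges of the torus, where `T` is the one-step transfer matrix of
paths and `Z` multiplies the rows of horizontal (vertical) mid-edges by `z₁` (`z₂`). -/
noncomputable def pathMatrix (α β γ : ℝ) (z₁ z₂ : ℂ) (n : ℕ) [NeZero n] :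
    Matrix (MidEdge (ZMod n)) (MidEdge (ZMod n)) ℂ := fun e =>
  match e with
  | (.black, u) => Pi.single (.black, u) 1 + (z₁ * α) • Pi.single (east (headVertex (.black, u))) 1
      + (z₁ * γ) • Pi.single (north (headVertex (.black, u))) 1
  | (.white, u) => Pi.single (.white, u) 1 + (z₂ * γ) • Pi.single (east (headVertex (.white, u))) 1
      + (z₂ * β) • Pi.single (north (headVertex (.white, u))) 1

theorem pathMatrix_west (α β γ : ℝ) (z₁ z₂ : ℂ) (v : ZMod n × ZMod n) :
    pathMatrix α β γ z₁ z₂ n (west v) = Pi.single (west v) 1 + (z₁ * α) • Pi.single (east v) 1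
      + (z₁ * γ) • Pi.single (north v) 1 := by
  have := headVertex_west v
  unfold west at *
  simp only [pathMatrix, this]

theorem pathMatrix_south (α β γ : ℝ) (z₁ z₂ : ℂ) (v : ZMod n × ZMod n) :
    pathMatrix α β γ z₁ z₂ n (south v) = Pi.single (south v) 1 + (z₂ * γ) • Pi.single (east v) 1
      + (z₂ * β) • Pi.single (north v) 1 := by
  have := headVertex_south v
  unfold south at *
  simp only [pathMatrix, this]

theorem sum_vertexType (f : VertexType → ℂ) :
    ∑ t, f t = f .a₁ + f .a₂ + f .b₁ + f .b₂ + f .c₁ + f .c₂ := by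
  rw [show (Finset.univ : Finset VertexType) = {.a₁, .a₂, .b₁, .b₂, .c₁, .c₂} from rfl]
  repeat rw [Finset.sum_insert (by decide)]
  rw [Finset.sum_singleton]
  ring

/-- The exterior product of the two rows at a vertex is the weighted sum over vertex types of the
exterior products of the selected basis vectors; the six weights are the `2 × 2` minors. -/
theorem det_expand_vertex (α β γ : ℝ) (z₁ z₂ : ℂ) (v : ZMod n × ZMod n)
    (G : Matrix (MidEdge (ZMod n)) (MidEdge (ZMod n)) ℂ) :
    Matrix.det ((G.updateRow (west v) (pathMatrix α β γ z₁ z₂ n (west v))).updateRow (south v)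
      (pathMatrix α β γ z₁ z₂ n (south v))) =
    ∑ t, twistedWeight α β γ z₁ z₂ t * Matrix.det ((G.updateRow (west v)
      (Pi.single (outEdges v t 0) 1)).updateRow (south v) (Pi.single (outEdges v t 1) 1)) := by
  have hne : (west v : MidEdge (ZMod n)) ≠ south v := by simp [west, south]
  set B : (MidEdge (ZMod n) → ℂ) → (MidEdge (ZMod n) → ℂ) → ℂ := fun x y =>
    Matrix.det ((G.updateRow (west v) x).updateRow (south v) y) with hB
  have add_right : ∀ x y y', B x (y + y') = B x y + B x y' := fun x y y' =>
    Matrix.det_updateRow_add _ _ _ _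
  have smul_right : ∀ x (c : ℂ) y, B x (c • y) = c * B x y := fun x c y =>
    Matrix.det_updateRow_smul _ _ _ _
  have swap : ∀ x y, B x y = Matrix.det ((G.updateRow (south v) y).updateRow (west v) x) := by
    intro x y
    simp only [hB]
    congr 1
    exact Function.update_comm hne _ _ _
  have add_left : ∀ x x' y, B (x + x') y = B x y + B x' y := fun x x' y => by
    rw [swap, swap, swap]; exact Matrix.det_updateRow_add _ _ _ _
  have smul_left : ∀ (c : ℂ) x y, B (c • x) y = c * B x y := fun c x y => by
    rw [swap, swap]; exact Matrix.det_updateRow_smul _ _ _ _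
  have self : ∀ x, B x x = 0 := fun x => by
    refine Matrix.det_zero_of_row_eq hne ?_
    rw [Matrix.updateRow_ne hne]; simp
  have anti : ∀ x y, B x y = - B y x := fun x y => by
    have h := self (x + y)
    rw [add_left, add_right, add_right, self, self] at h
    linear_combination h
  change B _ _ = ∑ t, _ * B _ _
  rw [sum_vertexType, pathMatrix_west, pathMatrix_south]
  simp only [add_right, add_left, smul_left, smul_right, self, outEdges, Matrix.cons_val_zero,
    Matrix.cons_val_one, twistedWeight, arrows, freeFermionWeight]
  rw [anti (Pi.single (east v) 1) (Pi.single (north v) 1)]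
  push_cast
  ring

end torus

/-! ### Determinants with prescribed vertex types -/

section torus
variable {n : ℕ}

/-- The matrix whose rows are given vertex by vertex. -/
def rowMatrix (g : ZMod n × ZMod n → Fin 2 → MidEdge (ZMod n) → ℂ) :
    Matrix (MidEdge (ZMod n)) (MidEdge (ZMod n)) ℂ := fun e => g (headVertex e) (headIndex e)

theorem rowMatrix_update (g : ZMod n × ZMod n → Fin 2 → MidEdge (ZMod n) → ℂ)
    (v : ZMod n × ZMod n) (q : Fin 2 → MidEdge (ZMod n) → ℂ) :
    rowMatrix (Function.update g v q) =
      ((rowMatrix g).updateRow (west v) (q 0)).updateRow (south v) (q 1) := by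
  ext1 e
  by_cases h : headVertex e = v
  · rcases e with ⟨c, u⟩
    subst h
    cases c
    · have hne : ((Colour.black, u) : MidEdge (ZMod n)) ≠ south (headVertex (Colour.black, u)) := by
        simp [south]
      rw [Matrix.updateRow_ne hne, west_headVertex, Matrix.updateRow_self]
      simp [rowMatrix, headIndex]
    · rw [south_headVertex, Matrix.updateRow_self]
      simp [rowMatrix, headIndex]
  · have h1 : e ≠ west v := fun h' => h (by rw [h', headVertex_west])
    have h2 : e ≠ south v := fun h' => h (by rw [h', headVertex_south])
    rw [Matrix.updateRow_ne h2, Matrix.updateRow_ne h1]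
    simp [rowMatrix, Function.update_of_ne h]

variable [NeZero n]

theorem det_rowMatrix_single (σ : Config (ZMod n)) :
    (rowMatrix fun v j => Pi.single (outEdges v (vertexType σ v) j) (1 : ℂ)).det =
      ((Equiv.Perm.sign (pathPerm σ) : ℤ) : ℂ) := by
  have : (rowMatrix fun v j => Pi.single (outEdges v (vertexType σ v) j) (1 : ℂ)) =
      (pathPerm σ).toPEquiv.toMatrix := by
    ext e f
    rw [PEquiv.toMatrix_apply]
    simp only [rowMatrix, Equiv.toPEquiv_apply, pathPerm_apply, edgeMap, Pi.single_apply,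
      Option.mem_def, Option.some.injEq]
    simp only [eq_comm]
  rw [this, Matrix.det_permutation]

theorem det_rowMatrix_single_of_not_injective {t : ZMod n × ZMod n → VertexType}
    (h : ¬ Function.Injective (edgeMap t)) :
    (rowMatrix fun v j => Pi.single (outEdges v (t v) j) (1 : ℂ)).det = 0 := by
  simp only [Function.Injective, not_forall] at h
  obtain ⟨e, f, h1, h2⟩ := h
  refine Matrix.det_zero_of_row_eq h2 ?_
  change (Pi.single (edgeMap t e) 1 : MidEdge (ZMod n) → ℂ) = Pi.single (edgeMap t f) 1
  rw [h1]

/-- The path matrix with the rows at the vertices constrained by `A` replaced by the basis vectors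
which the prescribed vertex type selects. -/
noncomputable def constrainedMatrix (α β γ : ℝ) (z₁ z₂ : ℂ)
    (A : ZMod n × ZMod n → Option VertexType) :
    Matrix (MidEdge (ZMod n)) (MidEdge (ZMod n)) ℂ :=
  rowMatrix fun v => (A v).elim (fun j => pathMatrix α β γ z₁ z₂ n (inEdges v j))
    (fun t j => Pi.single (outEdges v t j) 1)

/-- The expansion of the determinant over all assignments of vertex types reduces to a sum over
configurations. -/
theorem det_constrainedMatrix (α β γ : ℝ) (z₁ z₂ : ℂ) (A : ZMod n × ZMod n → Option VertexType) :
    (constrainedMatrix α β γ z₁ z₂ A).det =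
      ∑ σ : Config (ZMod n), (∏ v, (A v).elim (twistedWeight α β γ z₁ z₂ (vertexType σ v))
        (fun t => if vertexType σ v = t then 1 else 0)) *
          ((Equiv.Perm.sign (pathPerm σ) : ℤ) : ℂ) := by
  have : Nonempty VertexType := ⟨.a₁⟩
  have H := expand_all (V := ZMod n × ZMod n) (T := VertexType)
    (fun g => (rowMatrix g).det)
    (fun v => (A v).elim (fun j => pathMatrix α β γ z₁ z₂ n (inEdges v j))
      (fun t j => Pi.single (outEdges v t j) 1))
    (fun v t j => Pi.single (outEdges v t j) 1)
    (fun v t => (A v).elim (twistedWeight α β γ z₁ z₂ t) (fun s => if t = s then 1 else 0))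
    (fun v g => by
      rcases hA : A v with _ | s
      · simp only [Option.elim_none]
        rw [rowMatrix_update]
        simp only [rowMatrix_update]
        exact det_expand_vertex α β γ z₁ z₂ v _
      · simp)
  rw [constrainedMatrix]
  refine H.trans ?_
  symm
  refine Finset.sum_of_injOn vertexType vertexType_injective.injOn (by simp) ?_ ?_
  · intro t _ ht
    have : ¬ Function.Injective (edgeMap t) := fun h => ht <| by
      obtain ⟨σ, hσ⟩ := exists_config_of_bijective t (Finite.injective_iff_bijective.1 h)
      exact ⟨σ, by simp, hσ⟩
    rw [det_rowMatrix_single_of_not_injective this, mul_zero]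
  · intro σ _
    rw [det_rowMatrix_single]

theorem constrainedMatrix_none (α β γ : ℝ) (z₁ z₂ : ℂ) :
    constrainedMatrix α β γ z₁ z₂ (fun _ => none) = pathMatrix α β γ z₁ z₂ n := by
  funext e
  change pathMatrix α β γ z₁ z₂ n (inEdges (headVertex e) (headIndex e)) = _
  rw [inEdges_head]

/-- Replacing rows of an invertible matrix by basis vectors multiplies its determinant by a minor
of the inverse. -/
theorem det_replace_rows {m p : Type*} [Fintype m] [DecidableEq m] [Fintype p] [DecidableEq p]
    (K K' J : Matrix m m ℂ) (x y : p → m) (hx : Function.Injective x) (hJ : K * J = 1)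
    (h1 : ∀ i, K' (x i) = Pi.single (y i) 1) (h2 : ∀ e, e ∉ Set.range x → K' e = K e) :
    K'.det = K.det * (Matrix.of fun i j => J (y i) (x j)).det := by
  have hJ' : J * K = 1 := mul_eq_one_comm.1 hJ
  let Pm : Matrix m p ℂ := fun e i => if e = x i then 1 else 0
  let Q : Matrix p m ℂ := fun i e => J (y i) e - if e = x i then 1 else 0
  have e1 : K' * J = 1 + Pm * Q := by
    ext e f
    rw [Matrix.add_apply]
    by_cases he : e ∈ Set.range x
    · obtain ⟨i, rfl⟩ := he
      have : (Pm * Q) (x i) f = Q i f := by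
        rw [Matrix.mul_apply, Finset.sum_eq_single i]
        · simp [Pm]
        · intro j _ hj
          simp [Pm, hx.ne hj.symm]
        · simp
      rw [this, Matrix.mul_apply, h1]
      simp [Q, Pi.single_apply, Matrix.one_apply, eq_comm]
    · have : (Pm * Q) e f = 0 := by
        rw [Matrix.mul_apply]
        refine Finset.sum_eq_zero fun i _ => ?_
        have : e ≠ x i := fun h => he ⟨i, h.symm⟩
        simp [Pm, this]
      rw [this, add_zero, ← hJ, Matrix.mul_apply, Matrix.mul_apply, h2 e he]
  have e2 : 1 + Q * Pm = Matrix.of fun i j => J (y i) (x j) := by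
    ext i j
    rw [Matrix.add_apply, Matrix.mul_apply]
    simp only [Pm, Q, mul_ite, mul_one, mul_zero, Finset.sum_ite_eq', Finset.mem_univ, if_true,
      Matrix.of_apply, Matrix.one_apply, hx.eq_iff, eq_comm (a := j) (b := i)]
    ring
  rw [← e2, ← Matrix.det_one_add_mul_comm, ← e1, Matrix.det_mul, mul_comm, mul_assoc,
    ← Matrix.det_mul, hJ', Matrix.det_one, mul_one]

end torus

/-! ### Counting paths along antidiagonals -/

/-- `1` if the mid-edge is occupied by a path (arrow left or down), `0` otherwise. -/
def occ {R : Type} [CommRing R] (σ : Config R) (e : MidEdge R) : ℕ := (!σ.1 e).toNat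

theorem occ_conservation {R : Type} [CommRing R] (σ : Config R) (v : R × R) :
    occ σ (west v) + occ σ (south v) = occ σ (east v) + occ σ (north v) := by
  have h := (σ.2 v).1
  unfold inDegree at h
  unfold occ
  revert h
  cases σ.1 (west v) <;> cases σ.1 (south v) <;> cases σ.1 (east v) <;> cases σ.1 (north v) <;>
    simp

theorem ZMod.eq_of_shift_invariant {n : ℕ} [NeZero n] {X : Type*} (f : ZMod n → X)
    (h : ∀ x, f (x + 1) = f x) (x y : ZMod n) : f x = f y := by
  have key : ∀ k : ℕ, f (k : ZMod n) = f 0 := by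
    intro k
    induction k with
    | zero => simp
    | succ k ih => rw [Nat.cast_succ, h, ih]
  rw [← ZMod.natCast_zmod_val x, ← ZMod.natCast_zmod_val y, key, key]

section torus
variable {n : ℕ} [NeZero n]

/-- The number of paths of a torus configuration crossing the vertical seam: the number of occupied
horizontal mid-edges in the column `-1`. -/
def horizontalCount (σ : Config (ZMod n)) : ℕ := ∑ y : ZMod n, occ σ (.black, (-1, y))

/-- The number of paths of a torus configuration crossing the horizontal seam: the number of
occupied vertical mid-edges in the row `-1`. -/
def verticalCount (σ : Config (ZMod n)) : ℕ := ∑ x : ZMod n, occ σ (.white, (x, -1))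

theorem sum_occ_column (σ : Config (ZMod n)) (x : ZMod n) :
    ∑ y, occ σ (.black, (x, y)) = horizontalCount σ := by
  refine ZMod.eq_of_shift_invariant (fun x => ∑ y, occ σ (.black, (x, y))) (fun x => ?_) x (-1)
  have h1 : ∑ y, (occ σ (.black, (x, y)) + occ σ (.white, (x + 1, y - 1))) =
      ∑ y, (occ σ (.black, (x + 1, y)) + occ σ (.white, (x + 1, y))) :=
    Finset.sum_congr rfl fun y _ => by
      have := occ_conservation σ (x + 1, y)
      simpa [west, south, east, north] using this
  have h2 := (Equiv.subRight (1 : ZMod n)).sum_comp fun y => occ σ (.white, (x + 1, y))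
  simp only [Equiv.subRight_apply] at h2
  rw [Finset.sum_add_distrib, Finset.sum_add_distrib, h2] at h1
  exact (Nat.add_right_cancel h1).symm

theorem sum_occ_row (σ : Config (ZMod n)) (y : ZMod n) :
    ∑ x, occ σ (.white, (x, y)) = verticalCount σ := by
  refine ZMod.eq_of_shift_invariant (fun y => ∑ x, occ σ (.white, (x, y))) (fun y => ?_) y (-1)
  have h1 : ∑ x, (occ σ (.black, (x - 1, y + 1)) + occ σ (.white, (x, y))) =
      ∑ x, (occ σ (.black, (x, y + 1)) + occ σ (.white, (x, y + 1))) :=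
    Finset.sum_congr rfl fun x _ => by
      have := occ_conservation σ (x, y + 1)
      simpa [west, south, east, north] using this
  have h2 := (Equiv.subRight (1 : ZMod n)).sum_comp fun x => occ σ (.black, (x, y + 1))
  simp only [Equiv.subRight_apply] at h2
  rw [Finset.sum_add_distrib, Finset.sum_add_distrib, h2] at h1
  exact (Nat.add_left_cancel h1).symm

theorem sum_occ (σ : Config (ZMod n)) :
    ∑ e, occ σ e = n * (horizontalCount σ + verticalCount σ) := by
  have : ∀ f : Colour → ℕ, ∑ c, f c = f .black + f .white := fun f => by
    rw [show (Finset.univ : Finset Colour) = {.black, .white} from rfl,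
      Finset.sum_pair (by decide)]
  rw [Fintype.sum_prod_type, this, Fintype.sum_prod_type, Fintype.sum_prod_type_right]
  simp only [sum_occ_column, sum_occ_row, Finset.sum_const, Finset.card_univ, ZMod.card,
    smul_eq_mul]
  ring

/-- Occupation numbers along the antidiagonal `x + y = l`, in the order
west, south, west, south, … of increasing `x`. -/
def levelOcc (σ : Config (ZMod n)) (l : ZMod n) (i : ℕ) : ℕ :=
  occ σ (if i % 2 = 0 then west ((i / 2 : ℕ), l - (i / 2 : ℕ))
    else south ((i / 2 : ℕ), l - (i / 2 : ℕ)))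

theorem levelOcc_even (σ : Config (ZMod n)) (l : ZMod n) (k : ℕ) :
    levelOcc σ l (2 * k) = occ σ (west (k, l - k)) := by
  simp [levelOcc]

theorem levelOcc_odd (σ : Config (ZMod n)) (l : ZMod n) (k : ℕ) :
    levelOcc σ l (2 * k + 1) = occ σ (south (k, l - k)) := by
  have h1 : (2 * k + 1) / 2 = k := by omega
  have h2 : (2 * k + 1) % 2 = 1 := by omega
  simp [levelOcc, h1, h2]

/-- The number of occupied mid-edges among the first `i` on an antidiagonal. -/
def levelRank (σ : Config (ZMod n)) (l : ZMod n) (i : ℕ) : ℕ := ∑ j ∈ Finset.range i, levelOcc σ l j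

theorem levelRank_even_succ (σ : Config (ZMod n)) (l : ZMod n) (k : ℕ) :
    levelRank σ l (2 * (k + 1)) =
      levelRank σ l (2 * k) + occ σ (west (k, l - k)) + occ σ (south (k, l - k)) := by
  rw [show 2 * (k + 1) = 2 * k + 1 + 1 by ring, levelRank, Finset.sum_range_succ,
    Finset.sum_range_succ, levelOcc_even, levelOcc_odd]
  rfl

theorem levelRank_odd (σ : Config (ZMod n)) (l : ZMod n) (k : ℕ) :
    levelRank σ l (2 * k + 1) = levelRank σ l (2 * k) + occ σ (west (k, l - k)) := by
  rw [levelRank, Finset.sum_range_succ, levelOcc_even]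
  rfl

/-- Passing from one antidiagonal to the next shifts the ranks by the occupation number of the
seam mid-edge. -/
theorem levelRank_next (σ : Config (ZMod n)) (l : ZMod n) (k : ℕ) :
    levelRank σ (l + 1) (2 * k + 1) = levelRank σ l (2 * k) + occ σ (.black, (-1, l + 1)) := by
  induction k with
  | zero => simp [levelRank, levelOcc, west]
  | succ k ih =>
    rw [levelRank_odd, levelRank_even_succ, levelRank_even_succ, ← levelRank_odd, ih]
    have h := occ_conservation σ ((k : ZMod n), l - k)
    have h1 : west (((k + 1 : ℕ) : ZMod n), l + 1 - ((k + 1 : ℕ) : ZMod n)) =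
        east ((k : ZMod n), l - k) := by
      simp [west, east]
    have h2 : south ((k : ZMod n), l + 1 - k) = north ((k : ZMod n), l - k) := by
      simp only [south, north, Prod.mk.injEq, true_and]; ring
    rw [h1, h2]
    omega

theorem sum_zmod_eq_range {n : ℕ} [NeZero n] {M : Type*} [AddCommMonoid M] (f : ZMod n → M) :
    ∑ x, f x = ∑ k ∈ Finset.range n, f (k : ZMod n) := by
  symm
  refine Finset.sum_bij' (fun k _ => (k : ZMod n)) (fun x _ => x.val) (by simp)
    (fun x _ => by simpa using ZMod.val_lt x) (fun k hk => ?_) (by simp) (by simp)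
  exact ZMod.val_cast_of_lt (by simpa using hk)

theorem levelRank_eq_sum (σ : Config (ZMod n)) (l : ZMod n) :
    levelRank σ l (2 * n) = ∑ x, (occ σ (west (x, l - x)) + occ σ (south (x, l - x))) := by
  rw [sum_zmod_eq_range fun x => occ σ (west (x, l - x)) + occ σ (south (x, l - x))]
  have : ∀ k, levelRank σ l (2 * k) =
      ∑ j ∈ Finset.range k, (occ σ (west (j, l - j)) + occ σ (south (j, l - j))) := by
    intro k
    induction k with
    | zero => simp [levelRank]
    | succ k ih => rw [levelRank_even_succ, Finset.sum_range_succ, ih]; ring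
  exact this n

/-- The mid-edges of the torus, indexed by antidiagonal, position and colour. -/
def levelEquiv : MidEdge (ZMod n) ≃ ZMod n × ZMod n × Fin 2 where
  toFun e := ((headVertex e).1 + (headVertex e).2, (headVertex e).1, headIndex e)
  invFun p := inEdges (p.2.1, p.1 - p.2.1) p.2.2
  left_inv e := by simp [inEdges_head]
  right_inv p := by
    have := head_inEdges (p.2.1, p.1 - p.2.1) p.2.2
    simp [this]

/-- Every antidiagonal carries the same number of occupied mid-edges. -/
theorem levelRank_total (σ : Config (ZMod n)) (l : ZMod n) :
    levelRank σ l (2 * n) = horizontalCount σ + verticalCount σ := by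
  have hc : ∀ l', levelRank σ l' (2 * n) = levelRank σ l (2 * n) := by
    intro l'
    refine ZMod.eq_of_shift_invariant (fun l => levelRank σ l (2 * n)) (fun l => ?_) l' l
    obtain ⟨k, hk⟩ : ∃ k, n = k + 1 := Nat.exists_eq_succ_of_ne_zero (NeZero.ne n)
    have h1 := levelRank_next σ l n
    rw [levelRank_odd] at h1
    have h2 : west ((n : ZMod n), l + 1 - (n : ZMod n)) = (Colour.black, ((-1 : ZMod n), l + 1)) := by
      simp [west]
    rw [h2] at h1
    exact Nat.add_right_cancel h1
  have h : ∑ l', levelRank σ l' (2 * n) = n * (horizontalCount σ + verticalCount σ) := by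
    rw [← sum_occ, ← levelEquiv.symm.sum_comp, Fintype.sum_prod_type]
    refine Finset.sum_congr rfl fun l' _ => ?_
    rw [levelRank_eq_sum, Fintype.sum_prod_type]
    refine Finset.sum_congr rfl fun x _ => ?_
    rw [Fin.sum_univ_two]
    rfl
  simp only [hc, Finset.sum_const, Finset.card_univ, ZMod.card, smul_eq_mul] at h
  exact Nat.eq_of_mul_eq_mul_left (Nat.pos_of_ne_zero (NeZero.ne n)) h

/-- Position of a mid-edge on its antidiagonal. -/
def levelPos (e : MidEdge (ZMod n)) : ℕ := 2 * (headVertex e).1.val + (headIndex e).val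

/-- The antidiagonal of a mid-edge. -/
def level (e : MidEdge (ZMod n)) : ZMod n := (headVertex e).1 + (headVertex e).2

theorem levelPos_lt (e : MidEdge (ZMod n)) : levelPos e < 2 * n := by
  have := ZMod.val_lt (headVertex e).1
  have := (headIndex e).2
  unfold levelPos; omega

theorem levelOcc_levelPos (σ : Config (ZMod n)) (e : MidEdge (ZMod n)) :
    levelOcc σ (level e) (levelPos e) = occ σ e := by
  rcases e with ⟨c, u⟩
  cases c
  · have h : levelPos (Colour.black, u) = 2 * (headVertex (Colour.black, u)).1.val := by
      simp [levelPos, headIndex]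
    rw [h, levelOcc_even]
    simp [level]
  · have h : levelPos (Colour.white, u) = 2 * (headVertex (Colour.white, u)).1.val + 1 := by
      simp [levelPos, headIndex]
    rw [h, levelOcc_odd]
    simp [level]

theorem levelRank_mono (σ : Config (ZMod n)) (l : ZMod n) : Monotone (levelRank σ l) := by
  intro i j hij
  exact Finset.sum_le_sum_of_subset (Finset.range_mono hij)

theorem levelRank_lt (σ : Config (ZMod n)) (e : MidEdge (ZMod n)) (he : occ σ e = 1) {i : ℕ}
    (h : levelPos e < i) : levelRank σ (level e) (levelPos e) < levelRank σ (level e) i := by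
  have h1 := levelRank_mono σ (level e) (Nat.succ_le_of_lt h)
  have h2 : levelRank σ (level e) (levelPos e).succ =
      levelRank σ (level e) (levelPos e) + 1 := by
    rw [levelRank, Finset.sum_range_succ, levelOcc_levelPos, he]; rfl
  omega

end torus

/-! ### The sign of the path permutation -/

section torus
variable {n : ℕ} [NeZero n]

theorem occ_eq_one_iff {R : Type} [CommRing R] (σ : Config R) (e : MidEdge R) :
    occ σ e = 1 ↔ σ.1 e = false := by
  unfold occ; cases σ.1 e <;> simp

theorem pathPerm_of_not_occ (σ : Config (ZMod n)) (e : MidEdge (ZMod n)) (he : σ.1 e = true) :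
    pathPerm σ e = e := by
  rw [pathPerm_apply]
  rcases e with ⟨c, u⟩
  have h := arrows_vertexType σ (headVertex (c, u))
  unfold edgeMap
  cases c
  · rw [west_headVertex, he] at h
    revert h
    cases vertexType σ (headVertex (Colour.black, u)) <;> simp [arrows, outEdges, headIndex]
  · rw [south_headVertex, he] at h
    revert h
    cases vertexType σ (headVertex (Colour.white, u)) <;> simp [arrows, outEdges, headIndex]

/-- An occupied mid-edge is moved either across its head in the same direction or around the
corner; the occupation numbers at the head record which other mid-edges are used. -/
theorem pathPerm_of_occ (σ : Config (ZMod n)) (e : MidEdge (ZMod n)) (he : σ.1 e = false) :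
    σ.1 (pathPerm σ e) = false ∧
    ((pathPerm σ e = north (headVertex e) ∧
        occ σ (west (headVertex e)) * (headIndex e).val = 0) ∨
      (pathPerm σ e = east (headVertex e) ∧
        occ σ (north (headVertex e)) = occ σ (west (headVertex e)) * (headIndex e).val)) := by
  rw [pathPerm_apply]
  rcases e with ⟨c, u⟩
  have h := (arrows_vertexType σ (headVertex (c, u))).symm
  unfold edgeMap occ
  cases c
  · rw [west_headVertex, he] at h
    rw [west_headVertex, he]
    revert h
    cases vertexType σ (headVertex (Colour.black, u)) <;>
      simp +contextual [arrows, outEdges, headIndex]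
  · rw [south_headVertex, he] at h
    revert h
    cases vertexType σ (headVertex (Colour.white, u)) <;>
      simp +contextual [arrows, outEdges, headIndex]

theorem pathPerm_occ_iff (σ : Config (ZMod n)) (e : MidEdge (ZMod n)) :
    occ σ (pathPerm σ e) = 1 ↔ occ σ e = 1 := by
  rw [occ_eq_one_iff, occ_eq_one_iff]
  constructor
  · intro h
    by_contra h'
    rw [Bool.not_eq_false] at h'
    rw [pathPerm_of_not_occ σ e h', h'] at h
    cases h
  · intro h
    exact (pathPerm_of_occ σ e h).1

/-- The rank at the position following `x`, read modulo the number of paths, is insensitive to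
wrapping around the torus. -/
theorem levelRank_val_add_one (σ : Config (ZMod n)) (l x : ZMod n) :
    ((levelRank σ l (2 * (x + 1).val) : ℕ) : ZMod (horizontalCount σ + verticalCount σ)) =
      ((levelRank σ l (2 * (x.val + 1)) : ℕ) : ZMod (horizontalCount σ + verticalCount σ)) := by
  have hx := ZMod.val_lt x
  rcases Nat.lt_or_ge (x.val + 1) n with h | h
  · rw [ZMod.val_add_of_lt]
    · rcases Nat.lt_or_ge 1 n with h1 | h1
      · have : Fact (1 < n) := ⟨h1⟩
        rw [ZMod.val_one]
      · omega
    · rcases Nat.lt_or_ge 1 n with h1 | h1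
      · have : Fact (1 < n) := ⟨h1⟩
        rwa [ZMod.val_one]
      · omega
  · have h1 : x.val + 1 = n := by omega
    have h2 : x + 1 = 0 := by
      have := congrArg (Nat.cast : ℕ → ZMod n) h1
      simpa using this
    rw [h1, h2, levelRank_total]
    simp [levelRank]

/-- Following the paths by one step increases the antidiagonal by one and rotates the ranks by the
occupation number of the seam mid-edge. -/
theorem levelRank_pathPerm (σ : Config (ZMod n)) (e : MidEdge (ZMod n)) (he : occ σ e = 1) :
    level (pathPerm σ e) = level e + 1 ∧
    ((levelRank σ (level (pathPerm σ e)) (levelPos (pathPerm σ e)) : ℕ) :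
        ZMod (horizontalCount σ + verticalCount σ)) =
      ((levelRank σ (level e) (levelPos e) : ℕ) : ZMod (horizontalCount σ + verticalCount σ)) +
        (occ σ (.black, (-1, level e + 1)) : ℕ) := by
  obtain ⟨h0, h⟩ := pathPerm_of_occ σ e ((occ_eq_one_iff _ _).1 he)
  set v := headVertex e with hv
  have hval : ((v.1.val : ℕ) : ZMod n) = v.1 := ZMod.natCast_zmod_val _
  have hl : level e = v.1 + v.2 := rfl
  have hvv : v = (((v.1.val : ℕ) : ZMod n), level e - ((v.1.val : ℕ) : ZMod n)) := by
    rw [hval, hl]; simp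
  have hrank : levelRank σ (level e) (levelPos e) =
      levelRank σ (level e) (2 * v.1.val) + occ σ (west v) * (headIndex e).val := by
    rw [levelPos, ← hv]
    have : (headIndex e).val = 0 ∨ (headIndex e).val = 1 := by omega
    rcases this with h1 | h1
    · simp [h1]
    · rw [h1, levelRank_odd, ← hvv]; simp
  have hnext := levelRank_next σ (level e) v.1.val
  rcases h with ⟨h1, h2⟩ | ⟨h1, h2⟩
  · have e1 : level (pathPerm σ e) = level e + 1 := by
      rw [h1, hl]; simp [level, headVertex, north]; ring
    refine ⟨e1, ?_⟩
    rw [e1]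
    have e2 : levelPos (pathPerm σ e) = 2 * v.1.val + 1 := by
      rw [h1]; simp [levelPos, headVertex, headIndex, north]
    rw [e2, hnext, hrank, h2]
    push_cast; ring
  · have e1 : level (pathPerm σ e) = level e + 1 := by
      rw [h1, hl]; simp [level, headVertex, east]; ring
    refine ⟨e1, ?_⟩
    rw [e1]
    have e2 : levelPos (pathPerm σ e) = 2 * (v.1 + 1).val := by
      rw [h1]; simp [levelPos, headVertex, headIndex, east]
    have e3 : south ((v.1.val : ZMod n), level e + 1 - (v.1.val : ZMod n)) = north v := by
      rw [hval, hl]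
      exact Prod.ext rfl (Prod.ext rfl (by simp only [south, north]; ring))
    rw [e2, levelRank_val_add_one, levelRank_even_succ, ← levelRank_odd, hnext, hrank, e3, h2]
    push_cast; ring

theorem sign_addRight_one (k : ℕ) [NeZero k] :
    Equiv.Perm.sign (Equiv.addRight (1 : ZMod k)) = (-1) ^ (k - 1) := by
  obtain ⟨m, rfl⟩ := Nat.exists_eq_succ_of_ne_zero (NeZero.ne k)
  have : (Equiv.addRight (1 : ZMod (m + 1))) = finRotate (m + 1) := by
    ext1 i
    exact (finRotate_apply (n := m + 1) i).symm
  rw [this]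
  exact sign_finRotate (m + 1)

/-- The sign of the path permutation depends only on the homology class of the paths. -/
theorem sign_pathPerm (σ : Config (ZMod n)) :
    ((Equiv.Perm.sign (pathPerm σ) : ℤ)) =
      (-1) ^ ((n + 1) * (horizontalCount σ + verticalCount σ) +
        horizontalCount σ * verticalCount σ) := by
  set m := horizontalCount σ + verticalCount σ with hm
  rcases Nat.eq_zero_or_pos m with h0 | hpos
  · have h1 : ∀ e, σ.1 e = true := by
      have h2 : ∑ e, occ σ e = 0 := by rw [sum_occ, ← hm, h0, mul_zero]
      intro e
      have := (Finset.sum_eq_zero_iff.1 h2) e (Finset.mem_univ _)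
      unfold occ at this
      revert this
      cases σ.1 e <;> simp
    have h3 : pathPerm σ = 1 := Equiv.ext fun e => pathPerm_of_not_occ σ e (h1 e)
    have h4 : horizontalCount σ = 0 := by omega
    rw [h3, h0, h4]; simp
  · have : NeZero m := ⟨hpos.ne'⟩
    let p : MidEdge (ZMod n) → Prop := fun e => occ σ e = 1
    have hp : ∀ e, p (pathPerm σ e) ↔ p e := pathPerm_occ_iff σ
    have s1 : Equiv.Perm.sign ((pathPerm σ).subtypePerm hp) = Equiv.Perm.sign (pathPerm σ) := by
      refine Equiv.Perm.sign_subtypePerm _ hp fun e he => ?_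
      rw [show p e ↔ occ σ e = 1 from Iff.rfl, occ_eq_one_iff]
      by_contra h
      exact he (pathPerm_of_not_occ σ e (by simpa using h))
    -- With the antidiagonal and the rank as coordinates of the occupied mid-edges, the permutation
    -- becomes `g` below: it rotates the ranks by `c` and shifts the antidiagonal.
    let Ψ : {e // p e} → ZMod n × ZMod m := fun e =>
      (level e.1, ((levelRank σ (level e.1) (levelPos e.1) : ℕ) : ZMod m))
    have hΨ : Function.Injective Ψ := by
      rintro ⟨e, he⟩ ⟨f, hf⟩ h
      have hlev : level e = level f := congrArg Prod.fst h
      have hr : ((levelRank σ (level e) (levelPos e) : ℕ) : ZMod m) =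
          ((levelRank σ (level f) (levelPos f) : ℕ) : ZMod m) := congrArg Prod.snd h
      have he' := levelRank_lt σ e he (levelPos_lt e)
      have hf' := levelRank_lt σ f hf (levelPos_lt f)
      rw [levelRank_total, ← hm] at he' hf'
      have hr' : levelRank σ (level e) (levelPos e) = levelRank σ (level f) (levelPos f) := by
        have := congrArg ZMod.val hr
        rwa [ZMod.val_cast_of_lt he', ZMod.val_cast_of_lt hf'] at this
      have hpos : levelPos e = levelPos f := by
        rcases lt_trichotomy (levelPos e) (levelPos f) with h1 | h1 | h1
        · have := levelRank_lt σ e he h1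
          rw [hr', hlev] at this
          exact absurd this (lt_irrefl _)
        · exact h1
        · have := levelRank_lt σ f hf h1
          rw [← hr', hlev] at this
          exact absurd this (lt_irrefl _)
      have e1 : (headVertex e).1 = (headVertex f).1 := by
        apply ZMod.val_injective
        unfold levelPos at hpos
        have := (headIndex e).2
        have := (headIndex f).2
        omega
      have e2 : headIndex e = headIndex f := by
        apply Fin.ext
        unfold levelPos at hpos
        rw [e1] at hpos
        omega
      have e3 : levelEquiv e = levelEquiv f := by
        refine Prod.ext hlev (Prod.ext e1 e2)
      exact Subtype.ext (levelEquiv.injective e3)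
    have hcard : Fintype.card {e // p e} = Fintype.card (ZMod n × ZMod m) := by
      rw [Fintype.card_subtype, Fintype.card_prod, ZMod.card, ZMod.card, hm, ← sum_occ,
        Finset.card_eq_sum_ones, Finset.sum_filter]
      refine Finset.sum_congr rfl fun e _ => ?_
      have : occ σ e = 0 ∨ occ σ e = 1 := by
        unfold occ; cases σ.1 e <;> simp
      rcases this with h | h <;> simp [p, h]
    let Ψe : {e // p e} ≃ ZMod n × ZMod m :=
      Equiv.ofBijective Ψ ((Fintype.bijective_iff_injective_and_card Ψ).2 ⟨hΨ, hcard⟩)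
    let c : ZMod n → ZMod m := fun l => ((occ σ (.black, (-1, l + 1)) : ℕ) : ZMod m)
    let g : Equiv.Perm (ZMod n × ZMod m) :=
      Equiv.prodCongrLeft (fun _ : ZMod m => Equiv.addRight (1 : ZMod n)) *
        Equiv.prodCongrRight (fun l => Equiv.addRight (c l))
    have s2 : Equiv.Perm.sign ((pathPerm σ).subtypePerm hp) = Equiv.Perm.sign g := by
      refine Equiv.Perm.sign_eq_sign_of_equiv _ _ Ψe ?_
      rintro ⟨e, he⟩
      obtain ⟨h1, h2⟩ := levelRank_pathPerm σ e he
      exact Prod.ext h1 h2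
    have s3 : ∀ l, Equiv.Perm.sign (Equiv.addRight (c l)) =
        (-1) ^ ((m - 1) * occ σ (.black, (-1, l + 1))) := by
      intro l
      have : occ σ (.black, (-1, l + 1)) = 0 ∨ occ σ (.black, (-1, l + 1)) = 1 := by
        unfold occ; cases σ.1 (.black, (-1, l + 1)) <;> simp
      rcases this with h | h
      · have : Equiv.addRight (c l) = 1 := by ext1 x; simp [c, h]
        rw [this, h]; simp
      · have : c l = 1 := by simp [c, h]
        rw [this, h, sign_addRight_one, mul_one]
    have s4 : ∑ l : ZMod n, occ σ (.black, (-1, l + 1)) = horizontalCount σ :=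
      Equiv.sum_comp (Equiv.addRight (1 : ZMod n)) fun y => occ σ (.black, (-1, y))
    have s5 : Equiv.Perm.sign g = (-1) ^ ((n - 1) * m + (m - 1) * horizontalCount σ) := by
      rw [Equiv.Perm.sign_mul, Equiv.Perm.sign_prodCongrLeft, Equiv.Perm.sign_prodCongrRight]
      simp only [s3, sign_addRight_one]
      rw [Finset.prod_const, Finset.card_univ, ZMod.card, ← pow_mul, Finset.prod_pow_eq_pow_sum,
        ← Finset.mul_sum, s4, ← pow_add]
    rw [← s1, s2, s5]
    push_cast
    refine neg_one_pow_congr ?_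
    obtain ⟨k, hk⟩ : ∃ k, n = k + 1 := Nat.exists_eq_succ_of_ne_zero (NeZero.ne n)
    obtain ⟨j, hj⟩ : ∃ j, m = j + 1 := Nat.exists_eq_succ_of_ne_zero hpos.ne'
    have hpar : Even (horizontalCount σ + verticalCount σ) ↔ Even (j + 1) := by rw [← hm, hj]
    rw [show n - 1 = k by omega, show n + 1 = k + 1 + 1 by omega, show m - 1 = j by omega, hj]
    simp only [Nat.even_add, Nat.even_mul, Nat.not_even_one, iff_false] at hpar ⊢
    tauto

end torus

/-! ### Signed sums as determinants -/

/-- The Fourier symbol of the path matrix. It is conjugate to `kernelMatrix`, without half-integer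
powers. -/
noncomputable def symbolMatrix (α β γ : ℝ) (w₁ w₂ : ℂ) : Matrix Colour Colour ℂ
  | .black, .black => 1 + α * w₁
  | .black, .white => γ * w₁
  | .white, .black => γ * w₂
  | .white, .white => 1 + β * w₂

theorem sum_colour {M : Type*} [AddCommMonoid M] (f : Colour → M) :
    ∑ c, f c = f .black + f .white := by
  rw [show (Finset.univ : Finset Colour) = {.black, .white} from rfl, Finset.sum_pair (by decide)]

theorem det_colour (M : Matrix Colour Colour ℂ) :
    M.det = M .black .black * M .white .white - M .black .white * M .white .black := by
  let e : Fin 2 ≃ Colour :=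
    { toFun := ![.black, .white]
      invFun := fun c => match c with
        | .black => 0
        | .white => 1
      left_inv := fun i => by fin_cases i <;> rfl
      right_inv := fun c => by cases c <;> rfl }
  rw [← Matrix.det_submatrix_equiv_self e, Matrix.det_fin_two]
  rfl

/-- The adjugate of a two by two matrix indexed by colours. -/
def adjugateColour (M : Matrix Colour Colour ℂ) : Matrix Colour Colour ℂ
  | .black, .black => M .white .white
  | .black, .white => -M .black .white
  | .white, .black => -M .white .black
  | .white, .white => M .black .black

theorem inv_colour (M : Matrix Colour Colour ℂ) (h : M.det ≠ 0) (c c' : Colour) :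
    M⁻¹ c c' = adjugateColour M c c' / M.det := by
  have : M⁻¹ = M.det⁻¹ • adjugateColour M := by
    refine Matrix.inv_eq_right_inv ?_
    rw [Matrix.mul_smul, inv_smul_eq_iff₀ h]
    ext c c'
    rw [Matrix.mul_apply, sum_colour, Matrix.smul_apply, det_colour]
    cases c <;> cases c' <;> simp [adjugateColour] <;> ring
  rw [this, Matrix.smul_apply, smul_eq_mul, div_eq_inv_mul]

section torus
variable {n : ℕ} [NeZero n]

/-- The signed and weighted sum over a set of torus configurations, in which the numbers of paths
crossing the two seams are recorded by `ε` and `η`. -/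
noncomputable def signedSum (α β γ : ℝ) (S : Finset (Config (ZMod n))) (ε η : ℂ) : ℂ :=
  ∑ σ ∈ S, (-1) ^ (horizontalCount σ * verticalCount σ) * weight (freeFermionWeight α β γ) σ *
    ε ^ horizontalCount σ * η ^ verticalCount σ

theorem ite_arrow_eq_pow (σ : Config (ZMod n)) (e : MidEdge (ZMod n)) (z : ℂ) :
    (if σ.1 e then 1 else z) = z ^ occ σ e := by
  unfold occ
  cases σ.1 e <;> simp

theorem prod_twistedWeight (α β γ : ℝ) (z₁ z₂ : ℂ) (σ : Config (ZMod n)) :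
    ∏ v, twistedWeight α β γ z₁ z₂ (vertexType σ v) =
      weight (freeFermionWeight α β γ) σ * (z₁ ^ n) ^ horizontalCount σ *
        (z₂ ^ n) ^ verticalCount σ := by
  have h1 : ∑ v : ZMod n × ZMod n, occ σ (west v) = n * horizontalCount σ := by
    have : ∀ x y, occ σ (west (x, y)) = occ σ (.black, (x - 1, y)) := fun x y => rfl
    rw [Fintype.sum_prod_type]
    simp only [this, sum_occ_column, Finset.sum_const, Finset.card_univ, ZMod.card, smul_eq_mul]
  have h2 : ∑ v : ZMod n × ZMod n, occ σ (south v) = n * verticalCount σ := by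
    have : ∀ x y, occ σ (south (x, y)) = occ σ (.white, (x, y - 1)) := fun x y => rfl
    rw [Fintype.sum_prod_type_right]
    simp only [this, sum_occ_row, Finset.sum_const, Finset.card_univ, ZMod.card, smul_eq_mul]
  simp only [twistedWeight, arrows_vertexType, ite_arrow_eq_pow]
  rw [Finset.prod_mul_distrib, Finset.prod_mul_distrib, Finset.prod_pow_eq_pow_sum,
    Finset.prod_pow_eq_pow_sum, h1, h2, pow_mul, pow_mul, weight]
  push_cast
  rfl

/-- The configurations with prescribed types at given vertices. -/
noncomputable def typeEvent {k : ℕ} (v : Fin k → ZMod n × ZMod n) (t : Fin k → VertexType) :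
    Finset (Config (ZMod n)) :=
  letI := Classical.decPred fun σ : Config (ZMod n) => ∀ i, vertexType σ (v i) = t i
  Finset.univ.filter fun σ => ∀ i, vertexType σ (v i) = t i

open Classical in
/-- The prescription of the types `t` at the vertices `v`. -/
noncomputable def prescription {k : ℕ} (v : Fin k → ZMod n × ZMod n) (t : Fin k → VertexType)
    (w : ZMod n × ZMod n) : Option VertexType :=
  if h : ∃ i, v i = w then some (t h.choose) else none

theorem prescription_apply {k : ℕ} {v : Fin k → ZMod n × ZMod n} (hv : Function.Injective v)
    (t : Fin k → VertexType) (i : Fin k) : prescription v t (v i) = some (t i) := by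
  have h : ∃ j, v j = v i := ⟨i, rfl⟩
  rw [prescription, dif_pos h, hv h.choose_spec]

theorem prescription_of_notMem {k : ℕ} {v : Fin k → ZMod n × ZMod n}
    (t : Fin k → VertexType) {w : ZMod n × ZMod n} (hw : ∀ i, v i ≠ w) :
    prescription v t w = none := by
  rw [prescription, dif_neg]
  rintro ⟨i, hi⟩
  exact hw i hi

theorem neg_one_pow_combine (a b m h : ℕ) (x y : ℂ) :
    (-1 : ℂ) ^ (m * (a + b) + h) * (x ^ a * y ^ b) =
      (-1) ^ h * (((-1) ^ m * x) ^ a * ((-1) ^ m * y) ^ b) := by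
  rw [mul_pow, mul_pow, ← pow_mul, ← pow_mul, pow_add, mul_add, pow_add]; ring

/-- The sign of the path permutation is absorbed by the factors `(-1) ^ (n + 1)` of the seam
parameters and the sign `(-1) ^ (hv)` of `signedSum`. -/
theorem signedSum_univ_eq_det (α β γ : ℝ) (z₁ z₂ : ℂ) :
    signedSum α β γ (Finset.univ : Finset (Config (ZMod n))) ((-1) ^ (n + 1) * z₁ ^ n)
      ((-1) ^ (n + 1) * z₂ ^ n) = (pathMatrix α β γ z₁ z₂ n).det := by
  rw [← constrainedMatrix_none, det_constrainedMatrix, signedSum]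
  refine Finset.sum_congr rfl fun σ _ => ?_
  simp only [Option.elim_none]
  rw [prod_twistedWeight, sign_pathPerm]
  push_cast
  have := neg_one_pow_combine (horizontalCount σ) (verticalCount σ) (n + 1)
    (horizontalCount σ * verticalCount σ) (z₁ ^ n) (z₂ ^ n)
  linear_combination (-(weight (freeFermionWeight α β γ) σ : ℂ)) * this

theorem signedSum_typeEvent_eq_det (α β γ : ℝ) (z₁ z₂ : ℂ) {k : ℕ} {v : Fin k → ZMod n × ZMod n}
    (hv : Function.Injective v) (t : Fin k → VertexType) :
    signedSum α β γ (typeEvent v t) ((-1) ^ (n + 1) * z₁ ^ n) ((-1) ^ (n + 1) * z₂ ^ n) =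
      (∏ i, twistedWeight α β γ z₁ z₂ (t i)) *
        (constrainedMatrix α β γ z₁ z₂ (prescription v t)).det := by
  classical
  rw [det_constrainedMatrix, signedSum, typeEvent, Finset.sum_filter, Finset.mul_sum]
  refine Finset.sum_congr rfl fun σ _ => ?_
  have hsplit : ∀ f : ZMod n × ZMod n → ℂ, ∏ w, f w =
      (∏ i, f (v i)) * ∏ w ∈ Finset.univ.filter (fun w => ∀ i, v i ≠ w), f w := by
    intro f
    rw [← Finset.prod_filter_mul_prod_filter_not Finset.univ (fun w => ∃ i, v i = w)]
    congr 1
    · rw [← Finset.prod_image (s := Finset.univ) (g := v) (f := f) (fun i _ j _ h => hv h)]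
      refine Finset.prod_congr ?_ fun _ _ => rfl
      ext w; simp
    · refine Finset.prod_congr ?_ fun _ _ => rfl
      ext w; simp
  rw [hsplit]
  have h1 : ∏ w ∈ Finset.univ.filter (fun w => ∀ i, v i ≠ w),
      (prescription v t w).elim (twistedWeight α β γ z₁ z₂ (vertexType σ w))
        (fun t => if vertexType σ w = t then 1 else 0) =
      ∏ w ∈ Finset.univ.filter (fun w => ∀ i, v i ≠ w),
        twistedWeight α β γ z₁ z₂ (vertexType σ w) :=
    Finset.prod_congr rfl fun w hw => by
      rw [prescription_of_notMem t (Finset.mem_filter.1 hw).2, Option.elim_none]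
  rw [h1]
  simp only [prescription_apply hv, Option.elim_some]
  split_ifs with h
  · simp only [h, if_true, Finset.prod_const_one, one_mul]
    have h2 := prod_twistedWeight α β γ z₁ z₂ σ
    rw [hsplit] at h2
    simp only [h] at h2
    rw [← mul_assoc, h2, sign_pathPerm]
    push_cast
    have := neg_one_pow_combine (horizontalCount σ) (verticalCount σ) (n + 1)
      (horizontalCount σ * verticalCount σ) (z₁ ^ n) (z₂ ^ n)
    linear_combination (-(weight (freeFermionWeight α β γ) σ : ℂ)) * this
  · obtain ⟨i, hi⟩ := not_forall.1 h
    have h2 : ∏ i, (if vertexType σ (v i) = t i then (1 : ℂ) else 0) = 0 :=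
      Finset.prod_eq_zero (Finset.mem_univ i) (if_neg hi)
    rw [h2]
    ring

end torus

/-! ### Fourier diagonalization of the path matrix -/

section torus
variable {n : ℕ} [NeZero n]

/-- The `n`-th root of unity `exp (2πik/n)`. -/
noncomputable def rootChar (k : ZMod n) : ℂ := ZMod.stdAddChar k

theorem rootChar_add (k l : ZMod n) : rootChar (k + l) = rootChar k * rootChar l :=
  AddChar.map_add_eq_mul _ _ _

theorem rootChar_zero : rootChar (0 : ZMod n) = 1 := AddChar.map_zero_eq_one _

theorem rootChar_ne_zero (k : ZMod n) : rootChar k ≠ 0 := by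
  intro h
  have := rootChar_add k (-k)
  rw [h, add_neg_cancel, rootChar_zero, zero_mul] at this
  exact one_ne_zero this

theorem rootChar_mul_intCast (k : ZMod n) (j : ℤ) : rootChar (k * (j : ZMod n)) = rootChar k ^ j := by
  rw [mul_comm, ← zsmul_eq_mul]
  exact AddChar.map_zsmul_eq_zpow _ _ _

theorem rootChar_pow_card (k : ZMod n) : rootChar k ^ n = 1 := by
  have := rootChar_mul_intCast k n
  rw [Int.cast_natCast, ZMod.natCast_self, mul_zero, rootChar_zero, zpow_natCast] at this
  exact this.symm

theorem sum_rootChar (d : ZMod n) :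
    ∑ k : ZMod n, rootChar (k * d) = if d = 0 then (n : ℂ) else 0 := by
  have := AddChar.sum_mulShift d (ZMod.isPrimitive_stdAddChar n)
  simpa [rootChar] using this

/-- The two-dimensional character with frequency `k`. -/
noncomputable def torusChar (k u : ZMod n × ZMod n) : ℂ := rootChar (k.1 * u.1) * rootChar (k.2 * u.2)

theorem torusChar_add (k u u' : ZMod n × ZMod n) :
    torusChar k (u + u') = torusChar k u * torusChar k u' := by
  simp only [torusChar, Prod.fst_add, Prod.snd_add, mul_add, rootChar_add]; ring

theorem sum_torusChar (d : ZMod n × ZMod n) :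
    ∑ k, torusChar k d = if d = 0 then (n : ℂ) ^ 2 else 0 := by
  simp only [torusChar, Fintype.sum_prod_type, ← Finset.mul_sum, ← Finset.sum_mul, sum_rootChar]
  rcases d with ⟨d₁, d₂⟩
  by_cases h1 : d₁ = 0 <;> by_cases h2 : d₂ = 0 <;> simp [h1, h2, pow_two]

theorem torusChar_right (k u : ZMod n × ZMod n) :
    torusChar k (u.1 + 1, u.2) = torusChar k u * rootChar k.1 := by
  simp only [torusChar, mul_add, rootChar_add, mul_one]; ring

theorem torusChar_up (k u : ZMod n × ZMod n) :
    torusChar k (u.1, u.2 + 1) = torusChar k u * rootChar k.2 := by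
  simp only [torusChar, mul_add, rootChar_add, mul_one]; ring

/-- The symbol at the twisted frequency `k`. -/
noncomputable def symbolAt (α β γ : ℝ) (z₁ z₂ : ℂ) (k : ZMod n × ZMod n) : Matrix Colour Colour ℂ :=
  symbolMatrix α β γ (z₁ * rootChar k.1) (z₂ * rootChar k.2)

/-- The action of the path matrix on a vector-valued plane wave is given by the symbol. -/
theorem pathMatrix_mul_wave (α β γ : ℝ) (z₁ z₂ : ℂ) (k : ZMod n × ZMod n) (f : Colour → ℂ)
    (e : MidEdge (ZMod n)) :
    ∑ e', pathMatrix α β γ z₁ z₂ n e e' * (torusChar k e'.2 * f e'.1) =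
      torusChar k e.2 * ∑ c, symbolAt α β γ z₁ z₂ k e.1 c * f c := by
  have key : ∀ (e : MidEdge (ZMod n)) (g : MidEdge (ZMod n) → ℂ),
      ∑ e', (Pi.single e (1 : ℂ) : MidEdge (ZMod n) → ℂ) e' * g e' = g e := by
    intro e g
    rw [Finset.sum_eq_single e]
    · simp
    · intro e' _ he'
      simp [he']
    · simp
  rcases e with ⟨c, u⟩
  rw [sum_colour]
  cases c
  · simp only [pathMatrix, Pi.add_apply, Pi.smul_apply, smul_eq_mul, add_mul, mul_assoc,
      Finset.sum_add_distrib, ← Finset.mul_sum, key]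
    simp only [east, north, headVertex, torusChar_right, symbolAt, symbolMatrix]
    ring
  · simp only [pathMatrix, Pi.add_apply, Pi.smul_apply, smul_eq_mul, add_mul, mul_assoc,
      Finset.sum_add_distrib, ← Finset.mul_sum, key]
    simp only [east, north, headVertex, torusChar_up, symbolAt, symbolMatrix]
    ring

/-- The determinant of the path matrix is the product of the determinants of the symbol. -/
theorem det_pathMatrix (α β γ : ℝ) (z₁ z₂ : ℂ) :
    (pathMatrix α β γ z₁ z₂ n).det = ∏ k : ZMod n × ZMod n, (symbolAt α β γ z₁ z₂ k).det := by
  let Φ : Matrix (MidEdge (ZMod n)) (MidEdge (ZMod n)) ℂ := fun e e' =>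
    if e.1 = e'.1 then torusChar e'.2 e.2 else 0
  let Φ' : Matrix (MidEdge (ZMod n)) (MidEdge (ZMod n)) ℂ := fun e e' =>
    if e.1 = e'.1 then ((n : ℂ) ^ 2)⁻¹ * torusChar e.2 (-e'.2) else 0
  have hn : (n : ℂ) ^ 2 ≠ 0 := pow_ne_zero _ (Nat.cast_ne_zero.2 (NeZero.ne n))
  have h1 : Φ * Φ' = 1 := by
    ext ⟨c, u⟩ ⟨c', u'⟩
    rw [Matrix.mul_apply, Fintype.sum_prod_type]
    simp only [Φ, Φ', ite_mul, mul_ite, zero_mul, mul_zero]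
    rw [Finset.sum_eq_single c]
    · by_cases hc : c = c'
      · subst hc
        simp only [if_true]
        have : ∀ k, torusChar k u * (((n : ℂ) ^ 2)⁻¹ * torusChar k (-u')) =
            ((n : ℂ) ^ 2)⁻¹ * torusChar k (u - u') := fun k => by
          rw [sub_eq_add_neg, torusChar_add]; ring
        simp only [this, ← Finset.mul_sum, sum_torusChar, Matrix.one_apply, sub_eq_zero,
          Prod.mk.injEq, true_and]
        split_ifs
        · exact inv_mul_cancel₀ hn
        · simp
      · simp [hc]
    · intro b _ hb
      simp [hb.symm]
    · simp
  have h2 : pathMatrix α β γ z₁ z₂ n * Φ =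
      Φ * Matrix.blockDiagonal (symbolAt α β γ z₁ z₂) := by
    ext e ⟨c', k⟩
    have e1 : ∀ e', Φ e' (c', k) = torusChar k e'.2 * (if e'.1 = c' then 1 else 0) := by
      intro e'
      simp [Φ]
    rw [Matrix.mul_apply, Matrix.mul_apply]
    simp only [e1]
    rw [pathMatrix_mul_wave (f := fun c => if c = c' then 1 else 0), Fintype.sum_prod_type_right,
      Finset.sum_eq_single k]
    · simp [Φ, Matrix.blockDiagonal_apply]
    · intro k' _ hk'
      simp [Matrix.blockDiagonal_apply, hk']
    · simp
  have hdet : Φ.det * Φ'.det = 1 := by rw [← Matrix.det_mul, h1, Matrix.det_one]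
  have h3 := congrArg Matrix.det h2
  rw [Matrix.det_mul, Matrix.det_mul, Matrix.det_blockDiagonal, mul_comm] at h3
  exact mul_left_cancel₀ (left_ne_zero_of_mul_eq_one hdet) h3

/-- The Fourier representation of the inverse of the path matrix. -/
noncomputable def greenMatrix (α β γ : ℝ) (z₁ z₂ : ℂ) (n : ℕ) [NeZero n] :
    Matrix (MidEdge (ZMod n)) (MidEdge (ZMod n)) ℂ := fun y x =>
  ((n : ℂ) ^ 2)⁻¹ * ∑ k, torusChar k (y.2 - x.2) * (symbolAt α β γ z₁ z₂ k)⁻¹ y.1 x.1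

theorem pathMatrix_mul_greenMatrix (α β γ : ℝ) (z₁ z₂ : ℂ)
    (h : ∀ k : ZMod n × ZMod n, (symbolAt α β γ z₁ z₂ k).det ≠ 0) :
    pathMatrix α β γ z₁ z₂ n * greenMatrix α β γ z₁ z₂ n = 1 := by
  have hn : (n : ℂ) ^ 2 ≠ 0 := pow_ne_zero _ (Nat.cast_ne_zero.2 (NeZero.ne n))
  ext e x
  rw [Matrix.mul_apply]
  have h1 : ∀ e', pathMatrix α β γ z₁ z₂ n e e' * greenMatrix α β γ z₁ z₂ n e' x =
      ((n : ℂ) ^ 2)⁻¹ * ∑ k, torusChar k (-x.2) * (pathMatrix α β γ z₁ z₂ n e e' *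
        (torusChar k e'.2 * (symbolAt α β γ z₁ z₂ k)⁻¹ e'.1 x.1)) := by
    intro e'
    rw [greenMatrix, mul_left_comm, Finset.mul_sum]
    congr 1
    refine Finset.sum_congr rfl fun k _ => ?_
    rw [sub_eq_add_neg, torusChar_add]; ring
  simp only [h1, ← Finset.mul_sum]
  rw [Finset.sum_comm]
  simp only [← Finset.mul_sum]
  have h2 : ∀ k, ∑ e', pathMatrix α β γ z₁ z₂ n e e' *
      (torusChar k e'.2 * (symbolAt α β γ z₁ z₂ k)⁻¹ e'.1 x.1) =
      torusChar k e.2 * (1 : Matrix Colour Colour ℂ) e.1 x.1 := by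
    intro k
    rw [pathMatrix_mul_wave (f := fun c => (symbolAt α β γ z₁ z₂ k)⁻¹ c x.1),
      ← Matrix.mul_nonsing_inv (symbolAt α β γ z₁ z₂ k) (isUnit_iff_ne_zero.2 (h k)),
      Matrix.mul_apply]
  simp only [h2]
  have h3 : ∀ k, torusChar k (-x.2) * (torusChar k e.2 * (1 : Matrix Colour Colour ℂ) e.1 x.1) =
      torusChar k (e.2 - x.2) * (1 : Matrix Colour Colour ℂ) e.1 x.1 := by
    intro k
    rw [sub_eq_add_neg, torusChar_add]; ring
  simp only [h3, ← Finset.sum_mul, sum_torusChar, sub_eq_zero]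
  have hex : e = x ↔ e.1 = x.1 ∧ e.2 = x.2 := Prod.ext_iff
  rw [Matrix.one_apply, Matrix.one_apply]
  by_cases h4 : e.2 = x.2 <;> by_cases h5 : e.1 = x.1 <;> simp [hex, h4, h5]

end torus

/-! ### Summation over the second frequency -/

/-- The characteristic polynomial `Δ(w₁, w₂)` is `coeffA w₁ + coeffB w₁ * w₂`. -/
noncomputable def coeffA (α : ℝ) (w : ℂ) : ℂ := 1 + α * w

/-- The characteristic polynomial `Δ(w₁, w₂)` is `coeffA w₁ + coeffB w₁ * w₂`. -/
noncomputable def coeffB (α β γ : ℝ) (w : ℂ) : ℂ := β - (γ ^ 2 - α * β) * w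

theorem det_symbolMatrix (α β γ : ℝ) (w₁ w₂ : ℂ) :
    (symbolMatrix α β γ w₁ w₂).det = coeffA α w₁ + coeffB α β γ w₁ * w₂ := by
  rw [det_colour]
  simp only [symbolMatrix, coeffA, coeffB]
  ring

/-- The constant term in `w₂` of the adjugate of the symbol. -/
noncomputable def adjConst (α γ : ℝ) : Colour → Colour → ℂ → ℂ
  | .black, .black, _ => 1
  | .black, .white, w => -(γ * w)
  | .white, .black, _ => 0
  | .white, .white, w => 1 + α * w

/-- The coefficient of `w₂` in the adjugate of the symbol. -/
noncomputable def adjLin (β γ : ℝ) : Colour → Colour → ℂ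
  | .black, .black => β
  | .black, .white => 0
  | .white, .black => -γ
  | .white, .white => 0

theorem adjugate_symbolMatrix (α β γ : ℝ) (w₁ w₂ : ℂ) (c c' : Colour) :
    adjugateColour (symbolMatrix α β γ w₁ w₂) c c' = adjConst α γ c c' w₁ + adjLin β γ c c' * w₂ := by
  cases c <;> cases c' <;> simp [adjugateColour, symbolMatrix, adjConst, adjLin]

/-- The average of `w ^ j / (a + b w)` over the solutions of `w ^ n = (-1) ^ (n + 1) η`, in closed
form. It has this meaning for `|j| < n` only. -/
noncomputable def circleCoeff (n : ℕ) (a b η : ℂ) (j : ℤ) : ℂ :=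
  if j ≤ 0 then a ^ (n - 1 - (-j).toNat) * (-b) ^ (-j).toNat / (a ^ n + b ^ n * η)
  else (-1) ^ (j.toNat + 1) * η * a ^ (j.toNat - 1) * b ^ (n - j.toNat) / (a ^ n + b ^ n * η)

/-- The correlation kernel of the `n × n` torus with seam parameters `z₁ ^ n` and `η`, after
summation over the second frequency. -/
noncomputable def torusKernel (α β γ : ℝ) (n : ℕ) [NeZero n] (z₁ η : ℂ) (x y : MidEdge ℤ) : ℂ :=
  (n : ℂ)⁻¹ * ∑ k : ZMod n, (z₁ * rootChar k) ^ (y.2.1 - x.2.1) *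
    (adjConst α γ y.1 x.1 (z₁ * rootChar k) * circleCoeff n (coeffA α (z₁ * rootChar k))
        (coeffB α β γ (z₁ * rootChar k)) η (y.2.2 - x.2.2) +
      adjLin β γ y.1 x.1 * circleCoeff n (coeffA α (z₁ * rootChar k))
        (coeffB α β γ (z₁ * rootChar k)) η (y.2.2 - x.2.2 + 1))

section torus
variable {n : ℕ} [NeZero n]

theorem rootChar_injective : Function.Injective (rootChar : ZMod n → ℂ) :=
  ZMod.injective_stdAddChar

theorem prod_rootChar (x y : ℂ) : ∏ k : ZMod n, (x - rootChar k * y) = x ^ n - y ^ n := by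
  have hpos : 0 < n := Nat.pos_of_ne_zero (NeZero.ne n)
  have hprim : IsPrimitiveRoot (Complex.exp (2 * Real.pi * Complex.I / n)) n :=
    Complex.isPrimitiveRoot_exp n hpos.ne'
  rw [hprim.pow_sub_pow_eq_prod_sub_mul x y hpos]
  have himg : Finset.univ.image (rootChar : ZMod n → ℂ) = Polynomial.nthRootsFinset n 1 := by
    refine Finset.eq_of_subset_of_card_le ?_ ?_
    · intro w hw
      obtain ⟨k, -, rfl⟩ := Finset.mem_image.1 hw
      exact (Polynomial.mem_nthRootsFinset hpos _).2 (rootChar_pow_card k)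
    · rw [Finset.card_image_of_injective _ rootChar_injective, Finset.card_univ, ZMod.card,
        hprim.card_nthRootsFinset]
  rw [← himg, Finset.prod_image fun _ _ _ _ h => rootChar_injective h]

theorem sum_rootChar_zpow (j : ℤ) (hj : |j| < n) :
    ∑ k : ZMod n, rootChar k ^ j = if j = 0 then (n : ℂ) else 0 := by
  have h1 : ∀ k : ZMod n, rootChar k ^ j = rootChar (k * (j : ZMod n)) := fun k =>
    (rootChar_mul_intCast k j).symm
  simp only [h1, sum_rootChar]
  have : (j : ZMod n) = 0 ↔ j = 0 := by
    rw [ZMod.intCast_zmod_eq_zero_iff_dvd]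
    refine ⟨fun h => Int.eq_zero_of_abs_lt_dvd h hj, fun h => h ▸ dvd_zero _⟩
  simp only [this]

variable (n) in
theorem pow_twist {z₂ η : ℂ} (hz : z₂ ^ n = (-1) ^ (n + 1) * η) (a b : ℂ) :
    a ^ n - (-(b * z₂)) ^ n = a ^ n + b ^ n * η := by
  have h : ((-1 : ℂ) ^ n) * (-1) ^ n = 1 := by rw [← mul_pow]; simp
  rw [neg_pow, mul_pow, hz, pow_succ]
  linear_combination (b ^ n * η) * h

/-- The product over the second frequency of the linear factors of `Δ`. -/
theorem prod_add_rootChar {z₂ η : ℂ} (hz : z₂ ^ n = (-1) ^ (n + 1) * η) (a b : ℂ) :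
    ∏ k : ZMod n, (a + b * (z₂ * rootChar k)) = a ^ n + b ^ n * η := by
  rw [← pow_twist n hz, ← prod_rootChar]
  exact Finset.prod_congr rfl fun k _ => by ring

/-- The average over the twisted roots of unity is evaluated by expanding `1 / (a + b w)` as a
finite geometric sum, of which orthogonality of characters retains a single term. -/
theorem average_eq_circleCoeff {z₂ η : ℂ} (hz : z₂ ^ n = (-1) ^ (n + 1) * η) (hz0 : z₂ ≠ 0)
    (a b : ℂ) (h : a ^ n + b ^ n * η ≠ 0) (j : ℤ) (hj : |j| < n) :
    (n : ℂ)⁻¹ * ∑ k : ZMod n, (z₂ * rootChar k) ^ j / (a + b * (z₂ * rootChar k)) =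
      circleCoeff n a b η j := by
  have hn : (n : ℂ) ≠ 0 := Nat.cast_ne_zero.2 (NeZero.ne n)
  have hw0 : ∀ k : ZMod n, z₂ * rootChar k ≠ 0 := fun k => mul_ne_zero hz0 (rootChar_ne_zero k)
  have hpow : ∀ k : ZMod n, (z₂ * rootChar k) ^ n = z₂ ^ n := fun k => by
    rw [mul_pow, rootChar_pow_card, mul_one]
  have hfac : ∀ k : ZMod n, a + b * (z₂ * rootChar k) ≠ 0 := by
    intro k hk
    refine h ?_
    rw [← prod_add_rootChar hz]
    exact Finset.prod_eq_zero (Finset.mem_univ k) hk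
  -- the case of nonpositive powers, by the geometric sum
  have main : ∀ i : ℕ, i < n →
      (n : ℂ)⁻¹ * ∑ k : ZMod n, (z₂ * rootChar k) ^ (-(i : ℤ)) / (a + b * (z₂ * rootChar k)) =
        a ^ (n - 1 - i) * (-b) ^ i / (a ^ n + b ^ n * η) := by
    intro i hi
    have h1 : ∀ k : ZMod n, (z₂ * rootChar k) ^ (-(i : ℤ)) / (a + b * (z₂ * rootChar k)) =
        ∑ m ∈ Finset.range n, (a ^ (n - 1 - m) * (-b) ^ m / (a ^ n + b ^ n * η)) *
          (z₂ ^ ((m : ℤ) - i) * rootChar k ^ ((m : ℤ) - i)) := by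
      intro k
      have hg := geom_sum₂_mul (-(b * (z₂ * rootChar k))) a n
      have e1 : (-(b * (z₂ * rootChar k))) ^ n = (-(b * z₂)) ^ n := by
        rw [← mul_assoc, ← neg_mul, mul_pow, rootChar_pow_card, mul_one]
      have hg' : (∑ m ∈ Finset.range n, (-(b * (z₂ * rootChar k))) ^ m * a ^ (n - 1 - m)) *
          (a + b * (z₂ * rootChar k)) = a ^ n + b ^ n * η := by
        rw [← pow_twist n hz, ← e1]
        linear_combination -hg
      rw [div_eq_iff (hfac k)]
      have e2 : (z₂ * rootChar k) ^ (-(i : ℤ)) = (z₂ * rootChar k) ^ (-(i : ℤ)) *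
          ((∑ m ∈ Finset.range n, (-(b * (z₂ * rootChar k))) ^ m * a ^ (n - 1 - m)) *
          (a + b * (z₂ * rootChar k))) / (a ^ n + b ^ n * η) := by
        rw [hg', mul_div_assoc, div_self h, mul_one]
      rw [e2, Finset.sum_mul, Finset.sum_mul, Finset.mul_sum, Finset.sum_div]
      refine Finset.sum_congr rfl fun m _ => ?_
      rw [← mul_zpow, sub_eq_add_neg, zpow_add₀ (hw0 k), zpow_natCast]
      have : (-(b * (z₂ * rootChar k))) ^ m = (-b) ^ m * (z₂ * rootChar k) ^ m := by
        rw [← mul_pow]; ring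
      rw [this]; ring
    simp only [h1]
    rw [Finset.sum_comm]
    simp only [← Finset.mul_sum]
    rw [Finset.sum_eq_single i]
    · simp only [sub_self, zpow_zero, Finset.sum_const, Finset.card_univ, ZMod.card, nsmul_eq_mul]
      field_simp
    · intro m hm hmi
      have hm' := Finset.mem_range.1 hm
      rw [sum_rootChar_zpow, if_neg (by omega)]
      · simp
      · rw [abs_lt]; constructor <;> omega
    · intro h'; exact absurd (Finset.mem_range.2 hi) h'
  have hj' := abs_lt.1 hj
  unfold circleCoeff
  split_ifs with hj0
  · have e : j = -((-j).toNat : ℤ) := by omega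
    have := main (-j).toNat (by omega)
    rwa [← e] at this
  · have h2 := main (n - j.toNat) (by omega)
    have e : j = (n : ℤ) + -((n - j.toNat : ℕ) : ℤ) := by omega
    have h3 : ∀ k : ZMod n, (z₂ * rootChar k) ^ j =
        z₂ ^ n * (z₂ * rootChar k) ^ (-((n - j.toNat : ℕ) : ℤ)) := fun k => by
      conv_lhs => rw [e, zpow_add₀ (hw0 k), zpow_natCast, hpow]
    simp only [h3, mul_div_assoc, ← Finset.mul_sum]
    rw [mul_left_comm, h2, hz]
    have e3 : n - 1 - (n - j.toNat) = j.toNat - 1 := by omega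
    obtain ⟨m, hm⟩ : ∃ m, n = j.toNat + m := ⟨n - j.toNat, by omega⟩
    have e4 : (-1 : ℂ) ^ (n + 1) * (-1) ^ (n - j.toNat) = (-1) ^ (j.toNat + 1) := by
      rw [← pow_add]
      refine neg_one_pow_congr ?_
      rw [show n + 1 + (n - j.toNat) = (j.toNat + 1) + 2 * (n - j.toNat) by omega]
      simp [Nat.even_add]
    rw [e3, neg_pow b, ← e4]
    ring

end torus

/-! ### The determinantal formula on the torus -/

section torus
variable {n : ℕ} [NeZero n]

theorem exists_twist (n : ℕ) [NeZero n] (η : ℂ) : ∃ z₂ : ℂ, z₂ ^ n = (-1) ^ (n + 1) * η :=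
  IsAlgClosed.exists_pow_nat_eq _ (Nat.pos_of_ne_zero (NeZero.ne n))

theorem neg_one_pow_twist {z₂ η : ℂ} (hz : z₂ ^ n = (-1) ^ (n + 1) * η) :
    (-1) ^ (n + 1) * z₂ ^ n = η := by
  rw [hz, ← mul_assoc, ← mul_pow]; simp

/-- The signed partition function factorizes over the horizontal frequencies. -/
theorem signedSum_univ (α β γ : ℝ) (z₁ η : ℂ) :
    signedSum α β γ (Finset.univ : Finset (Config (ZMod n))) ((-1) ^ (n + 1) * z₁ ^ n) η =
      ∏ k : ZMod n, (coeffA α (z₁ * rootChar k) ^ n + coeffB α β γ (z₁ * rootChar k) ^ n * η) := by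
  obtain ⟨z₂, hz⟩ := exists_twist n η
  have := signedSum_univ_eq_det (n := n) α β γ z₁ z₂
  rw [neg_one_pow_twist hz] at this
  rw [this, det_pathMatrix, Fintype.prod_prod_type]
  refine Finset.prod_congr rfl fun k _ => ?_
  rw [← prod_add_rootChar hz]
  refine Finset.prod_congr rfl fun l _ => ?_
  rw [symbolAt, det_symbolMatrix]

/-- Reduction of a vertex of `ℤ²` modulo `n`. -/
def castVertex (n : ℕ) (v : ℤ × ℤ) : ZMod n × ZMod n := (v.1, v.2)

/-- Reduction of a mid-edge of `ℤ²` modulo `n`. -/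
def castEdge (n : ℕ) (e : MidEdge ℤ) : MidEdge (ZMod n) := (e.1, castVertex n e.2)

theorem castEdge_source (v : ℤ × ℤ) (j : Fin 2) :
    castEdge n (source v j) = inEdges (castVertex n v) j := by
  fin_cases j <;> simp [castEdge, castVertex, source, inEdges, west, south]

theorem castEdge_target (v : ℤ × ℤ) (t : VertexType) (j : Fin 2) :
    castEdge n (target v t j) = outEdges (castVertex n v) t j := by
  cases t <;> fin_cases j <;>
    simp [castEdge, castVertex, target, outEdges, west, south, east, north]

/-- In the inverse of the path matrix, the sum over the second frequency can be carried out. -/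
theorem greenMatrix_cast (α β γ : ℝ) {z₁ z₂ η : ℂ} (hz₁ : z₁ ≠ 0) (hz₂ : z₂ ≠ 0)
    (hz : z₂ ^ n = (-1) ^ (n + 1) * η)
    (h : ∀ k : ZMod n,
      coeffA α (z₁ * rootChar k) ^ n + coeffB α β γ (z₁ * rootChar k) ^ n * η ≠ 0)
    (x y : MidEdge ℤ) (hxy : |y.2.2 - x.2.2| + 1 < n) :
    z₁ ^ (y.2.1 - x.2.1) * z₂ ^ (y.2.2 - x.2.2) *
      greenMatrix α β γ z₁ z₂ n (castEdge n y) (castEdge n x) = torusKernel α β γ n z₁ η x y := by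
  have hw₂ : ∀ l : ZMod n, z₂ * rootChar l ≠ 0 := fun l => mul_ne_zero hz₂ (rootChar_ne_zero l)
  have hfac : ∀ k l : ZMod n, coeffA α (z₁ * rootChar k) +
      coeffB α β γ (z₁ * rootChar k) * (z₂ * rootChar l) ≠ 0 := by
    intro k l hkl
    refine h k ?_
    rw [← prod_add_rootChar hz]
    exact Finset.prod_eq_zero (Finset.mem_univ l) hkl
  have hchar : ∀ k l : ZMod n, torusChar (k, l) ((castEdge n y).2 - (castEdge n x).2) =
      rootChar k ^ (y.2.1 - x.2.1) * rootChar l ^ (y.2.2 - x.2.2) := by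
    intro k l
    rw [← rootChar_mul_intCast, ← rootChar_mul_intCast]
    simp [torusChar, castEdge, castVertex]
  rw [greenMatrix, torusKernel, Fintype.sum_prod_type, Finset.mul_sum, Finset.mul_sum,
    Finset.mul_sum]
  refine Finset.sum_congr rfl fun k _ => ?_
  have b1 : |y.2.2 - x.2.2| < n := by omega
  have b2 : |y.2.2 - x.2.2 + 1| < n := by
    have := abs_add_le (y.2.2 - x.2.2) 1
    rw [abs_one] at this
    omega
  rw [← average_eq_circleCoeff hz hz₂ _ _ (h k) _ b1, ← average_eq_circleCoeff hz hz₂ _ _ (h k) _ b2]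
  simp only [Finset.mul_sum, ← Finset.sum_add_distrib]
  refine Finset.sum_congr rfl fun l _ => ?_
  rw [hchar, symbolAt, inv_colour _ (by rw [det_symbolMatrix]; exact hfac k l), det_symbolMatrix,
    adjugate_symbolMatrix, mul_zpow, zpow_add_one₀ (hw₂ l), mul_zpow]
  have hcy : (castEdge n y).1 = y.1 := rfl
  have hcx : (castEdge n x).1 = x.1 := rfl
  rw [hcy, hcx]
  field_simp

/-- The twist factors of a vertex are those which turn `greenMatrix` into `torusKernel`. -/
theorem prod_twistedWeight_eq (α β γ : ℝ) {z₁ z₂ : ℂ} (hz₁ : z₁ ≠ 0) (hz₂ : z₂ ≠ 0) (v : ℤ × ℤ)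
    (t : VertexType) :
    twistedWeight α β γ z₁ z₂ t = freeFermionWeight α β γ t *
      ∏ j, (z₁ ^ (target v t j).2.1 * z₂ ^ (target v t j).2.2) *
        (z₁ ^ (-(source v j).2.1) * z₂ ^ (-(source v j).2.2)) := by
  rw [Fin.prod_univ_two]
  cases t <;> simp [twistedWeight, arrows, target, source, west, south, east, north,
    zpow_sub₀ hz₁, zpow_sub₀ hz₂, zpow_neg] <;> field_simp <;> simp

/-- The determinantal formula on the torus for signed sums. -/
theorem signedSum_typeEvent (α β γ : ℝ) {z₁ η : ℂ} (hz₁ : z₁ ≠ 0) (hη : η ≠ 0)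
    (h : ∀ k : ZMod n,
      coeffA α (z₁ * rootChar k) ^ n + coeffB α β γ (z₁ * rootChar k) ^ n * η ≠ 0)
    {k : ℕ} (v : Fin k → ℤ × ℤ) (t : Fin k → VertexType)
    (hv : Function.Injective fun i => castVertex n (v i))
    (hn : ∀ p q : Fin k × Fin 2,
      |(target (v q.1) (t q.1) q.2).2.2 - (source (v p.1) p.2).2.2| + 1 < n) :
    signedSum α β γ (typeEvent (fun i => castVertex n (v i)) t) ((-1) ^ (n + 1) * z₁ ^ n) η =
      (∏ i, (freeFermionWeight α β γ (t i) : ℂ)) *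
        (signedSum α β γ (Finset.univ : Finset (Config (ZMod n))) ((-1) ^ (n + 1) * z₁ ^ n) η *
        (Matrix.of fun p q : Fin k × Fin 2 => torusKernel α β γ n z₁ η
          (source (v p.1) p.2) (target (v q.1) (t q.1) q.2)).det) := by
  obtain ⟨z₂, hz⟩ := exists_twist n η
  have hz₂ : z₂ ≠ 0 := by
    rintro rfl
    rw [zero_pow (NeZero.ne n)] at hz
    exact mul_ne_zero (pow_ne_zero _ (neg_ne_zero.2 one_ne_zero)) hη hz.symm
  have hsymb : ∀ k : ZMod n × ZMod n, (symbolAt α β γ z₁ z₂ k).det ≠ 0 := by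
    rintro ⟨k, l⟩ hkl
    refine h k ?_
    rw [← prod_add_rootChar hz]
    refine Finset.prod_eq_zero (Finset.mem_univ l) ?_
    rwa [symbolAt, det_symbolMatrix] at hkl
  have h1 := signedSum_typeEvent_eq_det α β γ z₁ z₂ hv t
  have h2 := signedSum_univ_eq_det (n := n) α β γ z₁ z₂
  rw [neg_one_pow_twist hz] at h1 h2
  rw [h1, h2]
  have h3 := det_replace_rows (pathMatrix α β γ z₁ z₂ n)
    (constrainedMatrix α β γ z₁ z₂ (prescription (fun i => castVertex n (v i)) t))
    (greenMatrix α β γ z₁ z₂ n)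
    (fun p : Fin k × Fin 2 => castEdge n (source (v p.1) p.2))
    (fun p : Fin k × Fin 2 => castEdge n (target (v p.1) (t p.1) p.2))
    (by
      intro p q hpq
      simp only [castEdge_source] at hpq
      have := inEdges_injective (a₁ := (_, _)) (a₂ := (_, _)) hpq
      rw [Prod.mk.injEq] at this
      exact Prod.ext (hv this.1) this.2)
    (pathMatrix_mul_greenMatrix α β γ z₁ z₂ hsymb)
    (by
      intro p
      funext e
      rw [castEdge_source, castEdge_target, constrainedMatrix, rowMatrix, (head_inEdges _ _).1,
        (head_inEdges _ _).2, prescription_apply hv]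
      rfl)
    (by
      intro e he
      funext e'
      rw [constrainedMatrix, rowMatrix, prescription_of_notMem, Option.elim_none, inEdges_head]
      intro i hi
      refine he ⟨(i, headIndex e), ?_⟩
      simp only [castEdge_source]
      rw [hi, inEdges_head])
  rw [h3]
  have h4 : (Matrix.of fun p q : Fin k × Fin 2 => torusKernel α β γ n z₁ η
      (source (v p.1) p.2) (target (v q.1) (t q.1) q.2)).det =
      (∏ q : Fin k × Fin 2, (z₁ ^ (target (v q.1) (t q.1) q.2).2.1 *
        z₂ ^ (target (v q.1) (t q.1) q.2).2.2)) *
      ((∏ p : Fin k × Fin 2, (z₁ ^ (-(source (v p.1) p.2).2.1) *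
        z₂ ^ (-(source (v p.1) p.2).2.2))) *
      (Matrix.of fun p q : Fin k × Fin 2 => greenMatrix α β γ z₁ z₂ n
        (castEdge n (target (v p.1) (t p.1) p.2)) (castEdge n (source (v q.1) q.2))).det) := by
    rw [← Matrix.det_transpose (Matrix.of fun p q : Fin k × Fin 2 => greenMatrix α β γ z₁ z₂ n _ _),
      ← Matrix.det_mul_column, ← Matrix.det_mul_row]
    congr 1
    ext p q
    simp only [Matrix.of_apply, Matrix.transpose_apply]
    rw [← greenMatrix_cast α β γ hz₁ hz₂ hz h _ _ (hn p q), sub_eq_add_neg, sub_eq_add_neg,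
      zpow_add₀ hz₁, zpow_add₀ hz₂]
    ring
  rw [h4, Finset.prod_congr rfl fun i _ => prod_twistedWeight_eq α β γ hz₁ hz₂ (v i) (t i),
    Finset.prod_mul_distrib]
  simp only [Finset.prod_mul_distrib, Fintype.prod_prod_type]
  ring

end torus

/-! ### Riemann sums and limits of averages over roots of unity -/

/-- Dominated convergence for Riemann sums: if the summands are bounded and converge continuously
at almost every point, the sums converge to the integral of the limit. -/
theorem tendsto_riemannSum (τ : ℕ → ℝ) (hτ : ∀ n, τ n ∈ Set.Icc (0 : ℝ) 1) (f : ℕ → ℝ → ℂ)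
    (g : ℝ → ℂ) (C : ℝ)
    (hC : ∀ᶠ n in atTop, ∀ j : ℕ, j < n + 1 → ‖f n ((j + τ n) / (n + 1 : ℕ))‖ ≤ C)
    (hf : ∀ᵐ θ ∂(volume : Measure ℝ), ∀ u : ℕ → ℝ, Tendsto u atTop (𝓝 θ) →
      Tendsto (fun n => f n (u n)) atTop (𝓝 (g θ))) :
    Tendsto (fun n : ℕ => ((n + 1 : ℕ) : ℂ)⁻¹ *
      ∑ j ∈ Finset.range (n + 1), f n ((j + τ n) / (n + 1 : ℕ))) atTop
      (𝓝 (∫ θ in (0 : ℝ)..1, g θ)) := by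
  -- the step functions whose integrals are the sums
  set F : ℕ → ℝ → ℂ := fun n θ => f n ((⌊(n + 1 : ℕ) * θ⌋₊ + τ n) / (n + 1 : ℕ)) with hF
  have hmeas : ∀ n, Measurable (F n) := fun n =>
    (Measurable.of_discrete (f := fun m : ℕ => f n ((m + τ n) / (n + 1 : ℕ)))).comp
      (Nat.measurable_floor.comp (measurable_const_mul _))
  have hfloor : ∀ n (j : ℕ) (θ : ℝ), θ ∈ Set.Ioo ((j : ℝ) / (n + 1 : ℕ)) ((j + 1 : ℕ) / (n + 1 : ℕ)) →
      F n θ = f n ((j + τ n) / (n + 1 : ℕ)) := by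
    intro n j θ hθ
    have hpos : (0 : ℝ) < (n + 1 : ℕ) := by positivity
    have h1 : ⌊((n + 1 : ℕ) : ℝ) * θ⌋₊ = j := by
      have h2 := (div_lt_iff₀ hpos).1 hθ.1
      have h3 := (lt_div_iff₀ hpos).1 hθ.2
      rw [Nat.floor_eq_iff (by
        have : (0 : ℝ) ≤ j := by positivity
        nlinarith)]
      push_cast at h2 h3 ⊢
      constructor <;> linarith
    simp only [hF, h1]
  have hint : ∀ n, ∫ θ in (0 : ℝ)..1, F n θ = ((n + 1 : ℕ) : ℂ)⁻¹ *
      ∑ j ∈ Finset.range (n + 1), f n ((j + τ n) / (n + 1 : ℕ)) := by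
    intro n
    have hpos : (0 : ℝ) < (n + 1 : ℕ) := by positivity
    have hpiece : ∀ j : ℕ, ∀ᵐ θ, θ ∈ Set.uIoc ((j : ℝ) / (n + 1 : ℕ)) ((j + 1 : ℕ) / (n + 1 : ℕ)) →
        F n θ = f n ((j + τ n) / (n + 1 : ℕ)) := by
      intro j
      have hle : (j : ℝ) / (n + 1 : ℕ) ≤ ((j + 1 : ℕ) : ℝ) / (n + 1 : ℕ) := by
        gcongr; omega
      have hne : ∀ᵐ θ : ℝ, θ ≠ ((j + 1 : ℕ) : ℝ) / (n + 1 : ℕ) := by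
        simp [ae_iff, measure_singleton]
      filter_upwards [hne] with θ h1 h2
      rw [Set.uIoc_of_le hle] at h2
      exact hfloor n j θ ⟨h2.1, lt_of_le_of_ne h2.2 h1⟩
    have hii : ∀ j < n + 1, IntervalIntegrable (F n) volume ((fun j : ℕ => (j : ℝ) / (n + 1 : ℕ)) j)
        ((fun j : ℕ => (j : ℝ) / (n + 1 : ℕ)) (j + 1)) := by
      intro j _
      refine (intervalIntegrable_const (c := f n ((j + τ n) / (n + 1 : ℕ)))).congr_ae ?_
      rw [Filter.EventuallyEq, ae_restrict_iff' measurableSet_uIoc]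
      filter_upwards [hpiece j] with θ h1 h2
      exact (h1 h2).symm
    have hsum := intervalIntegral.sum_integral_adjacent_intervals hii
    simp only [Nat.cast_zero, zero_div] at hsum
    rw [div_self hpos.ne'] at hsum
    rw [← hsum, Finset.mul_sum]
    refine Finset.sum_congr rfl fun j _ => ?_
    rw [intervalIntegral.integral_congr_ae (hpiece j), intervalIntegral.integral_const]
    have : ((j + 1 : ℕ) : ℝ) / (n + 1 : ℕ) - (j : ℝ) / (n + 1 : ℕ) = ((n + 1 : ℕ) : ℝ)⁻¹ := by
      push_cast; field_simp; ring
    rw [this, Complex.real_smul]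
    push_cast; rfl
  simp only [← hint]
  refine intervalIntegral.tendsto_integral_filter_of_dominated_convergence (fun _ => C)
    (Eventually.of_forall fun n => (hmeas n).aestronglyMeasurable) ?_
    intervalIntegrable_const ?_
  · filter_upwards [hC] with n hCn
    have hne : ∀ᵐ θ : ℝ, θ ≠ 1 := by simp [ae_iff, measure_singleton]
    filter_upwards [hne] with θ h1 h2
    rw [Set.uIoc_of_le zero_le_one] at h2
    refine hCn _ ?_
    have h3 : θ < 1 := lt_of_le_of_ne h2.2 h1
    rw [Nat.floor_lt (by have := h2.1; positivity)]
    have hpos : (0 : ℝ) < (n + 1 : ℕ) := by positivity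
    push_cast at hpos ⊢
    nlinarith
  · filter_upwards [hf] with θ h1 h2
    rw [Set.uIoc_of_le zero_le_one] at h2
    refine h1 _ ?_
    have hinv : Tendsto (fun n : ℕ => (1 : ℝ) / ((n : ℝ) + 1)) atTop (𝓝 0) :=
      tendsto_one_div_add_atTop_nhds_zero_nat
    have hlow : Tendsto (fun n : ℕ => θ - 1 / ((n : ℝ) + 1)) atTop (𝓝 θ) := by
      simpa using tendsto_const_nhds.sub hinv
    have hupp : Tendsto (fun n : ℕ => θ + 1 / ((n : ℝ) + 1)) atTop (𝓝 θ) := by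
      simpa using tendsto_const_nhds.add hinv
    refine tendsto_of_tendsto_of_tendsto_of_le_of_le hlow hupp (fun n => ?_) (fun n => ?_)
    · have hpos : (0 : ℝ) < (n : ℝ) + 1 := by positivity
      have h3 := Nat.lt_floor_add_one (((n + 1 : ℕ) : ℝ) * θ)
      have h4 := (hτ n).1
      push_cast at h3 ⊢
      rw [le_div_iff₀ hpos, sub_mul, div_mul_cancel₀ _ hpos.ne']
      linarith
    · have hpos : (0 : ℝ) < (n : ℝ) + 1 := by positivity
      have h3 := Nat.floor_le (a := ((n + 1 : ℕ) : ℝ) * θ) (by have := h2.1; positivity)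
      have h4 := (hτ n).2
      push_cast at h3 ⊢
      have h5 : (θ + 1 / ((n : ℝ) + 1)) * (n + 1) = (n + 1) * θ + 1 := by field_simp
      rw [div_le_iff₀ hpos, h5]
      linarith

/-- The limit of `circleCoeff n a b η j` as `n → ∞`, for `|a| ≠ |b|`. -/
noncomputable def limitCoeff (a b : ℂ) (j : ℤ) : ℂ :=
  if ‖b‖ < ‖a‖ then (if j ≤ 0 then (-b) ^ (-j).toNat / a ^ ((-j).toNat + 1) else 0)
  else (if j ≤ 0 then 0 else (-1) ^ (j.toNat + 1) * a ^ (j.toNat - 1) / b ^ j.toNat)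

/-- A bound independent of `n`, provided that the denominator is not resonant. -/
theorem norm_circleCoeff_le {n : ℕ} {a b η : ℂ} {j : ℤ} {c R : ℝ} (hc : 0 < c) (hR : 1 ≤ R)
    (hη : ‖η‖ ≤ R) (hj : |j| < n) (hab : 0 < max ‖a‖ ‖b‖)
    (h : c * max ‖a‖ ‖b‖ ^ n ≤ ‖a ^ n + b ^ n * η‖) :
    ‖circleCoeff n a b η j‖ ≤ R / (c * max ‖a‖ ‖b‖) := by
  set m := max ‖a‖ ‖b‖ with hm
  have ha : ‖a‖ ≤ m := le_max_left _ _
  have hb : ‖b‖ ≤ m := le_max_right _ _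
  have hj' := abs_lt.1 hj
  have hnum : ∀ i k : ℕ, i + k = n - 1 → ‖a‖ ^ i * ‖b‖ ^ k ≤ m ^ (n - 1) := by
    intro i k hik
    rw [← hik, pow_add]
    gcongr
  have hpos : 0 < c * m ^ n := by positivity
  have hn : m ^ n = m ^ (n - 1) * m := by
    rw [← pow_succ]; congr 1; omega
  have key : ∀ x : ℂ, ‖x‖ ≤ R * m ^ (n - 1) → ‖x / (a ^ n + b ^ n * η)‖ ≤ R / (c * m) := by
    intro x hx
    rw [norm_div, div_le_div_iff₀ (hpos.trans_le h) (by positivity)]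
    calc ‖x‖ * (c * m) ≤ (R * m ^ (n - 1)) * (c * m) := by gcongr
      _ = R * (c * m ^ n) := by rw [hn]; ring
      _ ≤ _ := by gcongr
  unfold circleCoeff
  split_ifs with h0
  · refine key _ ?_
    rw [norm_mul, norm_pow, norm_pow, norm_neg]
    calc _ ≤ m ^ (n - 1) := hnum _ _ (by omega)
      _ ≤ R * m ^ (n - 1) := le_mul_of_one_le_left (by positivity) hR
  · refine key _ ?_
    rw [norm_mul, norm_mul, norm_mul, norm_pow, norm_pow, norm_pow, norm_neg, norm_one, one_pow,
      one_mul, mul_assoc]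
    have := hnum (j.toNat - 1) (n - j.toNat) (by omega)
    gcongr

/-- A quotient which stays away from the unit circle has powers tending to zero. -/
theorem tendsto_div_pow_zero {a b : ℂ} (hab : ‖b‖ < ‖a‖) {A B : ℕ → ℂ}
    (hA : Tendsto A atTop (𝓝 a)) (hB : Tendsto B atTop (𝓝 b)) (m : ℕ) :
    Tendsto (fun n => (B n / A n) ^ (n + 1 - m)) atTop (𝓝 0) := by
  have ha : a ≠ 0 := norm_pos_iff.1 ((norm_nonneg b).trans_lt hab)
  have h1 : Tendsto (fun n => ‖B n / A n‖) atTop (𝓝 ‖b / a‖) := (hB.div hA ha).norm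
  have h2 : ‖b / a‖ < 1 := by
    rw [norm_div, div_lt_one (norm_pos_iff.2 ha)]; exact hab
  obtain ⟨q, hq1, hq2⟩ := exists_between h2
  have hq0 : 0 ≤ q := (norm_nonneg _).trans hq1.le
  have h3 : Tendsto (fun n : ℕ => q ^ (n + 1 - m)) atTop (𝓝 0) :=
    (tendsto_pow_atTop_nhds_zero_of_lt_one hq0 hq2).comp
      ((tendsto_sub_atTop_nat m).comp (tendsto_add_atTop_nat 1))
  refine squeeze_zero_norm' ?_ h3
  filter_upwards [h1.eventually (gt_mem_nhds hq1)] with n hn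
  rw [norm_pow]
  gcongr

/-- The larger of the two powers in the denominator dominates. -/
theorem tendsto_circleCoeff {a b : ℂ} (hab : ‖a‖ ≠ ‖b‖) {A B η : ℕ → ℂ}
    (hA : Tendsto A atTop (𝓝 a)) (hB : Tendsto B atTop (𝓝 b)) {r R : ℝ} (hr : 0 < r)
    (hηr : ∀ n, r ≤ ‖η n‖) (hηR : ∀ n, ‖η n‖ ≤ R) (j : ℤ) :
    Tendsto (fun n => circleCoeff (n + 1) (A n) (B n) (η n) j) atTop (𝓝 (limitCoeff a b j)) := by
  have hη0 : ∀ n, η n ≠ 0 := fun n => norm_pos_iff.1 (hr.trans_le (hηr n))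
  have hlarge : ∀ᶠ n : ℕ in atTop, |j| < (n : ℤ) := by
    filter_upwards [eventually_gt_atTop |j|.toNat] with n hn
    omega
  rcases lt_or_gt_of_ne hab with h | h
  · have hb : b ≠ 0 := norm_pos_iff.1 ((norm_nonneg a).trans_lt h)
    have hB0 : ∀ᶠ n in atTop, B n ≠ 0 := hB.eventually_ne hb
    have hz : Tendsto (fun n => (A n / B n) ^ (n + 1) / η n) atTop (𝓝 0) := by
      have h1 : Tendsto (fun n => (A n / B n) ^ (n + 1)) atTop (𝓝 0) := by
        simpa using tendsto_div_pow_zero h hB hA 0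
      refine squeeze_zero_norm (a := fun n => ‖(A n / B n) ^ (n + 1)‖ / r) (fun n => ?_) ?_
      · rw [norm_div]; gcongr; exact hηr n
      · simpa using h1.norm.div_const r
    have hD : Tendsto (fun n => 1 + (A n / B n) ^ (n + 1) / η n) atTop (𝓝 1) := by
      simpa using tendsto_const_nhds.add hz
    have hDne : ∀ᶠ n in atTop, 1 + (A n / B n) ^ (n + 1) / η n ≠ 0 := hD.eventually_ne one_ne_zero
    unfold limitCoeff
    rw [if_neg (not_lt.2 h.le)]
    split_ifs with h0
    · have hlim : Tendsto (fun n => (A n / B n) ^ (n + 1 - (1 + (-j).toNat)) *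
          ((-1) ^ (-j).toNat / B n / (1 + (A n / B n) ^ (n + 1) / η n)) * (η n)⁻¹) atTop (𝓝 0) := by
        have h2 : Tendsto (fun n => (A n / B n) ^ (n + 1 - (1 + (-j).toNat)) *
            ((-1) ^ (-j).toNat / B n / (1 + (A n / B n) ^ (n + 1) / η n))) atTop (𝓝 0) := by
          simpa using (tendsto_div_pow_zero h hB hA (1 + (-j).toNat)).mul
            ((tendsto_const_nhds (x := (-1 : ℂ) ^ (-j).toNat)).div hB hb |>.div hD one_ne_zero)
        refine squeeze_zero_norm (a := fun n => ‖(A n / B n) ^ (n + 1 - (1 + (-j).toNat)) *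
          ((-1) ^ (-j).toNat / B n / (1 + (A n / B n) ^ (n + 1) / η n))‖ * r⁻¹) (fun n => ?_) ?_
        · rw [norm_mul _ (η n)⁻¹, norm_inv]
          gcongr
          exact hηr n
        · simpa using h2.norm.mul_const r⁻¹
      refine hlim.congr' ?_
      filter_upwards [hB0, hDne, hlarge] with n h1 h2 h3
      have hη := hη0 n
      obtain ⟨i, hi⟩ : ∃ i : ℕ, i = (-j).toNat := ⟨_, rfl⟩
      obtain ⟨m, hm⟩ : ∃ m, n = i + m := ⟨n - i, by have := abs_lt.1 h3; omega⟩
      unfold circleCoeff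
      rw [if_pos h0, ← hi]
      have e1 : n + 1 - (1 + i) = m := by omega
      have e2 : n + 1 - 1 - i = m := by omega
      have e4 : A n ^ (n + 1) + B n ^ (n + 1) * η n =
          B n ^ (n + 1) * η n * (1 + (A n / B n) ^ (n + 1) / η n) := by
        rw [div_pow]
        field_simp
        ring
      rw [e1, e2, e4, neg_pow (B n)]
      have e3 : B n ^ (n + 1) = B n ^ m * B n ^ i * B n := by
        rw [← pow_add, ← pow_succ]; congr 1; omega
      rw [e3, div_pow _ _ m]
      field_simp
    · have hlim : Tendsto (fun n => (-1) ^ (j.toNat + 1) * (A n) ^ (j.toNat - 1) / (B n) ^ j.toNat /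
          (1 + (A n / B n) ^ (n + 1) / η n)) atTop
          (𝓝 ((-1) ^ (j.toNat + 1) * a ^ (j.toNat - 1) / b ^ j.toNat / 1)) :=
        (((hA.pow _).const_mul _).div (hB.pow _) (pow_ne_zero _ hb)).div hD one_ne_zero
      rw [div_one] at hlim
      refine hlim.congr' ?_
      filter_upwards [hB0, hDne, hlarge] with n h1 h2 h3
      have hη := hη0 n
      obtain ⟨m, hm⟩ : ∃ m, n + 1 = j.toNat + m :=
        ⟨n + 1 - j.toNat, by have := abs_lt.1 h3; omega⟩
      unfold circleCoeff
      rw [if_neg h0]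
      have e1 : n + 1 - j.toNat = m := by omega
      have e4 : A n ^ (n + 1) + B n ^ (n + 1) * η n =
          B n ^ (n + 1) * η n * (1 + (A n / B n) ^ (n + 1) / η n) := by
        rw [div_pow]
        field_simp
        ring
      have e3 : B n ^ (n + 1) = B n ^ m * B n ^ j.toNat := by
        rw [← pow_add]; congr 1; omega
      rw [e1, e4, e3]
      field_simp
  · have ha : a ≠ 0 := norm_pos_iff.1 ((norm_nonneg b).trans_lt h)
    have hA0 : ∀ᶠ n in atTop, A n ≠ 0 := hA.eventually_ne ha
    have hz : Tendsto (fun n => (B n / A n) ^ (n + 1) * η n) atTop (𝓝 0) := by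
      have h1 : Tendsto (fun n => (B n / A n) ^ (n + 1)) atTop (𝓝 0) := by
        simpa using tendsto_div_pow_zero h hA hB 0
      refine squeeze_zero_norm (a := fun n => ‖(B n / A n) ^ (n + 1)‖ * R) (fun n => ?_) ?_
      · rw [norm_mul]; gcongr; exact hηR n
      · simpa using h1.norm.mul_const R
    have hD : Tendsto (fun n => 1 + (B n / A n) ^ (n + 1) * η n) atTop (𝓝 1) := by
      simpa using tendsto_const_nhds.add hz
    have hDne : ∀ᶠ n in atTop, 1 + (B n / A n) ^ (n + 1) * η n ≠ 0 := hD.eventually_ne one_ne_zero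
    have e4 : ∀ n, A n ≠ 0 → A n ^ (n + 1) + B n ^ (n + 1) * η n =
        A n ^ (n + 1) * (1 + (B n / A n) ^ (n + 1) * η n) := by
      intro n hn
      rw [div_pow]
      field_simp
    unfold limitCoeff
    rw [if_pos h]
    split_ifs with h0
    · have hlim : Tendsto (fun n => (-B n) ^ (-j).toNat / (A n) ^ ((-j).toNat + 1) /
          (1 + (B n / A n) ^ (n + 1) * η n)) atTop
          (𝓝 ((-b) ^ (-j).toNat / a ^ ((-j).toNat + 1) / 1)) :=
        ((hB.neg.pow _).div (hA.pow _) (pow_ne_zero _ ha)).div hD one_ne_zero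
      rw [div_one] at hlim
      refine hlim.congr' ?_
      filter_upwards [hA0, hDne, hlarge] with n h1 h2 h3
      obtain ⟨i, hi⟩ : ∃ i : ℕ, i = (-j).toNat := ⟨_, rfl⟩
      obtain ⟨m, hm⟩ : ∃ m, n = i + m := ⟨n - i, by have := abs_lt.1 h3; omega⟩
      unfold circleCoeff
      rw [if_pos h0, ← hi]
      have e2 : n + 1 - 1 - i = m := by omega
      have e3 : A n ^ (n + 1) = A n ^ m * A n ^ (i + 1) := by
        rw [← pow_add]; congr 1; omega
      rw [e2, e4 n h1, e3]
      field_simp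
    · have h2 : Tendsto (fun n => (B n / A n) ^ (n + 1 - j.toNat) *
          ((-1) ^ (j.toNat + 1) / A n / (1 + (B n / A n) ^ (n + 1) * η n))) atTop (𝓝 0) := by
        simpa using (tendsto_div_pow_zero h hA hB j.toNat).mul
          ((tendsto_const_nhds (x := (-1 : ℂ) ^ (j.toNat + 1))).div hA ha |>.div hD one_ne_zero)
      have hlim : Tendsto (fun n => (B n / A n) ^ (n + 1 - j.toNat) *
          ((-1) ^ (j.toNat + 1) / A n / (1 + (B n / A n) ^ (n + 1) * η n)) * η n) atTop (𝓝 0) := by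
        refine squeeze_zero_norm (a := fun n => ‖(B n / A n) ^ (n + 1 - j.toNat) *
          ((-1) ^ (j.toNat + 1) / A n / (1 + (B n / A n) ^ (n + 1) * η n))‖ * R) (fun n => ?_) ?_
        · rw [norm_mul _ (η n)]
          gcongr
          exact hηR n
        · simpa using h2.norm.mul_const R
      refine hlim.congr' ?_
      filter_upwards [hA0, hDne, hlarge] with n h1 h2 h3
      obtain ⟨i, hi⟩ : ∃ i : ℕ, j.toNat = i + 1 := ⟨j.toNat - 1, by omega⟩
      obtain ⟨m, hm⟩ : ∃ m, n = i + m := ⟨n - i, by have := abs_lt.1 h3; omega⟩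
      unfold circleCoeff
      rw [if_neg h0, hi]
      have e1 : n + 1 - (i + 1) = m := by omega
      have e3 : A n ^ (n + 1) = A n ^ m * A n ^ i * A n := by
        rw [← pow_add, ← pow_succ]; congr 1; omega
      rw [e1, e4 n h1, e3, Nat.add_sub_cancel, div_pow _ _ m]
      field_simp

/-! ### The limit of the torus kernel -/

/-- The point `exp (2πiθ)` of the unit circle. -/
noncomputable def circlePoint (θ : ℝ) : ℂ := Complex.exp ((2 * Real.pi * θ : ℝ) * Complex.I)

theorem norm_circlePoint (θ : ℝ) : ‖circlePoint θ‖ = 1 := Complex.norm_exp_ofReal_mul_I _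

theorem circlePoint_ne_zero (θ : ℝ) : circlePoint θ ≠ 0 := Complex.exp_ne_zero _

theorem circlePoint_add (θ φ : ℝ) : circlePoint (θ + φ) = circlePoint θ * circlePoint φ := by
  rw [circlePoint, circlePoint, circlePoint, ← Complex.exp_add]
  push_cast; ring_nf

theorem circlePoint_pow (θ : ℝ) (n : ℕ) : circlePoint θ ^ n = circlePoint (n * θ) := by
  rw [circlePoint, circlePoint, ← Complex.exp_nat_mul]
  push_cast; ring_nf

theorem continuous_circlePoint : Continuous circlePoint := by
  unfold circlePoint; fun_prop

theorem rootChar_eq_circlePoint {n : ℕ} [NeZero n] (j : ℕ) :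
    rootChar (j : ZMod n) = circlePoint (j / n) := by
  have := ZMod.stdAddChar_coe (N := n) (j : ℤ)
  rw [Int.cast_natCast] at this
  rw [rootChar, this, circlePoint]
  push_cast
  ring_nf

/-- The frequencies of the torus with horizontal twist `τ`. -/
theorem twisted_rootChar {n : ℕ} [NeZero n] (τ : ℝ) (j : ℕ) :
    circlePoint (τ / n) * rootChar (j : ZMod n) = circlePoint ((j + τ) / n) := by
  rw [rootChar_eq_circlePoint, ← circlePoint_add]
  congr 1; ring

/-- The two coefficients of `Δ` do not vanish simultaneously on the unit circle, as
`δ * coeffA + α * coeffB = γ ^ 2` with `δ = γ ^ 2 - α β`. -/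
theorem le_max_coeff {α β γ : ℝ} (hα : 0 < α) (hγ : 0 < γ) (hαβγ : α * β < γ ^ 2) (w : ℂ) :
    γ ^ 2 / (γ ^ 2 - α * β + α) ≤ max ‖coeffA α w‖ ‖coeffB α β γ w‖ := by
  have hδ : 0 < γ ^ 2 - α * β := by linarith
  rw [div_le_iff₀ (by positivity)]
  have h1 : ((γ ^ 2 : ℝ) : ℂ) = ((γ ^ 2 - α * β : ℝ) : ℂ) * coeffA α w +
      (α : ℂ) * coeffB α β γ w := by
    unfold coeffA coeffB; push_cast; ring
  have h2 : γ ^ 2 = ‖((γ ^ 2 : ℝ) : ℂ)‖ := by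
    rw [Complex.norm_real, Real.norm_eq_abs, abs_of_pos (by positivity)]
  refine h2.trans_le ?_
  rw [h1]
  calc _ ≤ ‖((γ ^ 2 - α * β : ℝ) : ℂ) * coeffA α w‖ + ‖(α : ℂ) * coeffB α β γ w‖ := norm_add_le _ _
    _ = (γ ^ 2 - α * β) * ‖coeffA α w‖ + α * ‖coeffB α β γ w‖ := by
      rw [norm_mul, norm_mul, Complex.norm_real, Complex.norm_real, Real.norm_eq_abs,
        Real.norm_eq_abs, abs_of_pos hδ, abs_of_pos hα]
    _ ≤ (γ ^ 2 - α * β) * max ‖coeffA α w‖ ‖coeffB α β γ w‖ +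
        α * max ‖coeffA α w‖ ‖coeffB α β γ w‖ := by
      gcongr
      · exact le_max_left _ _
      · exact le_max_right _ _
    _ = _ := by ring

theorem max_coeff_pos {α β γ : ℝ} (hα : 0 < α) (hγ : 0 < γ) (hαβγ : α * β < γ ^ 2) (w : ℂ) :
    0 < max ‖coeffA α w‖ ‖coeffB α β γ w‖ := by
  refine lt_of_lt_of_le ?_ (le_max_coeff hα hγ hαβγ w)
  have hδ : 0 < γ ^ 2 - α * β := by linarith
  positivity

/-- On the unit circle, `|coeffA|² - |coeffB|²` is an affine function of the cosine. -/
theorem normSq_coeff_sub (α β γ θ : ℝ) :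
    ‖coeffA α (circlePoint θ)‖ ^ 2 - ‖coeffB α β γ (circlePoint θ)‖ ^ 2 =
      (1 + α ^ 2 - β ^ 2 - (γ ^ 2 - α * β) ^ 2) +
        2 * (α + β * (γ ^ 2 - α * β)) * Real.cos (2 * Real.pi * θ) := by
  have hw : circlePoint θ = ⟨Real.cos (2 * Real.pi * θ), Real.sin (2 * Real.pi * θ)⟩ := by
    rw [circlePoint, Complex.exp_mul_I]
    apply Complex.ext <;>
      simp [← Complex.ofReal_cos, ← Complex.ofReal_sin, -Complex.ofReal_mul]
  have h1 := Real.sin_sq_add_cos_sq (2 * Real.pi * θ)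
  have hδ : ((γ : ℂ) ^ 2 - α * β) = ((γ ^ 2 - α * β : ℝ) : ℂ) := by push_cast; ring
  rw [← Complex.normSq_eq_norm_sq, ← Complex.normSq_eq_norm_sq, Complex.normSq_apply,
    Complex.normSq_apply, coeffA, coeffB, hw, hδ]
  simp only [Complex.add_re, Complex.add_im, Complex.sub_re, Complex.sub_im, Complex.mul_re,
    Complex.mul_im, Complex.ofReal_re, Complex.ofReal_im, Complex.one_re, Complex.one_im]
  linear_combination (α ^ 2 - (γ ^ 2 - α * β) ^ 2) * h1

theorem countable_cos_eq (c : ℝ) : {θ : ℝ | Real.cos (2 * Real.pi * θ) = c}.Countable := by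
  rcases Set.eq_empty_or_nonempty {θ : ℝ | Real.cos (2 * Real.pi * θ) = c} with h | ⟨ψ, hψ⟩
  · rw [h]; exact Set.countable_empty
  · refine ((Set.countable_range fun k : ℤ => ψ - k).union
      (Set.countable_range fun k : ℤ => k - ψ)).mono ?_
    intro θ hθ
    have hpi := Real.pi_pos
    have h1 : Real.cos (2 * Real.pi * θ) = Real.cos (2 * Real.pi * ψ) :=
      (show _ = c from hθ).trans (show _ = c from hψ).symm
    obtain ⟨k, hk | hk⟩ := (Real.cos_eq_cos_iff).1 h1
    · left
      refine ⟨k, ?_⟩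
      simp only
      nlinarith
    · right
      refine ⟨k, ?_⟩
      simp only
      nlinarith

theorem slope_pos {α β γ : ℝ} (hα : 0 < α) (hβ : 0 < β) (hαβγ : α * β < γ ^ 2) :
    0 < 2 * (α + β * (γ ^ 2 - α * β)) := by
  have hδ : 0 < γ ^ 2 - α * β := by linarith
  positivity

theorem countable_norm_coeff_eq {α β γ : ℝ} (hα : 0 < α) (hβ : 0 < β) (hαβγ : α * β < γ ^ 2) :
    {θ : ℝ | ‖coeffA α (circlePoint θ)‖ = ‖coeffB α β γ (circlePoint θ)‖}.Countable := by
  have hs := slope_pos hα hβ hαβγ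
  refine (countable_cos_eq (-(1 + α ^ 2 - β ^ 2 - (γ ^ 2 - α * β) ^ 2) /
    (2 * (α + β * (γ ^ 2 - α * β))))).mono ?_
  intro θ hθ
  have h := normSq_coeff_sub α β γ θ
  rw [show ‖coeffA α (circlePoint θ)‖ = ‖coeffB α β γ (circlePoint θ)‖ from hθ, sub_self] at h
  change Real.cos _ = _
  rw [eq_div_iff hs.ne']
  linarith

/-- The integrand of the correlation kernel after integrating out the second variable. -/
noncomputable def limitIntegrand (α β γ : ℝ) (x y : MidEdge ℤ) (θ : ℝ) : ℂ :=
  circlePoint θ ^ (y.2.1 - x.2.1) *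
    (adjConst α γ y.1 x.1 (circlePoint θ) * limitCoeff (coeffA α (circlePoint θ))
        (coeffB α β γ (circlePoint θ)) (y.2.2 - x.2.2) +
      adjLin β γ y.1 x.1 * limitCoeff (coeffA α (circlePoint θ))
        (coeffB α β γ (circlePoint θ)) (y.2.2 - x.2.2 + 1))

/-- The infinite-volume kernel as a one-dimensional integral over the first frequency. -/
noncomputable def limitKernel (α β γ : ℝ) (x y : MidEdge ℤ) : ℂ :=
  ∫ θ in (0 : ℝ)..1, limitIntegrand α β γ x y θ

theorem continuous_adjConst (α γ : ℝ) (c c' : Colour) : Continuous (adjConst α γ c c') := by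
  cases c <;> cases c' <;> unfold adjConst <;> fun_prop

theorem norm_adjConst_le (α γ : ℝ) (c c' : Colour) {w : ℂ} (hw : ‖w‖ = 1) :
    ‖adjConst α γ c c' w‖ ≤ 1 + |α| + |γ| := by
  have h1 := abs_nonneg α
  have h2 := abs_nonneg γ
  cases c <;> cases c' <;> simp only [adjConst]
  · rw [norm_one]; linarith
  · rw [norm_neg, norm_mul, hw, Complex.norm_real, Real.norm_eq_abs]; linarith
  · rw [norm_zero]; linarith
  · refine (norm_add_le _ _).trans ?_
    rw [norm_mul, hw, Complex.norm_real, Real.norm_eq_abs, norm_one]; linarith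

/-- If no frequency is resonant, the torus kernel converges to the infinite-volume kernel. -/
theorem tendsto_torusKernel {α β γ : ℝ} (hα : 0 < α) (hβ : 0 < β) (hγ : 0 < γ)
    (hαβγ : α * β < γ ^ 2) {τ : ℕ → ℝ} (hτ : ∀ n, τ n ∈ Set.Icc (0 : ℝ) 1) {η : ℕ → ℂ}
    {c r R : ℝ} (hc : 0 < c) (hr : 0 < r) (hηr : ∀ n, r ≤ ‖η n‖) (hηR : ∀ n, ‖η n‖ ≤ R)
    (hgood : ∀ n, ∀ k : ZMod (n + 1),
      c * max ‖coeffA α (circlePoint (τ n / (n + 1 : ℕ)) * rootChar k)‖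
        ‖coeffB α β γ (circlePoint (τ n / (n + 1 : ℕ)) * rootChar k)‖ ^ (n + 1) ≤
      ‖coeffA α (circlePoint (τ n / (n + 1 : ℕ)) * rootChar k) ^ (n + 1) +
        coeffB α β γ (circlePoint (τ n / (n + 1 : ℕ)) * rootChar k) ^ (n + 1) * η n‖)
    (x y : MidEdge ℤ) :
    Tendsto (fun n => torusKernel α β γ (n + 1) (circlePoint (τ n / (n + 1 : ℕ))) (η n) x y) atTop
      (𝓝 (limitKernel α β γ x y)) := by
  set f : ℕ → ℝ → ℂ := fun n θ => circlePoint θ ^ (y.2.1 - x.2.1) *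
    (adjConst α γ y.1 x.1 (circlePoint θ) * circleCoeff (n + 1) (coeffA α (circlePoint θ))
        (coeffB α β γ (circlePoint θ)) (η n) (y.2.2 - x.2.2) +
      adjLin β γ y.1 x.1 * circleCoeff (n + 1) (coeffA α (circlePoint θ))
        (coeffB α β γ (circlePoint θ)) (η n) (y.2.2 - x.2.2 + 1)) with hf
  have hsum : ∀ n : ℕ, torusKernel α β γ (n + 1) (circlePoint (τ n / (n + 1 : ℕ))) (η n) x y =
      ((n + 1 : ℕ) : ℂ)⁻¹ * ∑ j ∈ Finset.range (n + 1), f n ((j + τ n) / (n + 1 : ℕ)) := by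
    intro n
    rw [torusKernel, sum_zmod_eq_range]
    simp only [twisted_rootChar, hf]
  simp only [hsum]
  set d := γ ^ 2 / (γ ^ 2 - α * β + α) with hd
  have hδ : 0 < γ ^ 2 - α * β := by linarith
  have hdpos : 0 < d := by positivity
  refine tendsto_riemannSum τ hτ f _ ((1 + |α| + |γ|) * (max R 1 / (c * d)) +
    ‖adjLin β γ y.1 x.1‖ * (max R 1 / (c * d))) ?_ ?_
  · have hlarge : ∀ᶠ n : ℕ in atTop, |y.2.2 - x.2.2| + 1 < (n : ℤ) := by
      filter_upwards [eventually_gt_atTop (|y.2.2 - x.2.2| + 1).toNat] with n hn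
      omega
    filter_upwards [hlarge] with n hn j _
    have hg := hgood n j
    rw [twisted_rootChar] at hg
    set w := circlePoint ((j + τ n) / (n + 1 : ℕ)) with hw
    have hw1 : ‖w‖ = 1 := norm_circlePoint _
    have hbound : ∀ m : ℤ, |m| < ((n + 1 : ℕ) : ℤ) →
        ‖circleCoeff (n + 1) (coeffA α w) (coeffB α β γ w) (η n) m‖ ≤ max R 1 / (c * d) := by
      intro m hm
      refine (norm_circleCoeff_le hc (le_max_right R 1) ((hηR n).trans (le_max_left _ _)) hm
        (max_coeff_pos hα hγ hαβγ w) hg).trans ?_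
      have := le_max_coeff hα hγ hαβγ w
      gcongr
    have b1 : |y.2.2 - x.2.2| < ((n + 1 : ℕ) : ℤ) := by push_cast; omega
    have b2 : |y.2.2 - x.2.2 + 1| < ((n + 1 : ℕ) : ℤ) := by
      have := abs_add_le (y.2.2 - x.2.2) 1
      rw [abs_one] at this
      push_cast; omega
    simp only [hf]
    rw [← hw, norm_mul, norm_zpow, hw1, one_zpow, one_mul]
    refine (norm_add_le _ _).trans ?_
    rw [norm_mul, norm_mul]
    gcongr
    · exact norm_adjConst_le _ _ _ _ hw1
    · exact hbound _ b1
    · exact hbound _ b2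
  · have hae : ∀ᵐ θ : ℝ, ‖coeffA α (circlePoint θ)‖ ≠ ‖coeffB α β γ (circlePoint θ)‖ :=
      (countable_norm_coeff_eq hα hβ hαβγ).ae_notMem volume
    filter_upwards [hae] with θ hθ u hu
    have hw : Tendsto (fun n => circlePoint (u n)) atTop (𝓝 (circlePoint θ)) :=
      (continuous_circlePoint.tendsto θ).comp hu
    have hA : Tendsto (fun n => coeffA α (circlePoint (u n))) atTop
        (𝓝 (coeffA α (circlePoint θ))) := (hw.const_mul _).const_add _
    have hB : Tendsto (fun n => coeffB α β γ (circlePoint (u n))) atTop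
        (𝓝 (coeffB α β γ (circlePoint θ))) := (hw.const_mul _).const_sub _
    have hadj : Tendsto (fun n => adjConst α γ y.1 x.1 (circlePoint (u n))) atTop
        (𝓝 (adjConst α γ y.1 x.1 (circlePoint θ))) :=
      ((continuous_adjConst α γ y.1 x.1).tendsto _).comp hw
    exact (hw.zpow₀ _ (Or.inl (circlePoint_ne_zero θ))).mul
      ((hadj.mul (tendsto_circleCoeff hθ hA hB hr hηr hηR _)).add
        ((tendsto_circleCoeff hθ hA hB hr hηr hηR _).const_mul _))

/-! ### Products of linear factors -/

/-- Jensen's inequality for a product of linear factors, from the maximum principle: factors whose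
zero lies inside the unit disc are replaced by their reflections. -/
theorem exists_prod_max_le {ι : Type*} [Fintype ι] (A B : ι → ℂ) {t : ℝ} (ht : 0 < t) :
    ∃ η : ℂ, ‖η‖ = t ∧ ∏ k, max ‖A k‖ (t * ‖B k‖) ≤ ‖∏ k, (A k + B k * η)‖ := by
  classical
  let h : ℂ → ℂ := fun η => ∏ k, if ‖A k‖ < t * ‖B k‖ then
    (starRingEnd ℂ) (t * B k) + (starRingEnd ℂ) (A k) * η else A k + t * B k * η
  have hd : Differentiable ℂ h := by
    refine Differentiable.fun_finsetProd fun k _ => ?_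
    split_ifs <;> fun_prop
  obtain ⟨ζ, hζ, hmax⟩ := Complex.exists_mem_frontier_isMaxOn_norm
    (Metric.isBounded_ball (x := (0 : ℂ)) (r := 1)) ⟨0, by simp⟩ hd.diffContOnCl
  rw [frontier_ball _ one_ne_zero, mem_sphere_zero_iff_norm] at hζ
  have h0 := hmax (subset_closure (Metric.mem_ball_self one_pos))
  have hh0 : ‖h 0‖ = ∏ k, max ‖A k‖ (t * ‖B k‖) := by
    simp only [h]
    rw [norm_prod]
    refine Finset.prod_congr rfl fun k _ => ?_
    split_ifs with hk
    · rw [max_eq_right hk.le, mul_zero, add_zero, RCLike.norm_conj, norm_mul, Complex.norm_real,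
        Real.norm_eq_abs, abs_of_pos ht]
    · rw [max_eq_left (not_lt.1 hk), mul_zero, add_zero]
  refine ⟨t * ζ, by rw [norm_mul, hζ, Complex.norm_real, Real.norm_eq_abs, abs_of_pos ht, mul_one],
    ?_⟩
  rw [← hh0]
  refine (show ‖h 0‖ ≤ ‖h ζ‖ from h0).trans (le_of_eq ?_)
  simp only [h]
  rw [norm_prod, norm_prod]
  refine Finset.prod_congr rfl fun k _ => ?_
  split_ifs with hk
  · have hζ' : ζ * (starRingEnd ℂ) ζ = 1 := by
      rw [Complex.mul_conj, Complex.normSq_eq_norm_sq, hζ]; simp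
    have e : A k + B k * (t * ζ) = ζ *
        (starRingEnd ℂ) ((starRingEnd ℂ) (t * B k) + (starRingEnd ℂ) (A k) * ζ) := by
      simp only [map_add, map_mul, Complex.conj_conj, Complex.conj_ofReal]
      linear_combination (-A k) * hζ'
    rw [e, norm_mul, hζ, one_mul, RCLike.norm_conj]
  · congr 1; ring

/-- The ratio of the smaller to the larger of two norms. -/
noncomputable def ratio (a b : ℂ) : ℝ := min ‖a‖ ‖b‖ / max ‖a‖ ‖b‖

theorem ratio_nonneg (a b : ℂ) : 0 ≤ ratio a b := by unfold ratio; positivity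

theorem ratio_le_one (a b : ℂ) : ratio a b ≤ 1 :=
  div_le_one_of_le₀ min_le_max (by positivity)

theorem ratio_pow (a b : ℂ) (n : ℕ) : ratio (a ^ n) (b ^ n) = ratio a b ^ n := by
  unfold ratio
  rw [norm_pow, norm_pow, div_pow]
  rcases le_total ‖a‖ ‖b‖ with h | h
  · have h' := pow_le_pow_left₀ (norm_nonneg _) h n
    rw [min_eq_left h, max_eq_right h, min_eq_left h', max_eq_right h']
  · have h' := pow_le_pow_left₀ (norm_nonneg _) h n
    rw [min_eq_right h, max_eq_left h, min_eq_right h', max_eq_left h']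

theorem min_eq_ratio_mul (a b : ℂ) : min ‖a‖ ‖b‖ = ratio a b * max ‖a‖ ‖b‖ := by
  unfold ratio
  by_cases h : max ‖a‖ ‖b‖ = 0
  · have : min ‖a‖ ‖b‖ ≤ 0 := h ▸ min_le_max
    rw [h, mul_zero]
    exact le_antisymm this (by positivity)
  · rw [div_mul_cancel₀ _ h]

/-- Upper bound for a product of linear factors, in terms of the number of factors in which the
linear term dominates. -/
theorem norm_prod_le_of_ratio {ι : Type*} [Fintype ι] (A B : ι → ℂ) {η : ℂ} {s : ℝ} (hη : 0 < ‖η‖)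
    (h1 : ‖η‖ ≤ s) (h2 : ‖η‖⁻¹ ≤ s) :
    ‖∏ k, (A k + B k * η)‖ ≤ (∏ k, max ‖A k‖ ‖B k‖) *
      ‖η‖ ^ (Finset.univ.filter fun k => ‖A k‖ < ‖B k‖).card *
        Real.exp (s * ∑ k, ratio (A k) (B k)) := by
  have hκ : ‖η‖ ^ (Finset.univ.filter fun k => ‖A k‖ < ‖B k‖).card =
      ∏ k, if ‖A k‖ < ‖B k‖ then ‖η‖ else 1 := by
    rw [← Finset.prod_filter, Finset.prod_const]
  rw [Finset.mul_sum, Real.exp_sum, hκ, norm_prod, ← Finset.prod_mul_distrib,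
    ← Finset.prod_mul_distrib]
  refine Finset.prod_le_prod (fun _ _ => norm_nonneg _) fun k _ => ?_
  have hρ := ratio_nonneg (A k) (B k)
  have hmin := min_eq_ratio_mul (A k) (B k)
  have hexp : 1 + s * ratio (A k) (B k) ≤ Real.exp (s * ratio (A k) (B k)) := by
    rw [add_comm]; exact Real.add_one_le_exp _
  have htri : ‖A k + B k * η‖ ≤ ‖A k‖ + ‖B k‖ * ‖η‖ := by
    rw [← norm_mul]; exact norm_add_le _ _
  split_ifs with h
  · rw [max_eq_right h.le] at hmin ⊢
    rw [min_eq_left h.le] at hmin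
    calc _ ≤ ratio (A k) (B k) * ‖B k‖ + ‖B k‖ * ‖η‖ := by rwa [hmin] at htri
      _ = ‖B k‖ * ‖η‖ * (1 + ‖η‖⁻¹ * ratio (A k) (B k)) := by field_simp; ring
      _ ≤ ‖B k‖ * ‖η‖ * (1 + s * ratio (A k) (B k)) := by gcongr
      _ ≤ _ := by gcongr
  · rw [max_eq_left (not_lt.1 h)] at hmin ⊢
    rw [min_eq_right (not_lt.1 h)] at hmin
    calc _ ≤ ‖A k‖ + ratio (A k) (B k) * ‖A k‖ * ‖η‖ := by rwa [hmin] at htri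
      _ = ‖A k‖ * 1 * (1 + ‖η‖ * ratio (A k) (B k)) := by ring
      _ ≤ ‖A k‖ * 1 * (1 + s * ratio (A k) (B k)) := by gcongr
      _ ≤ _ := by gcongr

/-- A circle about `η₀` with radius between `1/4` and `1/2` keeping a distance from given points. -/
theorem exists_radius {ι : Type*} (S : Finset ι) (ξ : ι → ℂ) (η₀ : ℂ) {K : ℕ} (hK : S.card ≤ K) :
    ∃ r : ℝ, 1 / 4 ≤ r ∧ r ≤ 1 / 2 ∧
      ∀ k ∈ S, ∀ η : ℂ, ‖η - η₀‖ = r → 1 / (8 * (K + 1)) ≤ ‖η - ξ k‖ := by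
  by_contra hcon
  push Not at hcon
  have hK0 : (0 : ℝ) < K + 1 := by positivity
  -- otherwise each of the radii `1 / 4 + j / (4 (K + 1))` is nearly the distance of a point of the
  -- family from `η₀`, and these `K + 1` points are distinct
  have hex : ∀ j : Fin (K + 1), ∃ k ∈ S,
      |‖ξ k - η₀‖ - (1 / 4 + (j : ℕ) / (4 * (K + 1)))| < 1 / (8 * (K + 1)) := by
    intro j
    have hj : ((j : ℕ) : ℝ) ≤ K := by exact_mod_cast Nat.lt_succ_iff.1 j.2
    obtain ⟨k, hk, η, h1, h2⟩ := hcon (1 / 4 + (j : ℕ) / (4 * (K + 1)))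
      (by have : (0 : ℝ) ≤ (j : ℕ) / (4 * (K + 1)) := by positivity
          linarith)
      (by have : ((j : ℕ) : ℝ) / (4 * (K + 1)) ≤ 1 / 4 := by
            rw [div_le_div_iff₀ (by positivity) (by norm_num)]; linarith
          linarith)
    refine ⟨k, hk, lt_of_le_of_lt ?_ h2⟩
    rw [← h1, ← norm_sub_rev (ξ k) η]
    refine (abs_norm_sub_norm_le _ _).trans (le_of_eq ?_)
    congr 1; ring
  choose f hfS hf using hex
  have hinj : Function.Injective f := by
    intro i j hij
    by_contra hne
    have h1 := abs_lt.1 (hf i)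
    have h2 := abs_lt.1 (hf j)
    rw [hij] at h1
    have h3 : (1 : ℝ) / (8 * (K + 1)) = 1 / 2 * (1 / (4 * (K + 1))) := by field_simp; ring
    have h4 : ∀ x : ℝ, x / (4 * (K + 1)) = x * (1 / (4 * (K + 1))) := fun x => by ring
    have hd : (0 : ℝ) < 1 / (4 * (K + 1)) := by positivity
    rw [h3, h4 ((i : ℕ) : ℝ)] at h1
    rw [h3, h4 ((j : ℕ) : ℝ)] at h2
    have hlt : |((i : ℕ) : ℝ) - (j : ℕ)| < 1 := by
      rw [abs_lt]
      constructor <;> nlinarith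
    have hne' : ((i : ℕ) : ℤ) - (j : ℕ) ≠ 0 := fun h => hne (Fin.ext (by omega))
    have h5 : (1 : ℤ) ≤ |((i : ℕ) : ℤ) - (j : ℕ)| := Int.one_le_abs hne'
    have h6 : (1 : ℝ) ≤ |((i : ℕ) : ℝ) - (j : ℕ)| := by exact_mod_cast h5
    linarith
  have hcard := Finset.card_le_card_of_injOn (s := Finset.univ) (t := S) f (fun j _ => hfS j)
    hinj.injOn
  rw [Finset.card_univ, Fintype.card_fin] at hcard
  omega

/-- On a suitable circle about `η₀`, all linear factors are comparable to their larger term. -/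
theorem exists_good_radius {ι : Type*} [Fintype ι] (A B : ι → ℂ) {η₀ : ℂ} (hη₀ : ‖η₀‖ = 1) {K : ℕ}
    (hK : 4 * ∑ k, ratio (A k) (B k) ≤ K) :
    ∃ r : ℝ, 1 / 4 ≤ r ∧ r ≤ 1 / 2 ∧ ∀ k, ∀ η : ℂ, ‖η - η₀‖ = r →
      1 / (32 * (K + 1)) * max ‖A k‖ ‖B k‖ ≤ ‖A k + B k * η‖ := by
  classical
  set S := Finset.univ.filter fun k => 1 / 4 ≤ ratio (A k) (B k) with hS
  have hcard : S.card ≤ K := by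
    have h1 : (S.card : ℝ) * (1 / 4) ≤ ∑ k, ratio (A k) (B k) := by
      rw [← nsmul_eq_mul]
      refine (Finset.card_nsmul_le_sum S _ _ fun k hk => (Finset.mem_filter.1 hk).2).trans ?_
      exact Finset.sum_le_univ_sum_of_nonneg fun k => ratio_nonneg _ _
    have : (S.card : ℝ) ≤ K := by linarith
    exact_mod_cast this
  obtain ⟨r, hr1, hr2, hr⟩ := exists_radius S (fun k => -A k / B k) η₀ hcard
  refine ⟨r, hr1, hr2, fun k η hη => ?_⟩
  have hK0 : (0 : ℝ) < K + 1 := by positivity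
  have hup : ‖η‖ ≤ 3 / 2 := by
    have := norm_add_le (η - η₀) η₀
    rw [sub_add_cancel, hη, hη₀] at this
    linarith
  have hlow : 1 / 2 ≤ ‖η‖ := by
    have := norm_sub_norm_le η₀ (η₀ - η)
    rw [sub_sub_cancel, norm_sub_rev, hη, hη₀] at this
    linarith
  have hmin := min_eq_ratio_mul (A k) (B k)
  have hc : (1 : ℝ) / (32 * (K + 1)) ≤ 1 / 4 := by
    rw [div_le_div_iff₀ (by positivity) (by norm_num)]
    have : (0 : ℝ) ≤ K := by positivity
    linarith
  have hmax0 : 0 ≤ max ‖A k‖ ‖B k‖ := le_max_of_le_left (norm_nonneg _)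
  by_cases hk : 1 / 4 ≤ ratio (A k) (B k)
  · have hB : 1 / 4 * max ‖A k‖ ‖B k‖ ≤ ‖B k‖ := by
      refine le_trans ?_ (min_le_right ‖A k‖ ‖B k‖)
      rw [hmin]; gcongr
    rcases hmax0.eq_or_lt with h0 | h0
    · rw [← h0, mul_zero]; exact norm_nonneg _
    · have hB0 : B k ≠ 0 := norm_pos_iff.1 (lt_of_lt_of_le (by positivity) hB)
      have h1 := hr k (Finset.mem_filter.2 ⟨Finset.mem_univ _, hk⟩) η hη
      have h2 : A k + B k * η = B k * (η - -A k / B k) := by field_simp; ring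
      rw [h2, norm_mul]
      calc 1 / (32 * (K + 1)) * max ‖A k‖ ‖B k‖
          = (1 / 4 * max ‖A k‖ ‖B k‖) * (1 / (8 * (K + 1))) := by field_simp; ring
        _ ≤ _ := by gcongr
  · push Not at hk
    refine (mul_le_mul_of_nonneg_right hc hmax0).trans ?_
    rcases le_total ‖A k‖ ‖B k‖ with h | h
    · rw [min_eq_left h, max_eq_right h] at hmin
      rw [max_eq_right h]
      have h1 := norm_sub_norm_le (B k * η) (-A k)
      rw [sub_neg_eq_add, norm_neg, norm_mul, add_comm] at h1
      have hb := norm_nonneg (B k)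
      nlinarith
    · rw [min_eq_right h, max_eq_left h] at hmin
      rw [max_eq_left h]
      have h1 := norm_sub_norm_le (A k) (-(B k * η))
      rw [sub_neg_eq_add, norm_neg, norm_mul] at h1
      have ha := norm_nonneg (A k)
      have hb := norm_nonneg (B k)
      have hb2 : ‖B k‖ ≤ 1 / 4 * ‖A k‖ := by rw [hmin]; gcongr
      nlinarith

/-! ### Counting near-resonant frequencies -/

/-- Jordan's inequality for the sine, near both zeros `x = 0` and `x = N`. -/
theorem exp_sin_le {c : ℝ} (hc : 0 < c) {N : ℕ} {x : ℝ} (h0 : 0 ≤ x) (h1 : x ≤ N) (hN : 0 < N) :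
    Real.exp (-(c * N * |Real.sin (Real.pi * x / N)|)) ≤
      Real.exp (-(2 * c * x)) + Real.exp (-(2 * c * (N - x))) := by
  have hpi := Real.pi_pos
  have hN' : (0 : ℝ) < N := by exact_mod_cast hN
  have key : ∀ y : ℝ, 0 ≤ y → y ≤ N / 2 → 2 * y ≤ N * |Real.sin (Real.pi * y / N)| := by
    intro y hy0 hy1
    have h2 := Real.mul_le_sin (x := Real.pi * y / N) (by positivity)
      (by rw [div_le_div_iff₀ hN' (by norm_num)]; nlinarith)
    have h3 := le_abs_self (Real.sin (Real.pi * y / N))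
    have h4 : 2 / Real.pi * (Real.pi * y / N) = 2 * y / N := by field_simp
    rw [h4, div_le_iff₀ hN'] at h2
    nlinarith
  rcases le_total x (N / 2) with h | h
  · have := key x h0 h
    refine le_add_of_le_of_nonneg (Real.exp_le_exp.2 ?_) (Real.exp_pos _).le
    nlinarith
  · have h2 := key (N - x) (by linarith) (by linarith)
    have h3 : Real.pi * (N - x) / N = Real.pi - Real.pi * x / N := by field_simp
    rw [h3, Real.sin_pi_sub] at h2
    refine le_add_of_nonneg_of_le (Real.exp_pos _).le (Real.exp_le_exp.2 ?_)
    nlinarith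

/-- The summands decay geometrically with the distance of `j + τ` from the multiples of `N`. -/
theorem sum_exp_sin_le {c : ℝ} (hc : 0 < c) {N : ℕ} (hN : 0 < N) (τ : ℝ) :
    ∑ j ∈ Finset.range N, Real.exp (-(c * N * |Real.sin (Real.pi * (j + τ) / N)|)) ≤
      2 / (1 - Real.exp (-(2 * c))) := by
  have hN' : (0 : ℝ) < N := by exact_mod_cast hN
  set S : ℝ → ℝ := fun τ =>
    ∑ j ∈ Finset.range N, Real.exp (-(c * N * |Real.sin (Real.pi * (j + τ) / N)|)) with hS
  have hper : Function.Periodic S 1 := by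
    intro τ
    simp only [hS]
    set g : ℕ → ℝ := fun j => Real.exp (-(c * N * |Real.sin (Real.pi * (j + τ) / N)|)) with hg
    have h1 : ∀ j : ℕ, Real.exp (-(c * N * |Real.sin (Real.pi * (j + (τ + 1)) / N)|)) =
        g (j + 1) := by
      intro j
      simp only [hg]
      push_cast
      ring_nf
    simp only [h1]
    have h2 : g N = g 0 := by
      simp only [hg]
      have : Real.pi * ((N : ℕ) + τ) / N = Real.pi * ((0 : ℕ) + τ) / N + Real.pi := by
        push_cast; field_simp; ring
      rw [this, Real.sin_add_pi, abs_neg]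
    have h3 := Finset.sum_range_succ g N
    have h4 := Finset.sum_range_succ' g N
    change ∑ j ∈ Finset.range N, g (j + 1) = ∑ j ∈ Finset.range N, g j
    linarith
  obtain ⟨t, ht, hτt⟩ := hper.exists_mem_Ico₀ one_pos τ
  change S τ ≤ _
  rw [hτt]
  set q := Real.exp (-(2 * c)) with hq
  have hq0 : 0 < q := Real.exp_pos _
  have hq1 : q < 1 := (Real.exp_lt_exp.2 (by linarith)).trans_eq Real.exp_zero
  have hgeo : ∑ j ∈ Finset.range N, q ^ j ≤ 1 / (1 - q) := by
    rw [geom_sum_eq hq1.ne, ← neg_div_neg_eq]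
    gcongr
    · linarith [pow_pos hq0 N]
    · linarith
  calc S t ≤ ∑ j ∈ Finset.range N, (q ^ j + q ^ (N - 1 - j)) := by
        refine Finset.sum_le_sum fun j hj => ?_
        have hj' : j + 1 ≤ N := Finset.mem_range.1 hj
        have hj'' : (j : ℝ) + 1 ≤ N := by exact_mod_cast hj'
        refine (exp_sin_le hc (by have := ht.1; positivity) (by linarith [ht.2]) hN).trans ?_
        rw [hq, ← Real.exp_nat_mul, ← Real.exp_nat_mul]
        have e : ((N - 1 - j : ℕ) : ℝ) = N - 1 - j := by
          rw [Nat.cast_sub (by omega), Nat.cast_sub (by omega)]; push_cast; ring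
        rw [e]
        gcongr
        · nlinarith [ht.1]
        · nlinarith [ht.2]
    _ = ∑ j ∈ Finset.range N, q ^ j + ∑ j ∈ Finset.range N, q ^ j := by
        rw [Finset.sum_add_distrib, Finset.sum_range_reflect (fun j => q ^ j) N]
    _ ≤ 2 / (1 - q) := by
        have : 2 / (1 - q) = 1 / (1 - q) + 1 / (1 - q) := by ring
        linarith

/-- For `sin ψ > 0` the cosine crosses the level `cos ψ` transversally, at `±ψ`. -/
theorem exp_cos_sub_le {K ψ φ : ℝ} (hK : 0 ≤ K) :
    Real.exp (-(K * |Real.cos φ - Real.cos ψ|)) ≤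
      Real.exp (-(K * Real.sin ψ * |Real.sin ((φ - ψ) / 2)|)) +
        Real.exp (-(K * Real.sin ψ * |Real.sin ((φ + ψ) / 2)|)) := by
  set s := |Real.sin ((φ - ψ) / 2)| with hs
  set t := |Real.sin ((φ + ψ) / 2)| with ht
  have h1 : |Real.cos φ - Real.cos ψ| = 2 * t * s := by
    rw [Real.cos_sub_cos, abs_mul, abs_mul, abs_neg, abs_two]
  have h2 : Real.sin ψ ≤ s + t := by
    have e : ψ = (φ + ψ) / 2 - (φ - ψ) / 2 := by ring
    have h3 : Real.sin ψ = Real.sin ((φ + ψ) / 2) * Real.cos ((φ - ψ) / 2) -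
        Real.cos ((φ + ψ) / 2) * Real.sin ((φ - ψ) / 2) := by
      conv_lhs => rw [e, Real.sin_sub]
    rw [h3]
    refine (le_abs_self _).trans ((abs_sub _ _).trans ?_)
    rw [abs_mul, abs_mul]
    have h4 := Real.abs_cos_le_one ((φ - ψ) / 2)
    have h5 := Real.abs_cos_le_one ((φ + ψ) / 2)
    have h6 : 0 ≤ s := abs_nonneg _
    have h7 : 0 ≤ t := abs_nonneg _
    nlinarith
  have h6 : 0 ≤ s := abs_nonneg _
  have h7 : 0 ≤ t := abs_nonneg _
  rw [h1]
  rcases le_total s t with h | h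
  · refine le_add_of_le_of_nonneg (Real.exp_le_exp.2 ?_) (Real.exp_pos _).le
    have : Real.sin ψ * s ≤ 2 * t * s := by nlinarith
    nlinarith
  · refine le_add_of_nonneg_of_le (Real.exp_pos _).le (Real.exp_le_exp.2 ?_)
    have : Real.sin ψ * t ≤ 2 * t * s := by nlinarith
    nlinarith

/-- The ratio is exponentially small in the difference of the squared norms. -/
theorem ratio_le_exp {a b : ℂ} {M : ℝ} (hM : 0 < M) (ha : ‖a‖ ≤ M) (hb : ‖b‖ ≤ M) :
    ratio a b ≤ Real.exp (-(|‖a‖ ^ 2 - ‖b‖ ^ 2| / (2 * M ^ 2))) := by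
  have h0 := ratio_nonneg a b
  have hsq : ratio a b ^ 2 ≤ Real.exp (-(|‖a‖ ^ 2 - ‖b‖ ^ 2| / M ^ 2)) := by
    have hmax0 : 0 ≤ max ‖a‖ ‖b‖ := le_max_of_le_left (norm_nonneg _)
    have hmaxM : max ‖a‖ ‖b‖ ≤ M := max_le ha hb
    have h1 : |‖a‖ ^ 2 - ‖b‖ ^ 2| = max ‖a‖ ‖b‖ ^ 2 - min ‖a‖ ‖b‖ ^ 2 := by
      have hna := norm_nonneg a
      have hnb := norm_nonneg b
      rcases le_total ‖a‖ ‖b‖ with h | h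
      · rw [max_eq_right h, min_eq_left h, abs_sub_comm, abs_of_nonneg]
        nlinarith
      · rw [max_eq_left h, min_eq_right h, abs_of_nonneg]
        nlinarith
    have h2 : |‖a‖ ^ 2 - ‖b‖ ^ 2| = max ‖a‖ ‖b‖ ^ 2 * (1 - ratio a b ^ 2) := by
      rw [h1, min_eq_ratio_mul]; ring
    have h3 : 0 ≤ 1 - ratio a b ^ 2 := by nlinarith [ratio_le_one a b]
    have h4 : |‖a‖ ^ 2 - ‖b‖ ^ 2| / M ^ 2 ≤ 1 - ratio a b ^ 2 := by
      rw [div_le_iff₀ (by positivity), h2, mul_comm]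
      gcongr
    have h5 := Real.add_one_le_exp (-(|‖a‖ ^ 2 - ‖b‖ ^ 2| / M ^ 2))
    linarith
  have h2 : Real.exp (-(|‖a‖ ^ 2 - ‖b‖ ^ 2| / M ^ 2)) =
      Real.exp (-(|‖a‖ ^ 2 - ‖b‖ ^ 2| / (2 * M ^ 2))) ^ 2 := by
    rw [← Real.exp_nat_mul]
    congr 1
    push_cast
    field_simp
  rw [h2] at hsq
  exact le_of_sq_le_sq hsq (Real.exp_pos _).le

theorem norm_coeff_le (α β γ θ : ℝ) :
    ‖coeffA α (circlePoint θ)‖ ≤ 1 + |α| + |β| + |γ ^ 2 - α * β| ∧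
      ‖coeffB α β γ (circlePoint θ)‖ ≤ 1 + |α| + |β| + |γ ^ 2 - α * β| := by
  have h1 := abs_nonneg α
  have h2 := abs_nonneg β
  have h3 := abs_nonneg (γ ^ 2 - α * β)
  have hδ : ((γ : ℂ) ^ 2 - α * β) = ((γ ^ 2 - α * β : ℝ) : ℂ) := by push_cast; ring
  constructor
  · refine (norm_add_le _ _).trans ?_
    rw [norm_mul, norm_circlePoint, Complex.norm_real, Real.norm_eq_abs, norm_one]
    linarith
  · rw [coeffB, hδ]
    refine (norm_sub_le _ _).trans ?_
    rw [norm_mul, norm_circlePoint, Complex.norm_real, Complex.norm_real, Real.norm_eq_abs,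
      Real.norm_eq_abs]
    linarith

/-- In the rough case (`Δ` has two simple zeros on the torus), only boundedly many frequencies are
close to resonance, uniformly in the size of the torus. -/
theorem sum_ratio_le_of_rough {α β γ : ℝ} (hα : 0 < α) (hβ : 0 < β) (hαβγ : α * β < γ ^ 2)
    (hrough : |1 + α ^ 2 - β ^ 2 - (γ ^ 2 - α * β) ^ 2| < 2 * (α + β * (γ ^ 2 - α * β))) :
    ∃ C : ℝ, ∀ (n : ℕ) [NeZero n] (τ : ℝ),
      ∑ k : ZMod n, ratio (coeffA α (circlePoint (τ / n) * rootChar k) ^ n)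
        (coeffB α β γ (circlePoint (τ / n) * rootChar k) ^ n) ≤ C := by
  set A₀ := 1 + α ^ 2 - β ^ 2 - (γ ^ 2 - α * β) ^ 2 with hA₀
  set A₁ := 2 * (α + β * (γ ^ 2 - α * β)) with hA₁
  have hA₁pos : 0 < A₁ := slope_pos hα hβ hαβγ
  have habs := abs_lt.1 hrough
  set ψ := Real.arccos (-A₀ / A₁) with hψ
  have hcos : Real.cos ψ = -A₀ / A₁ := by
    rw [hψ, Real.cos_arccos]
    · rw [le_div_iff₀ hA₁pos]; linarith
    · rw [div_le_iff₀ hA₁pos]; linarith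
  have hsin : 0 < Real.sin ψ := by
    refine Real.sin_pos_of_pos_of_lt_pi ?_ ?_
    · rw [hψ, Real.arccos_pos, div_lt_iff₀ hA₁pos]; linarith
    · rw [hψ]
      refine lt_of_le_of_ne (Real.arccos_le_pi _) fun h => ?_
      rw [Real.arccos_eq_pi, div_le_iff₀ hA₁pos] at h
      linarith
  set M := 1 + |α| + |β| + |γ ^ 2 - α * β| with hM
  have hMpos : 0 < M := by positivity
  set c := A₁ / (2 * M ^ 2) * Real.sin ψ with hc
  have hcpos : 0 < c := by positivity
  refine ⟨2 / (1 - Real.exp (-(2 * c))) + 2 / (1 - Real.exp (-(2 * c))), fun n hn τ => ?_⟩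
  have hn0 : 0 < n := Nat.pos_of_ne_zero (NeZero.ne n)
  have hn' : (0 : ℝ) < n := by exact_mod_cast hn0
  have hpi := Real.pi_pos
  rw [sum_zmod_eq_range]
  simp only [twisted_rootChar, ratio_pow]
  have hterm : ∀ j : ℕ, ratio (coeffA α (circlePoint ((j + τ) / n)))
      (coeffB α β γ (circlePoint ((j + τ) / n))) ^ n ≤
      Real.exp (-(c * n * |Real.sin (Real.pi * (j + (τ - n * ψ / (2 * Real.pi))) / n)|)) +
      Real.exp (-(c * n * |Real.sin (Real.pi * (j + (τ + n * ψ / (2 * Real.pi))) / n)|)) := by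
    intro j
    set φ := 2 * Real.pi * ((j + τ) / n) with hφ
    obtain ⟨h1, h2⟩ := norm_coeff_le α β γ ((j + τ) / n)
    have h3 := ratio_le_exp hMpos h1 h2
    rw [normSq_coeff_sub, ← hφ, ← hA₀, ← hA₁] at h3
    have h4 : A₀ + A₁ * Real.cos φ = A₁ * (Real.cos φ - Real.cos ψ) := by
      rw [hcos]; field_simp; ring
    rw [h4, abs_mul, abs_of_pos hA₁pos] at h3
    have h5 := pow_le_pow_left₀ (ratio_nonneg _ _) h3 n
    rw [← Real.exp_nat_mul] at h5
    have h6 : (n : ℝ) * -(A₁ * |Real.cos φ - Real.cos ψ| / (2 * M ^ 2)) =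
        -((n * A₁ / (2 * M ^ 2)) * |Real.cos φ - Real.cos ψ|) := by ring
    rw [h6] at h5
    refine h5.trans ((exp_cos_sub_le (by positivity)).trans (le_of_eq ?_))
    have e1 : (φ - ψ) / 2 = Real.pi * (j + (τ - n * ψ / (2 * Real.pi))) / n := by
      rw [hφ]; field_simp; ring
    have e2 : (φ + ψ) / 2 = Real.pi * (j + (τ + n * ψ / (2 * Real.pi))) / n := by
      rw [hφ]; field_simp; ring
    have e3 : n * A₁ / (2 * M ^ 2) * Real.sin ψ = c * n := by rw [hc]; ring
    rw [e1, e2, e3]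
  refine (Finset.sum_le_sum fun j _ => hterm j).trans ?_
  rw [Finset.sum_add_distrib]
  exact add_le_add (sum_exp_sin_le hcpos hn0 _) (sum_exp_sin_le hcpos hn0 _)

theorem ratio_lt_one {a b : ℂ} (h : ‖a‖ ≠ ‖b‖) : ratio a b < 1 := by
  unfold ratio
  have h1 : min ‖a‖ ‖b‖ < max ‖a‖ ‖b‖ := min_lt_max.2 h
  rw [div_lt_one (lt_of_le_of_lt (by positivity) h1)]
  exact h1

/-- In all cases, the number of frequencies close to resonance is of smaller order than the size
of the torus. -/
theorem tendsto_average_ratio {α β γ : ℝ} (hα : 0 < α) (hβ : 0 < β) (hγ : 0 < γ)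
    (hαβγ : α * β < γ ^ 2) {τ : ℕ → ℝ} (hτ : ∀ n, τ n ∈ Set.Icc (0 : ℝ) 1) :
    Tendsto (fun n : ℕ => ((n + 1 : ℕ) : ℝ)⁻¹ * ∑ k : ZMod (n + 1),
      ratio (coeffA α (circlePoint (τ n / (n + 1 : ℕ)) * rootChar k) ^ (n + 1))
        (coeffB α β γ (circlePoint (τ n / (n + 1 : ℕ)) * rootChar k) ^ (n + 1))) atTop (𝓝 0) := by
  have key := tendsto_riemannSum τ hτ
    (fun n θ => ((ratio (coeffA α (circlePoint θ)) (coeffB α β γ (circlePoint θ)) ^ (n + 1) : ℝ) : ℂ))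
    (fun _ => 0) 1 (Eventually.of_forall fun n j _ => by
      rw [Complex.norm_real, Real.norm_eq_abs, abs_of_nonneg (pow_nonneg (ratio_nonneg _ _) _)]
      exact pow_le_one₀ (ratio_nonneg _ _) (ratio_le_one _ _)) (by
      have hae : ∀ᵐ θ : ℝ, ‖coeffA α (circlePoint θ)‖ ≠ ‖coeffB α β γ (circlePoint θ)‖ :=
        (countable_norm_coeff_eq hα hβ hαβγ).ae_notMem volume
      filter_upwards [hae] with θ hθ u hu
      have hw : Tendsto (fun n => circlePoint (u n)) atTop (𝓝 (circlePoint θ)) :=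
        (continuous_circlePoint.tendsto θ).comp hu
      have hA : Tendsto (fun n => ‖coeffA α (circlePoint (u n))‖) atTop
          (𝓝 ‖coeffA α (circlePoint θ)‖) := ((hw.const_mul _).const_add _).norm
      have hB : Tendsto (fun n => ‖coeffB α β γ (circlePoint (u n))‖) atTop
          (𝓝 ‖coeffB α β γ (circlePoint θ)‖) := ((hw.const_mul _).const_sub _).norm
      have hr : Tendsto (fun n => ratio (coeffA α (circlePoint (u n)))
          (coeffB α β γ (circlePoint (u n)))) atTop
          (𝓝 (ratio (coeffA α (circlePoint θ)) (coeffB α β γ (circlePoint θ)))) :=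
        (hA.min hB).div (hA.max hB) (max_coeff_pos hα hγ hαβγ _).ne'
      obtain ⟨q, hq1, hq2⟩ := exists_between (ratio_lt_one hθ)
      have hq0 : 0 ≤ q := (ratio_nonneg _ _).trans hq1.le
      rw [← Complex.ofReal_zero]
      refine (Complex.continuous_ofReal.tendsto 0).comp ?_
      refine squeeze_zero' (Eventually.of_forall fun n => pow_nonneg (ratio_nonneg _ _) _) ?_
        ((tendsto_pow_atTop_nhds_zero_of_lt_one hq0 hq2).comp (tendsto_add_atTop_nat 1))
      filter_upwards [hr.eventually (gt_mem_nhds hq1)] with n hn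
      exact pow_le_pow_left₀ (ratio_nonneg _ _) hn.le _)
  simp only [intervalIntegral.integral_zero] at key
  have h2 := (Complex.continuous_re.tendsto 0).comp key
  refine h2.congr fun n => ?_
  rw [sum_zmod_eq_range]
  simp only [twisted_rootChar, ratio_pow, Function.comp_apply]
  rw [← Complex.ofReal_sum, ← Complex.ofReal_natCast, ← Complex.ofReal_inv, ← Complex.ofReal_mul,
    Complex.ofReal_re]

/-! ### Tilted sums and deviations -/

section torus
variable {n : ℕ} [NeZero n]

/-- The weighted sum over a set of torus configurations in which every path crossing the
horizontal seam receives the additional factor `t`. -/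
noncomputable def tiltedSum (α β γ : ℝ) (S : Finset (Config (ZMod n))) (t : ℝ) : ℝ :=
  ∑ σ ∈ S, weight (freeFermionWeight α β γ) σ * t ^ verticalCount σ

/-- The sign `(-1) ^ (hv)` is a combination of the four characters of the parities of `h`
and `v`. -/
theorem parity_identity (h v : ℕ) :
    (-1 : ℂ) ^ (h * v) * (1 + (-1) ^ v + (-1) ^ h - (-1) ^ h * (-1) ^ v) = 2 := by
  rcases Nat.even_or_odd h with hh | hh <;> rcases Nat.even_or_odd v with hv | hv
  · rw [(hh.mul_right v).neg_one_pow, hh.neg_one_pow, hv.neg_one_pow]; norm_num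
  · rw [(hh.mul_right v).neg_one_pow, hh.neg_one_pow, hv.neg_one_pow]; norm_num
  · rw [(hv.mul_left h).neg_one_pow, hh.neg_one_pow, hv.neg_one_pow]; norm_num
  · rw [(hh.mul hv).neg_one_pow, hh.neg_one_pow, hv.neg_one_pow]; norm_num

/-- Sums without signs as combinations of the four signed sums. -/
theorem tiltedSum_eq_signedSum (α β γ : ℝ) (S : Finset (Config (ZMod n))) (t : ℝ) :
    (tiltedSum α β γ S t : ℂ) = 1 / 2 * (signedSum α β γ S 1 t + signedSum α β γ S 1 (-t) +
      signedSum α β γ S (-1) t - signedSum α β γ S (-1) (-t)) := by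
  simp only [tiltedSum, signedSum]
  rw [← Finset.sum_add_distrib, ← Finset.sum_add_distrib, ← Finset.sum_sub_distrib, Finset.mul_sum]
  push_cast
  refine Finset.sum_congr rfl fun σ _ => ?_
  have := parity_identity (horizontalCount σ) (verticalCount σ)
  rw [neg_pow (t : ℂ), one_pow]
  linear_combination (-(1 / 2 : ℂ) * weight (freeFermionWeight α β γ) σ * t ^ verticalCount σ) * this

section positive
variable {α β γ : ℝ} (hα : 0 < α) (hβ : 0 < β) (hγ : 0 < γ) (hαβγ : α * β < γ ^ 2)
include hα hβ hγ hαβγ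

theorem norm_signedSum_le (S : Finset (Config (ZMod n))) {ε : ℂ} (hε : ‖ε‖ = 1) (η : ℂ) :
    ‖signedSum α β γ S ε η‖ ≤ tiltedSum α β γ S ‖η‖ := by
  refine (norm_sum_le _ _).trans (Finset.sum_le_sum fun σ _ => le_of_eq ?_)
  have := weight_pos (freeFermionWeight_pos hα hβ hγ hαβγ) σ
  simp only [norm_mul, norm_pow, norm_neg, norm_one, one_pow, hε, one_mul, mul_one,
    Complex.norm_real, Real.norm_eq_abs, abs_of_pos this]

theorem tiltedSum_nonneg (S : Finset (Config (ZMod n))) {t : ℝ} (ht : 0 ≤ t) :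
    0 ≤ tiltedSum α β γ S t :=
  Finset.sum_nonneg fun σ _ =>
    mul_nonneg (weight_pos (freeFermionWeight_pos hα hβ hγ hαβγ) σ).le (pow_nonneg ht _)

theorem tiltedSum_univ_pos {t : ℝ} (ht : 0 < t) :
    0 < tiltedSum α β γ (Finset.univ : Finset (Config (ZMod n))) t :=
  Finset.sum_pos (fun σ _ => mul_pos (weight_pos (freeFermionWeight_pos hα hβ hγ hαβγ) σ)
    (pow_pos ht _)) ⟨⟨fun _ => true, fun _ => ⟨rfl, rfl⟩⟩, Finset.mem_univ _⟩

/-- Lower bound for the tilted partition function by the geometric mean of its signed version. -/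
theorem prod_max_le_tiltedSum (τ : ℝ) {t : ℝ} (ht : 0 < t) :
    ∏ k : ZMod n, max ‖coeffA α (circlePoint (τ / n) * rootChar k) ^ n‖
      (t * ‖coeffB α β γ (circlePoint (τ / n) * rootChar k) ^ n‖) ≤
      tiltedSum α β γ (Finset.univ : Finset (Config (ZMod n))) t := by
  obtain ⟨η, hη, h⟩ := exists_prod_max_le
    (fun k : ZMod n => coeffA α (circlePoint (τ / n) * rootChar k) ^ n)
    (fun k : ZMod n => coeffB α β γ (circlePoint (τ / n) * rootChar k) ^ n) ht
  refine h.trans ?_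
  rw [← signedSum_univ α β γ (circlePoint (τ / n)) η, ← hη]
  refine norm_signedSum_le hα hβ hγ hαβγ _ ?_ η
  rw [norm_mul, norm_pow, norm_pow, norm_neg, norm_one, one_pow, norm_circlePoint, one_pow, mul_one]

end positive
end torus

theorem circlePoint_zero : circlePoint 0 = 1 := by simp [circlePoint]

theorem circlePoint_half : circlePoint (1 / 2) = -1 := by
  rw [circlePoint, ← Complex.exp_pi_mul_I]
  congr 2
  push_cast
  ring

/-- Both seam signs are realized by a horizontal twist. -/
theorem exists_sign_twist {ε : ℂ} (hε : ε = 1 ∨ ε = -1) (n : ℕ) [NeZero n] :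
    ∃ τ ∈ Set.Icc (0 : ℝ) 1, (-1) ^ (n + 1) * circlePoint (τ / n) ^ n = ε := by
  have hn : (n : ℝ) ≠ 0 := by exact_mod_cast NeZero.ne n
  have h0 : ∀ τ : ℝ, circlePoint (τ / n) ^ n = circlePoint τ := fun τ => by
    rw [circlePoint_pow, mul_div_cancel₀ _ hn]
  simp only [h0]
  have h1 : ∃ τ ∈ Set.Icc (0 : ℝ) 1, circlePoint τ = 1 := ⟨0, by simp, circlePoint_zero⟩
  have h2 : ∃ τ ∈ Set.Icc (0 : ℝ) 1, circlePoint τ = -1 :=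
    ⟨1 / 2, by norm_num, circlePoint_half⟩
  rcases neg_one_pow_eq_or ℂ (n + 1) with h | h <;> rw [h] <;> rcases hε with rfl | rfl
  · simpa using h1
  · simpa using h2
  · obtain ⟨τ, hτ, h⟩ := h2
    exact ⟨τ, hτ, by rw [h]; norm_num⟩
  · obtain ⟨τ, hτ, h⟩ := h1
    exact ⟨τ, hτ, by rw [h]; norm_num⟩

theorem eventually_castVertex_injective {k : ℕ} {v : Fin k → ℤ × ℤ} (hv : Function.Injective v) :
    ∀ᶠ n : ℕ in atTop, Function.Injective fun i => castVertex (n + 1) (v i) := by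
  have h : ∀ i j : Fin k, ∀ᶠ n : ℕ in atTop,
      castVertex (n + 1) (v i) = castVertex (n + 1) (v j) → i = j := by
    intro i j
    filter_upwards [eventually_gt_atTop (|(v j).1 - (v i).1| + |(v j).2 - (v i).2|).toNat]
      with n hn h
    have hn' : |(v j).1 - (v i).1| + |(v j).2 - (v i).2| < n := by
      have := abs_nonneg ((v j).1 - (v i).1)
      have := abs_nonneg ((v j).2 - (v i).2)
      omega
    rw [castVertex, castVertex, Prod.mk.injEq, ZMod.intCast_eq_intCast_iff_dvd_sub,
      ZMod.intCast_eq_intCast_iff_dvd_sub] at h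
    have h1 := Int.eq_zero_of_abs_lt_dvd h.1 (by
      have := abs_nonneg ((v j).2 - (v i).2)
      push_cast; omega)
    have h2 := Int.eq_zero_of_abs_lt_dvd h.2 (by
      have := abs_nonneg ((v j).1 - (v i).1)
      push_cast; omega)
    exact hv (Prod.ext (by omega) (by omega))
  filter_upwards [eventually_all.2 fun i => eventually_all.2 (h i)] with n hn i j hij
  exact hn i j hij

theorem eventually_distance_lt {k : ℕ} (v : Fin k → ℤ × ℤ) (t : Fin k → VertexType) :
    ∀ᶠ n : ℕ in atTop, ∀ p q : Fin k × Fin 2,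
      |(target (v q.1) (t q.1) q.2).2.2 - (source (v p.1) p.2).2.2| + 1 < ((n + 1 : ℕ) : ℤ) := by
  refine eventually_all.2 fun p => eventually_all.2 fun q => ?_
  filter_upwards [eventually_gt_atTop
    (|(target (v q.1) (t q.1) q.2).2.2 - (source (v p.1) p.2).2.2| + 1).toNat] with n hn
  push_cast
  omega

/-- The asserted value of the probability of the types `t` at the vertices `v`, in terms of the
one-dimensional form of the kernel. -/
noncomputable def limitValue (α β γ : ℝ) {k : ℕ} (v : Fin k → ℤ × ℤ) (t : Fin k → VertexType) : ℂ :=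
  (∏ i, (freeFermionWeight α β γ (t i) : ℂ)) *
    (Matrix.of fun p q : Fin k × Fin 2 => limitKernel α β γ
      (source (v p.1) p.2) (target (v q.1) (t q.1) q.2)).det

/-- The configurations of the torus of side `n + 1` with types `t` at the vertices `v`. -/
noncomputable abbrev torusEvent (n : ℕ) {k : ℕ} (v : Fin k → ℤ × ℤ) (t : Fin k → VertexType) :
    Finset (Config (ZMod (n + 1))) :=
  typeEvent (fun i => castVertex (n + 1) (v i)) t

/-- The deviation of the signed sum over a cylinder event from its predicted value. -/
noncomputable def deviation (α β γ : ℝ) (n : ℕ) {k : ℕ} (v : Fin k → ℤ × ℤ)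
    (t : Fin k → VertexType) (ε η : ℂ) : ℂ :=
  signedSum α β γ (torusEvent n v t) ε η -
    limitValue α β γ v t * signedSum α β γ (Finset.univ : Finset (Config (ZMod (n + 1)))) ε η

section limits
variable {α β γ : ℝ} (hα : 0 < α) (hβ : 0 < β) (hγ : 0 < γ) (hαβγ : α * β < γ ^ 2)
include hα hβ hγ hαβγ

/-- Away from resonances the deviation is small compared with the signed partition function. -/
theorem exists_deviation_eq {k : ℕ} {v : Fin k → ℤ × ℤ} (hv : Function.Injective v)
    (t : Fin k → VertexType) {ε : ℂ} {τ : ℕ → ℝ} (hτ : ∀ n, τ n ∈ Set.Icc (0 : ℝ) 1)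
    (hτε : ∀ n : ℕ, (-1) ^ (n + 1 + 1) * circlePoint (τ n / (n + 1 : ℕ)) ^ (n + 1) = ε)
    {η : ℕ → ℂ} {c r R : ℝ} (hc : 0 < c) (hr : 0 < r) (hηr : ∀ n, r ≤ ‖η n‖) (hηR : ∀ n, ‖η n‖ ≤ R)
    (hgood : ∀ n, ∀ k : ZMod (n + 1),
      c * max ‖coeffA α (circlePoint (τ n / (n + 1 : ℕ)) * rootChar k)‖
        ‖coeffB α β γ (circlePoint (τ n / (n + 1 : ℕ)) * rootChar k)‖ ^ (n + 1) ≤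
      ‖coeffA α (circlePoint (τ n / (n + 1 : ℕ)) * rootChar k) ^ (n + 1) +
        coeffB α β γ (circlePoint (τ n / (n + 1 : ℕ)) * rootChar k) ^ (n + 1) * η n‖) :
    ∃ d : ℕ → ℂ, Tendsto d atTop (𝓝 0) ∧ ∀ᶠ n in atTop, deviation α β γ n v t ε (η n) =
      d n * signedSum α β γ (Finset.univ : Finset (Config (ZMod (n + 1)))) ε (η n) := by
  refine ⟨fun n => (∏ i, (freeFermionWeight α β γ (t i) : ℂ)) *
    (Matrix.of fun p q : Fin k × Fin 2 => torusKernel α β γ (n + 1)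
      (circlePoint (τ n / (n + 1 : ℕ))) (η n)
      (source (v p.1) p.2) (target (v q.1) (t q.1) q.2)).det - limitValue α β γ v t, ?_, ?_⟩
  · rw [← sub_self (limitValue α β γ v t)]
    refine Tendsto.sub_const (Tendsto.const_mul _ ?_) _
    refine ((continuous_id.matrix_det).tendsto _).comp ?_
    refine tendsto_pi_nhds.2 fun p => tendsto_pi_nhds.2 fun q => ?_
    exact tendsto_torusKernel hα hβ hγ hαβγ hτ hc hr hηr hηR hgood _ _
  · filter_upwards [eventually_castVertex_injective hv, eventually_distance_lt v t] with n h1 h2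
    have hne : ∀ k : ZMod (n + 1), coeffA α (circlePoint (τ n / (n + 1 : ℕ)) * rootChar k) ^ (n + 1) +
        coeffB α β γ (circlePoint (τ n / (n + 1 : ℕ)) * rootChar k) ^ (n + 1) * η n ≠ 0 := by
      intro k
      have := max_coeff_pos hα hγ hαβγ (circlePoint (τ n / (n + 1 : ℕ)) * rootChar k)
      exact norm_pos_iff.1 (lt_of_lt_of_le (by positivity) (hgood n k))
    have h3 := signedSum_typeEvent α β γ (circlePoint_ne_zero (τ n / (n + 1 : ℕ)))
      (norm_pos_iff.1 (hr.trans_le (hηr n))) hne v t h1 h2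
    rw [hτε] at h3
    rw [deviation, h3]
    ring

/-- Convergence of tilted probabilities follows from smallness of the four deviations. -/
theorem tendsto_tiltedSum_of_deviation {k : ℕ} (v : Fin k → ℤ × ℤ)
    (t : Fin k → VertexType) {s : ℝ} (hs : 0 < s)
    (h : ∀ ε : ℂ, (ε = 1 ∨ ε = -1) → ∀ η : ℂ, (η = s ∨ η = -s) →
      Tendsto (fun n : ℕ => ‖deviation α β γ n v t ε η‖ /
        tiltedSum α β γ (Finset.univ : Finset (Config (ZMod (n + 1)))) s) atTop (𝓝 0)) :
    Tendsto (fun n : ℕ => ((tiltedSum α β γ (torusEvent n v t) s /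
      tiltedSum α β γ (Finset.univ : Finset (Config (ZMod (n + 1)))) s : ℝ) : ℂ)) atTop
      (𝓝 (limitValue α β γ v t)) := by
  rw [tendsto_iff_norm_sub_tendsto_zero]
  have h1 := ((((h 1 (Or.inl rfl) s (Or.inl rfl)).add (h 1 (Or.inl rfl) (-s) (Or.inr rfl))).add
    (h (-1) (Or.inr rfl) s (Or.inl rfl))).add (h (-1) (Or.inr rfl) (-s) (Or.inr rfl)))
  simp only [add_zero] at h1
  refine squeeze_zero (fun _ => norm_nonneg _) (fun n => ?_) h1
  have hZ := tiltedSum_univ_pos (n := n + 1) hα hβ hγ hαβγ hs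
  set Z := tiltedSum α β γ (Finset.univ : Finset (Config (ZMod (n + 1)))) s with hZdef
  have hZc : (Z : ℂ) ≠ 0 := by exact_mod_cast hZ.ne'
  have e : ((tiltedSum α β γ (torusEvent n v t) s / Z : ℝ) : ℂ) - limitValue α β γ v t =
      (1 / 2 * (deviation α β γ n v t 1 s + deviation α β γ n v t 1 (-s) +
        deviation α β γ n v t (-1) s - deviation α β γ n v t (-1) (-s))) / Z := by
    rw [eq_div_iff hZc]
    have h2 : (((tiltedSum α β γ (torusEvent n v t) s / Z : ℝ) : ℂ) - limitValue α β γ v t) * Z =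
        (tiltedSum α β γ (torusEvent n v t) s : ℂ) - limitValue α β γ v t * Z := by
      push_cast
      field_simp
    rw [h2, hZdef, tiltedSum_eq_signedSum, tiltedSum_eq_signedSum]
    simp only [deviation]
    ring
  rw [e, norm_div, Complex.norm_real, Real.norm_eq_abs, abs_of_pos hZ, ← add_div, ← add_div,
    ← add_div]
  refine div_le_div_of_nonneg_right ?_ hZ.le
  rw [norm_mul]
  have h3 : ‖(1 / 2 : ℂ)‖ ≤ 1 := by norm_num
  refine (mul_le_of_le_one_left (norm_nonneg _) h3).trans ?_
  refine (norm_sub_le _ _).trans (add_le_add ?_ le_rfl)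
  refine (norm_add_le _ _).trans (add_le_add ?_ le_rfl)
  exact norm_add_le _ _

end limits

/-! ### The rough case -/

theorem differentiable_signedSum {n : ℕ} [NeZero n] (α β γ : ℝ) (S : Finset (Config (ZMod n)))
    (ε : ℂ) : Differentiable ℂ fun η => signedSum α β γ S ε η := by
  unfold signedSum
  fun_prop

/-- Maximum principle after division by a power of the variable: on a disc around a point of the
unit circle that does not contain `0`. -/
theorem exists_sphere_norm_le {f : ℂ → ℂ} (hf : Differentiable ℂ f) {η₀ : ℂ} (hη₀ : ‖η₀‖ = 1)
    {r : ℝ} (hr : 0 < r) (hr1 : r < 1) (κ : ℕ) :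
    ∃ ζ : ℂ, ‖ζ - η₀‖ = r ∧ ‖f η₀‖ * ‖ζ‖ ^ κ ≤ ‖f ζ‖ := by
  have hne : ∀ ζ ∈ Metric.closedBall η₀ r, ζ ≠ 0 := by
    rintro ζ hζ rfl
    rw [mem_closedBall_iff_norm, zero_sub, norm_neg, hη₀] at hζ
    linarith
  have hd : DifferentiableOn ℂ (fun ζ => f ζ / ζ ^ κ) (Metric.closedBall η₀ r) :=
    hf.differentiableOn.div (differentiableOn_id.pow κ) fun ζ hζ => pow_ne_zero _ (hne ζ hζ)
  obtain ⟨ζ, hζ, hmax⟩ := Complex.exists_mem_frontier_isMaxOn_norm (Metric.isBounded_ball)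
    ⟨η₀, Metric.mem_ball_self hr⟩ (hd.diffContOnCl_ball (R := r) subset_rfl)
  rw [frontier_ball _ hr.ne', mem_sphere_iff_norm] at hζ
  refine ⟨ζ, hζ, ?_⟩
  have h1 : ‖f η₀ / η₀ ^ κ‖ ≤ ‖f ζ / ζ ^ κ‖ :=
    hmax (subset_closure (Metric.mem_ball_self hr))
  have hζ0 : ζ ≠ 0 := hne ζ (mem_closedBall_iff_norm.2 hζ.le)
  have hpos : 0 < ‖ζ‖ := norm_pos_iff.2 hζ0
  rw [norm_div, norm_div, norm_pow, norm_pow, hη₀, one_pow, div_one,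
    le_div_iff₀ (by positivity)] at h1
  exact h1

section limits
variable {α β γ : ℝ} (hα : 0 < α) (hβ : 0 < β) (hγ : 0 < γ) (hαβγ : α * β < γ ^ 2)
include hα hβ hγ hαβγ

/-- Rough case: the deviation at `±1` is controlled, through the maximum principle, by its values
on a circle around `±1` avoiding all resonances. -/
theorem tendsto_deviation_of_rough
    (hrough : |1 + α ^ 2 - β ^ 2 - (γ ^ 2 - α * β) ^ 2| < 2 * (α + β * (γ ^ 2 - α * β)))
    {k : ℕ} {v : Fin k → ℤ × ℤ} (hv : Function.Injective v) (t : Fin k → VertexType)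
    {ε : ℂ} (hε : ε = 1 ∨ ε = -1) {η₀ : ℂ} (hη₀ : ‖η₀‖ = 1) :
    Tendsto (fun n : ℕ => ‖deviation α β γ n v t ε η₀‖ /
        tiltedSum α β γ (Finset.univ : Finset (Config (ZMod (n + 1)))) 1) atTop (𝓝 0) := by
  obtain ⟨C, hC⟩ := sum_ratio_le_of_rough hα hβ hαβγ hrough
  obtain ⟨K, hK⟩ := exists_nat_ge (4 * C)
  choose τ hτ hτε using fun n : ℕ => exists_sign_twist hε (n + 1)
  set A : (n : ℕ) → ZMod (n + 1) → ℂ := fun n k =>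
    coeffA α (circlePoint (τ n / (n + 1 : ℕ)) * rootChar k) ^ (n + 1) with hA
  set B : (n : ℕ) → ZMod (n + 1) → ℂ := fun n k =>
    coeffB α β γ (circlePoint (τ n / (n + 1 : ℕ)) * rootChar k) ^ (n + 1) with hB
  have hsum : ∀ n, ∑ k, ratio (A n k) (B n k) ≤ C := fun n => hC (n + 1) (τ n)
  choose r hr1 hr2 hr using fun n => exists_good_radius (A n) (B n) hη₀
    (K := K) (by have := hsum n; linarith)
  -- dividing by this power of `η` makes the signed partition function on the circle comparable with
  -- the lower bound `∏ k, max ‖A n k‖ ‖B n k‖`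
  set κ : ℕ → ℕ := fun n => (Finset.univ.filter fun k => ‖A n k‖ < ‖B n k‖).card with hκ
  have hdiff : ∀ n : ℕ, Differentiable ℂ fun η => deviation α β γ n v t ε η := fun n =>
    (differentiable_signedSum α β γ _ ε).sub ((differentiable_signedSum α β γ _ ε).const_mul _)
  choose ζ hζ hmax using fun n => exists_sphere_norm_le (hdiff n) hη₀
    (by linarith [hr1 n] : 0 < r n) (by linarith [hr2 n]) (κ n)
  have hζlow : ∀ n, 1 / 2 ≤ ‖ζ n‖ := by
    intro n
    have h1 := norm_sub_norm_le η₀ (ζ n)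
    rw [norm_sub_rev, hζ, hη₀] at h1
    linarith [hr2 n]
  have hζhigh : ∀ n, ‖ζ n‖ ≤ 2 := by
    intro n
    have h1 := norm_sub_norm_le (ζ n) η₀
    rw [hζ, hη₀] at h1
    linarith [hr2 n]
  have hgood : ∀ n, ∀ k : ZMod (n + 1), 1 / (32 * ((K : ℝ) + 1)) *
      max ‖coeffA α (circlePoint (τ n / (n + 1 : ℕ)) * rootChar k)‖
        ‖coeffB α β γ (circlePoint (τ n / (n + 1 : ℕ)) * rootChar k)‖ ^ (n + 1) ≤
      ‖coeffA α (circlePoint (τ n / (n + 1 : ℕ)) * rootChar k) ^ (n + 1) +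
        coeffB α β γ (circlePoint (τ n / (n + 1 : ℕ)) * rootChar k) ^ (n + 1) * ζ n‖ := by
    intro n k
    refine le_trans (le_of_eq ?_) (hr n k (ζ n) (hζ n))
    simp only [hA, hB, norm_pow]
    rcases le_total ‖coeffA α (circlePoint (τ n / (n + 1 : ℕ)) * rootChar k)‖
      ‖coeffB α β γ (circlePoint (τ n / (n + 1 : ℕ)) * rootChar k)‖ with h | h
    · rw [max_eq_right h, max_eq_right (pow_le_pow_left₀ (norm_nonneg _) h _)]
    · rw [max_eq_left h, max_eq_left (pow_le_pow_left₀ (norm_nonneg _) h _)]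
  obtain ⟨d, hd, hdev⟩ := exists_deviation_eq hα hβ hγ hαβγ hv t hτ hτε
    (by positivity : (0 : ℝ) < 1 / (32 * ((K : ℝ) + 1))) (by norm_num : (0 : ℝ) < 1 / 2)
    hζlow hζhigh hgood
  have hlim : Tendsto (fun n => ‖d n‖ * Real.exp (2 * C)) atTop (𝓝 0) := by
    have := hd.norm.mul_const (Real.exp (2 * C))
    simpa using this
  refine squeeze_zero' (Eventually.of_forall fun n => div_nonneg (norm_nonneg _)
    (tiltedSum_nonneg hα hβ hγ hαβγ _ zero_le_one)) ?_ hlim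
  filter_upwards [hdev] with n hn
  have hZ := tiltedSum_univ_pos (n := n + 1) hα hβ hγ hαβγ one_pos
  have hP := prod_max_le_tiltedSum (n := n + 1) hα hβ hγ hαβγ (τ n) one_pos
  simp only [one_mul] at hP
  change ∏ k, max ‖A n k‖ ‖B n k‖ ≤ _ at hP
  have hζpos : 0 < ‖ζ n‖ := lt_of_lt_of_le (by norm_num) (hζlow n)
  have hU := norm_prod_le_of_ratio (A n) (B n) hζpos (hζhigh n) (by
    rw [inv_le_comm₀ hζpos two_pos]; simpa using hζlow n)
  have hS := signedSum_univ (n := n + 1) α β γ (circlePoint (τ n / (n + 1 : ℕ))) (ζ n)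
  rw [hτε] at hS
  rw [div_le_iff₀ hZ]
  have h1 := hmax n
  rw [hn, norm_mul, hS] at h1
  have h2 : ‖deviation α β γ n v t ε η₀‖ * ‖ζ n‖ ^ κ n ≤
      (‖d n‖ * Real.exp (2 * C) *
        tiltedSum α β γ (Finset.univ : Finset (Config (ZMod (n + 1)))) 1) * ‖ζ n‖ ^ κ n := by
    refine h1.trans ?_
    have h3 : ‖∏ k, (A n k + B n k * ζ n)‖ ≤
        tiltedSum α β γ (Finset.univ : Finset (Config (ZMod (n + 1)))) 1 * ‖ζ n‖ ^ κ n *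
          Real.exp (2 * C) := by
      refine hU.trans ?_
      have h4 : Real.exp (2 * ∑ k, ratio (A n k) (B n k)) ≤ Real.exp (2 * C) :=
        Real.exp_le_exp.2 (mul_le_mul_of_nonneg_left (hsum n) zero_le_two)
      exact mul_le_mul (mul_le_mul_of_nonneg_right hP (pow_nonneg hζpos.le _)) h4
        (Real.exp_pos _).le (mul_nonneg hZ.le (pow_nonneg hζpos.le _))
    calc _ ≤ ‖d n‖ * (tiltedSum α β γ (Finset.univ : Finset (Config (ZMod (n + 1)))) 1 *
          ‖ζ n‖ ^ κ n * Real.exp (2 * C)) := mul_le_mul_of_nonneg_left h3 (norm_nonneg _)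
      _ = _ := by ring
  exact le_of_mul_le_mul_right h2 (by positivity)

/-- Both values `η = ±1` needed for the untilted probability lie on the unit circle. -/
theorem tendsto_tiltedSum_of_rough
    (hrough : |1 + α ^ 2 - β ^ 2 - (γ ^ 2 - α * β) ^ 2| < 2 * (α + β * (γ ^ 2 - α * β)))
    {k : ℕ} {v : Fin k → ℤ × ℤ} (hv : Function.Injective v) (t : Fin k → VertexType) :
    Tendsto (fun n : ℕ => ((tiltedSum α β γ (torusEvent n v t) 1 /
      tiltedSum α β γ (Finset.univ : Finset (Config (ZMod (n + 1)))) 1 : ℝ) : ℂ)) atTop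
      (𝓝 (limitValue α β γ v t)) :=
  tendsto_tiltedSum_of_deviation hα hβ hγ hαβγ v t one_pos fun ε hε η hη =>
    tendsto_deviation_of_rough hα hβ hγ hαβγ hrough hv t hε (by
      rcases hη with rfl | rfl <;> simp)

end limits

/-! ### Subexponential comparison in the dominated case -/

/-- One of the two coefficients of `Δ` dominates on the whole unit circle: `coeffB` if `q` is
true, and `coeffA` if `q` is false. -/
def Dominated (q : Bool) (α β γ : ℝ) : Prop :=
  ∀ θ : ℝ, if q then ‖coeffA α (circlePoint θ)‖ ≤ ‖coeffB α β γ (circlePoint θ)‖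
    else ‖coeffB α β γ (circlePoint θ)‖ ≤ ‖coeffA α (circlePoint θ)‖

/-- If the affine function of the cosine in `normSq_coeff_sub` does not change sign, one coefficient
dominates. -/
theorem exists_dominated {α β γ : ℝ} (hα : 0 < α) (hβ : 0 < β) (hαβγ : α * β < γ ^ 2)
    (h : 2 * (α + β * (γ ^ 2 - α * β)) ≤ |1 + α ^ 2 - β ^ 2 - (γ ^ 2 - α * β) ^ 2|) :
    ∃ q, Dominated q α β γ := by
  have hs := slope_pos hα hβ hαβγ
  rcases le_abs.1 h with h | h
  · refine ⟨false, fun θ => ?_⟩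
    have h1 := normSq_coeff_sub α β γ θ
    have h2 := Real.neg_one_le_cos (2 * Real.pi * θ)
    simp only [Bool.false_eq_true, if_false]
    refine le_of_sq_le_sq ?_ (norm_nonneg _)
    nlinarith
  · refine ⟨true, fun θ => ?_⟩
    have h1 := normSq_coeff_sub α β γ θ
    have h2 := Real.cos_le_one (2 * Real.pi * θ)
    simp only [if_true]
    refine le_of_sq_le_sq ?_ (norm_nonneg _)
    nlinarith

/-- The condition that `Δ` has no two simple zeros on the torus is symmetric under transposition
of the lattice. -/
theorem not_rough_transpose {α β γ : ℝ} (hα : 0 < α) (hβ : 0 < β) (hαβγ : α * β < γ ^ 2)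
    (h : 2 * (α + β * (γ ^ 2 - α * β)) ≤ |1 + α ^ 2 - β ^ 2 - (γ ^ 2 - α * β) ^ 2|) :
    2 * (β + α * (γ ^ 2 - β * α)) ≤ |1 + β ^ 2 - α ^ 2 - (γ ^ 2 - β * α) ^ 2| := by
  have hs := slope_pos hα hβ hαβγ
  have h1 := sq_le_sq' (by linarith) h
  rw [sq_abs] at h1
  refine le_of_sq_le_sq ?_ (abs_nonneg _)
  rw [sq_abs]
  nlinarith

/-- A linear factor is close to its dominating term, up to a factor controlled by the ratio. -/
theorem norm_add_mul_le_of_dominated {A B η : ℂ} {q : Bool} (hη : 0 < ‖η‖)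
    (h : if q then ‖A‖ ≤ ‖B‖ else ‖B‖ ≤ ‖A‖) :
    ‖A + B * η‖ ≤ ‖η‖ ^ q.toNat * max ‖A‖ ‖B‖ *
      Real.exp ((‖η‖ + ‖η‖⁻¹) * ratio A B) := by
  have hmin := min_eq_ratio_mul A B
  have hr := ratio_nonneg A B
  have hm : 0 ≤ max ‖A‖ ‖B‖ := le_max_of_le_left (norm_nonneg _)
  have hi : 0 < ‖η‖⁻¹ := inv_pos.2 hη
  have hexp := Real.add_one_le_exp ((‖η‖ + ‖η‖⁻¹) * ratio A B)
  refine (norm_add_le _ _).trans ?_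
  rw [norm_mul]
  cases q
  · simp only [Bool.false_eq_true, if_false] at h
    rw [min_eq_right h] at hmin
    simp only [Bool.toNat_false, pow_zero, one_mul]
    calc ‖A‖ + ‖B‖ * ‖η‖ = max ‖A‖ ‖B‖ * (‖η‖ * ratio A B + 1) := by
          rw [mul_add, mul_one, mul_left_comm, mul_comm (max _ _), ← hmin, max_eq_left h]; ring
      _ ≤ _ := by
          refine mul_le_mul_of_nonneg_left (le_trans ?_ hexp) hm
          nlinarith [mul_nonneg hi.le hr]
  · simp only [if_true] at h
    rw [min_eq_left h] at hmin
    simp only [Bool.toNat_true, pow_one]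
    calc ‖A‖ + ‖B‖ * ‖η‖ = ‖η‖ * max ‖A‖ ‖B‖ * (‖η‖⁻¹ * ratio A B + 1) := by
          have e : ‖η‖ * max ‖A‖ ‖B‖ * (‖η‖⁻¹ * ratio A B + 1) =
              ratio A B * max ‖A‖ ‖B‖ + ‖η‖ * max ‖A‖ ‖B‖ := by field_simp
          rw [e, ← hmin, max_eq_right h]; ring
      _ ≤ _ := by
          refine mul_le_mul_of_nonneg_left (le_trans ?_ hexp) (by positivity)
          nlinarith [mul_nonneg hη.le hr]

/-- The discrepancy of `a` from its frozen value, which is `m` if `q` is true and `0` if `q` is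
false. -/
def defect (q : Bool) (a m : ℝ) : ℝ := if q then m - a else a

section torus
variable {n : ℕ} [NeZero n]

theorem Dominated.pow {q : Bool} {α β γ : ℝ} (h : Dominated q α β γ) (τ : ℝ) (k : ZMod n) :
    if q then ‖coeffA α (circlePoint (τ / n) * rootChar k) ^ n‖ ≤
        ‖coeffB α β γ (circlePoint (τ / n) * rootChar k) ^ n‖
      else ‖coeffB α β γ (circlePoint (τ / n) * rootChar k) ^ n‖ ≤
        ‖coeffA α (circlePoint (τ / n) * rootChar k) ^ n‖ := by
  rw [← ZMod.natCast_zmod_val k, twisted_rootChar, norm_pow, norm_pow]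
  have h1 := h ((k.val + τ) / n)
  cases q
  · simp only [Bool.false_eq_true, if_false] at h1 ⊢
    exact pow_le_pow_left₀ (norm_nonneg _) h1 _
  · simp only [if_true] at h1 ⊢
    exact pow_le_pow_left₀ (norm_nonneg _) h1 _

section positive
variable {α β γ : ℝ} (hα : 0 < α) (hβ : 0 < β) (hγ : 0 < γ) (hαβγ : α * β < γ ^ 2)
include hα hβ hγ hαβγ

/-- The dominating coefficient alone gives a lower bound for every tilt `y`. -/
theorem pow_mul_prod_max_le {q : Bool} (hdom : Dominated q α β γ) (τ : ℝ) {y : ℝ} (hy : 0 < y) :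
    y ^ (q.toNat * n) * ∏ k : ZMod n, max ‖coeffA α (circlePoint (τ / n) * rootChar k) ^ n‖
      ‖coeffB α β γ (circlePoint (τ / n) * rootChar k) ^ n‖ ≤
      tiltedSum α β γ (Finset.univ : Finset (Config (ZMod n))) y := by
  refine le_trans ?_ (prod_max_le_tiltedSum hα hβ hγ hαβγ τ hy)
  have hcard : y ^ (q.toNat * n) = ∏ _k : ZMod n, y ^ q.toNat := by
    rw [Finset.prod_const, Finset.card_univ, ZMod.card, pow_mul]
  rw [hcard, ← Finset.prod_mul_distrib]
  refine Finset.prod_le_prod (fun k _ => by positivity) fun k _ => ?_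
  have h := hdom.pow τ k
  cases q
  · simp only [Bool.false_eq_true, if_false] at h
    rw [max_eq_left h]
    simp
  · simp only [if_true] at h
    rw [max_eq_right h]
    simp

/-- Comparison of tilted partition functions when one coefficient dominates. -/
theorem tiltedSum_compare {q : Bool} (hdom : Dominated q α β γ) {x y : ℝ} (hx : 0 < x) (hy : 0 < y)
    {τ τ' : ℝ} (hτ : (-1) ^ (n + 1) * circlePoint (τ / n) ^ n = 1)
    (hτ' : (-1) ^ (n + 1) * circlePoint (τ' / n) ^ n = -1) :
    tiltedSum α β γ (Finset.univ : Finset (Config (ZMod n))) x * y ^ (q.toNat * n) ≤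
      Real.exp (Real.log 2 + (x + x⁻¹) * (∑ k : ZMod n,
          ratio (coeffA α (circlePoint (τ / n) * rootChar k) ^ n)
            (coeffB α β γ (circlePoint (τ / n) * rootChar k) ^ n) +
        ∑ k : ZMod n, ratio (coeffA α (circlePoint (τ' / n) * rootChar k) ^ n)
            (coeffB α β γ (circlePoint (τ' / n) * rootChar k) ^ n))) *
      (x ^ (q.toNat * n) * tiltedSum α β γ (Finset.univ : Finset (Config (ZMod n))) y) := by
  set Z := tiltedSum α β γ (Finset.univ : Finset (Config (ZMod n))) with hZ
  set R : ℝ → ℝ := fun τ => ∑ k : ZMod n, ratio (coeffA α (circlePoint (τ / n) * rootChar k) ^ n)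
    (coeffB α β γ (circlePoint (τ / n) * rootChar k) ^ n) with hR
  have hRnn : ∀ τ, 0 ≤ R τ := fun τ => Finset.sum_nonneg fun k _ => ratio_nonneg _ _
  have hs : 0 < x + x⁻¹ := by positivity
  have hZy : 0 < Z y := tiltedSum_univ_pos hα hβ hγ hαβγ hy
  have key : ∀ τ ε η, (-1) ^ (n + 1) * circlePoint (τ / n) ^ n = ε → ‖η‖ = x →
      ‖signedSum α β γ (Finset.univ : Finset (Config (ZMod n))) ε η‖ * y ^ (q.toNat * n) ≤
      Real.exp ((x + x⁻¹) * R τ) * (x ^ (q.toNat * n) * Z y) := by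
    intro τ ε η hε hη
    have hη0 : 0 < ‖η‖ := hη ▸ hx
    rw [← hε, signedSum_univ]
    have h1 : ‖∏ k : ZMod n, (coeffA α (circlePoint (τ / n) * rootChar k) ^ n +
        coeffB α β γ (circlePoint (τ / n) * rootChar k) ^ n * η)‖ ≤
        x ^ (q.toNat * n) * (∏ k : ZMod n, max ‖coeffA α (circlePoint (τ / n) * rootChar k) ^ n‖
          ‖coeffB α β γ (circlePoint (τ / n) * rootChar k) ^ n‖) *
          Real.exp ((x + x⁻¹) * R τ) := by
      have hcard : x ^ (q.toNat * n) = ∏ _k : ZMod n, x ^ q.toNat := by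
        rw [Finset.prod_const, Finset.card_univ, ZMod.card, pow_mul]
      rw [hR, Finset.mul_sum, Real.exp_sum, hcard, norm_prod, ← Finset.prod_mul_distrib,
        ← Finset.prod_mul_distrib]
      refine Finset.prod_le_prod (fun k _ => norm_nonneg _) fun k _ => ?_
      have := norm_add_mul_le_of_dominated hη0 (hdom.pow τ k)
      rwa [hη] at this
    have h2 := pow_mul_prod_max_le (n := n) hα hβ hγ hαβγ hdom τ hy
    calc _ ≤ x ^ (q.toNat * n) * (∏ k : ZMod n, max ‖coeffA α (circlePoint (τ / n) * rootChar k) ^ n‖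
          ‖coeffB α β γ (circlePoint (τ / n) * rootChar k) ^ n‖) *
          Real.exp ((x + x⁻¹) * R τ) * y ^ (q.toNat * n) :=
          mul_le_mul_of_nonneg_right h1 (by positivity)
      _ = Real.exp ((x + x⁻¹) * R τ) * (x ^ (q.toNat * n) * (y ^ (q.toNat * n) *
          ∏ k : ZMod n, max ‖coeffA α (circlePoint (τ / n) * rootChar k) ^ n‖
          ‖coeffB α β γ (circlePoint (τ / n) * rootChar k) ^ n‖)) := by ring
      _ ≤ _ := mul_le_mul_of_nonneg_left (mul_le_mul_of_nonneg_left h2 (by positivity))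
          (Real.exp_pos _).le
  have hnx : ‖(x : ℂ)‖ = x := by rw [Complex.norm_real, Real.norm_eq_abs, abs_of_pos hx]
  have hnx' : ‖-(x : ℂ)‖ = x := by rw [norm_neg, hnx]
  have k1 := key τ 1 x hτ hnx
  have k2 := key τ 1 (-x) hτ hnx'
  have k3 := key τ' (-1) x hτ' hnx
  have k4 := key τ' (-1) (-x) hτ' hnx'
  have hZx : Z x ≤ 1 / 2 * (‖signedSum α β γ (Finset.univ : Finset (Config (ZMod n))) 1 x‖ +
      ‖signedSum α β γ (Finset.univ : Finset (Config (ZMod n))) 1 (-x)‖ +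
      ‖signedSum α β γ (Finset.univ : Finset (Config (ZMod n))) (-1) x‖ +
      ‖signedSum α β γ (Finset.univ : Finset (Config (ZMod n))) (-1) (-x)‖) := by
    have h1 : Z x = ‖(Z x : ℂ)‖ := by
      rw [Complex.norm_real, Real.norm_eq_abs,
        abs_of_nonneg (tiltedSum_nonneg hα hβ hγ hαβγ _ hx.le)]
    rw [h1, hZ, tiltedSum_eq_signedSum, norm_mul]
    have h2 : ‖(1 / 2 : ℂ)‖ = 1 / 2 := by norm_num
    rw [h2]
    refine mul_le_mul_of_nonneg_left ?_ (by norm_num)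
    refine (norm_sub_le _ _).trans (add_le_add ?_ le_rfl)
    exact (norm_add_le _ _).trans (add_le_add (norm_add_le _ _) le_rfl)
  have hpos : 0 < x ^ (q.toNat * n) * Z y := by positivity
  have e1 : Real.exp ((x + x⁻¹) * R τ) ≤ Real.exp ((x + x⁻¹) * (R τ + R τ')) :=
    Real.exp_le_exp.2 (by nlinarith [hRnn τ'])
  have e2 : Real.exp ((x + x⁻¹) * R τ') ≤ Real.exp ((x + x⁻¹) * (R τ + R τ')) :=
    Real.exp_le_exp.2 (by nlinarith [hRnn τ])
  rw [Real.exp_add, Real.exp_log two_pos]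
  have hy' : 0 < y ^ (q.toNat * n) := by positivity
  calc _ ≤ 1 / 2 * (‖signedSum α β γ (Finset.univ : Finset (Config (ZMod n))) 1 x‖ +
      ‖signedSum α β γ (Finset.univ : Finset (Config (ZMod n))) 1 (-x)‖ +
      ‖signedSum α β γ (Finset.univ : Finset (Config (ZMod n))) (-1) x‖ +
      ‖signedSum α β γ (Finset.univ : Finset (Config (ZMod n))) (-1) (-x)‖) *
        y ^ (q.toNat * n) := mul_le_mul_of_nonneg_right hZx hy'.le
    _ ≤ (Real.exp ((x + x⁻¹) * R τ) + Real.exp ((x + x⁻¹) * R τ')) *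
        (x ^ (q.toNat * n) * Z y) := by linarith
    _ ≤ _ := by nlinarith

end positive

/-- The mean of `g` with respect to the tilted torus measure. -/
noncomputable def tiltedMean (α β γ : ℝ) (s : ℝ) (g : Config (ZMod n) → ℝ) : ℝ :=
  (∑ σ, weight (freeFermionWeight α β γ) σ * s ^ verticalCount σ * g σ) /
    tiltedSum α β γ (Finset.univ : Finset (Config (ZMod n))) s

theorem tiltedMean_sum {ι : Type*} (α β γ : ℝ) (s : ℝ) (S : Finset ι)
    (g : ι → Config (ZMod n) → ℝ) :
    tiltedMean α β γ s (fun σ => ∑ i ∈ S, g i σ) = ∑ i ∈ S, tiltedMean α β γ s (g i) := by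
  simp only [tiltedMean, ← Finset.sum_div, Finset.mul_sum]
  rw [Finset.sum_comm]

section positive
variable {α β γ : ℝ} (hα : 0 < α) (hβ : 0 < β) (hγ : 0 < γ) (hαβγ : α * β < γ ^ 2)
include hα hβ hγ hαβγ

theorem tiltedMean_mono {s : ℝ} (hs : 0 < s) {g h : Config (ZMod n) → ℝ} (hgh : ∀ σ, g σ ≤ h σ) :
    tiltedMean α β γ s g ≤ tiltedMean α β γ s h := by
  refine div_le_div_of_nonneg_right (Finset.sum_le_sum fun σ _ => ?_)
    (tiltedSum_univ_pos hα hβ hγ hαβγ hs).le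
  have := weight_pos (freeFermionWeight_pos hα hβ hγ hαβγ) σ
  exact mul_le_mul_of_nonneg_left (hgh σ) (by positivity)

theorem tiltedMean_const {s : ℝ} (hs : 0 < s) (c : ℝ) :
    tiltedMean α β γ s (fun _ : Config (ZMod n) => c) = c := by
  rw [tiltedMean, ← Finset.sum_mul]
  exact mul_div_cancel_left₀ _ (tiltedSum_univ_pos hα hβ hγ hαβγ hs).ne'

theorem tiltedMean_nonneg {s : ℝ} (hs : 0 < s) {g : Config (ZMod n) → ℝ} (hg : ∀ σ, 0 ≤ g σ) :
    0 ≤ tiltedMean α β γ s g := by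
  have := tiltedMean_mono hα hβ hγ hαβγ hs hg
  rwa [tiltedMean_const hα hβ hγ hαβγ hs] at this

/-- Jensen's inequality for the exponential function. -/
theorem exp_tiltedMean_le {s : ℝ} (hs : 0 < s) (g : Config (ZMod n) → ℝ) :
    Real.exp (tiltedMean α β γ s g) ≤ tiltedMean α β γ s (fun σ => Real.exp (g σ)) := by
  set m := tiltedMean α β γ s g with hm
  have h1 : tiltedMean α β γ s (fun σ => Real.exp m * (g σ - m + 1)) ≤
      tiltedMean α β γ s (fun σ => Real.exp (g σ)) := by
    refine tiltedMean_mono hα hβ hγ hαβγ hs fun σ => ?_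
    calc _ ≤ Real.exp m * Real.exp (g σ - m) :=
          mul_le_mul_of_nonneg_left (Real.add_one_le_exp _) (Real.exp_pos _).le
      _ = _ := by rw [← Real.exp_add]; congr 1; ring
  refine le_trans (le_of_eq ?_) h1
  have hZ := (tiltedSum_univ_pos (n := n) hα hβ hγ hαβγ hs).ne'
  have h2 : ∑ σ : Config (ZMod n), weight (freeFermionWeight α β γ) σ * s ^ verticalCount σ * g σ =
      m * tiltedSum α β γ (Finset.univ : Finset (Config (ZMod n))) s := by
    rw [hm, tiltedMean, div_mul_cancel₀ _ hZ]
  have h3 : ∑ σ : Config (ZMod n), weight (freeFermionWeight α β γ) σ * s ^ verticalCount σ *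
      (Real.exp m * (g σ - m + 1)) =
        Real.exp m * (m * tiltedSum α β γ (Finset.univ : Finset (Config (ZMod n))) s +
        (1 - m) * tiltedSum α β γ (Finset.univ : Finset (Config (ZMod n))) s) := by
    rw [← h2, tiltedSum, Finset.mul_sum, ← Finset.sum_add_distrib, Finset.mul_sum]
    exact Finset.sum_congr rfl fun σ _ => by ring
  rw [tiltedMean, h3]
  field_simp
  ring

end positive
end torus

section limits
variable {α β γ : ℝ} (hα : 0 < α) (hβ : 0 < β) (hγ : 0 < γ) (hαβγ : α * β < γ ^ 2)
include hα hβ hγ hαβγ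

/-- Up to subexponential factors, tilting acts as if all vertical mid-edges had their frozen
value. -/
theorem exists_tiltedSum_compare {q : Bool} (hdom : Dominated q α β γ) {x y : ℝ} (hx : 0 < x)
    (hy : 0 < y) : ∃ ε : ℕ → ℝ, Tendsto ε atTop (𝓝 0) ∧ ∀ n : ℕ,
      tiltedSum α β γ (Finset.univ : Finset (Config (ZMod (n + 1)))) x *
        y ^ (q.toNat * (n + 1)) ≤ Real.exp ((n + 1 : ℕ) * ε n) * (x ^ (q.toNat * (n + 1)) *
          tiltedSum α β γ (Finset.univ : Finset (Config (ZMod (n + 1)))) y) := by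
  choose τ hτ hτε using fun n : ℕ =>
    exists_sign_twist (Or.inl rfl : (1 : ℂ) = 1 ∨ (1 : ℂ) = -1) (n + 1)
  choose τ' hτ' hτε' using fun n : ℕ =>
    exists_sign_twist (Or.inr rfl : (-1 : ℂ) = 1 ∨ (-1 : ℂ) = -1) (n + 1)
  have h1 := tendsto_average_ratio hα hβ hγ hαβγ hτ
  have h2 := tendsto_average_ratio hα hβ hγ hαβγ hτ'
  have h3 : Tendsto (fun n : ℕ => ((n + 1 : ℕ) : ℝ)⁻¹ * Real.log 2) atTop (𝓝 0) := by
    have := (tendsto_inv_atTop_zero.comp (tendsto_natCast_atTop_atTop (R := ℝ))).comp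
      (tendsto_add_atTop_nat 1)
    simpa using this.mul_const (Real.log 2)
  have h4 := h3.add ((h1.add h2).const_mul (x + x⁻¹))
  simp only [add_zero, mul_zero] at h4
  refine ⟨_, h4, fun n => ?_⟩
  refine (tiltedSum_compare hα hβ hγ hαβγ hdom hx hy (hτε n) (hτε' n)).trans (le_of_eq ?_)
  have hn : ((n + 1 : ℕ) : ℝ) ≠ 0 := by positivity
  congr 2
  field_simp

/-- The exponential moments of the number of vertical mid-edges of a row that do not have their
frozen value are subexponential. -/
theorem exists_exp_moment {q : Bool} (hdom : Dominated q α β γ) {s : ℝ} (hs : 0 < s) :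
    ∃ ε : ℕ → ℝ, Tendsto ε atTop (𝓝 0) ∧ ∀ n : ℕ,
      ∑ σ : Config (ZMod (n + 1)), weight (freeFermionWeight α β γ) σ * s ^ verticalCount σ *
        Real.exp (defect q (verticalCount σ) (n + 1 : ℕ)) ≤
      Real.exp ((n + 1 : ℕ) * ε n) *
        tiltedSum α β γ (Finset.univ : Finset (Config (ZMod (n + 1)))) s := by
  cases q
  · obtain ⟨ε, hε, h⟩ := exists_tiltedSum_compare hα hβ hγ hαβγ hdom
      (mul_pos hs (Real.exp_pos 1)) hs
    refine ⟨ε, hε, fun n => ?_⟩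
    have h1 := h n
    simp only [Bool.toNat_false, zero_mul, pow_zero, mul_one, one_mul] at h1
    refine le_trans (le_of_eq ?_) h1
    rw [tiltedSum]
    refine Finset.sum_congr rfl fun σ _ => ?_
    rw [mul_pow, ← Real.exp_nat_mul, mul_one, defect, if_neg Bool.false_ne_true, mul_assoc]
  · obtain ⟨ε, hε, h⟩ := exists_tiltedSum_compare hα hβ hγ hαβγ hdom
      (mul_pos hs (Real.exp_pos (-1))) hs
    refine ⟨ε, hε, fun n => ?_⟩
    have h1 := h n
    simp only [Bool.toNat_true, one_mul] at h1
    have hp : 0 < s ^ (n + 1) := by positivity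
    refine le_of_mul_le_mul_right ?_ (mul_pos hp (Real.exp_pos (-(n + 1 : ℕ))))
    calc _ = tiltedSum α β γ (Finset.univ : Finset (Config (ZMod (n + 1)))) (s * Real.exp (-1)) *
          s ^ (n + 1) := by
          rw [tiltedSum, Finset.sum_mul, Finset.sum_mul]
          refine Finset.sum_congr rfl fun σ _ => ?_
          have e1 : Real.exp (defect true (verticalCount σ) (n + 1 : ℕ)) *
              Real.exp (-(n + 1 : ℕ)) = Real.exp (-1) ^ verticalCount σ := by
            rw [← Real.exp_add, ← Real.exp_nat_mul, defect, if_pos rfl]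
            congr 1; ring
          rw [mul_pow, ← e1]
          ring
      _ ≤ _ := h1
      _ = _ := by
          rw [mul_pow, ← Real.exp_nat_mul]
          have : ((n + 1 : ℕ) : ℝ) * -1 = -((n + 1 : ℕ) : ℝ) := by ring
          rw [this]
          ring

/-- A family of nonnegative observables with subexponential exponential moments has means of
smaller order than the size of the torus. -/
theorem tendsto_tiltedMean_div {s : ℝ} (hs : 0 < s) {ε : ℕ → ℝ} (hε : Tendsto ε atTop (𝓝 0))
    (g : (n : ℕ) → Config (ZMod (n + 1)) → ℝ) (hg : ∀ n σ, 0 ≤ g n σ)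
    (h : ∀ n : ℕ, ∑ σ : Config (ZMod (n + 1)), weight (freeFermionWeight α β γ) σ *
        s ^ verticalCount σ * Real.exp (g n σ) ≤ Real.exp ((n + 1 : ℕ) * ε n) *
        tiltedSum α β γ (Finset.univ : Finset (Config (ZMod (n + 1)))) s) :
    Tendsto (fun n : ℕ => tiltedMean α β γ s (g n) / (n + 1 : ℕ)) atTop (𝓝 0) := by
  refine squeeze_zero (fun n => div_nonneg (tiltedMean_nonneg hα hβ hγ hαβγ hs (hg n))
    (Nat.cast_nonneg _)) (fun n => ?_) hε
  have hn : (0 : ℝ) < (n + 1 : ℕ) := by positivity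
  rw [div_le_iff₀ hn, mul_comm]
  refine Real.exp_le_exp.1 ((exp_tiltedMean_le hα hβ hγ hαβγ hs (g n)).trans ?_)
  rw [tiltedMean, div_le_iff₀ (tiltedSum_univ_pos hα hβ hγ hαβγ hs)]
  exact h n

end limits

/-! ### Symmetries of the torus -/

section symmetries
variable {R : Type} [CommRing R]

/-- Translation of a configuration. -/
def shiftConfig (u : R × R) (σ : Config R) : Config R :=
  ⟨fun e => σ.1 (e.1, e.2 + u), fun v => by
    have h := σ.2 (v + u)
    simpa [inDegree, outDegree, west, south, east, north, sub_add_eq_add_sub, Prod.add_def] using h⟩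

/-- Translation as a permutation of the configurations. -/
def shiftEquiv (u : R × R) : Config R ≃ Config R where
  toFun := shiftConfig u
  invFun := shiftConfig (-u)
  left_inv σ := by ext e; simp [shiftConfig]
  right_inv σ := by ext e; simp [shiftConfig]

theorem vertexType_shiftConfig (u : R × R) (σ : Config R) (v : R × R) :
    vertexType (shiftConfig u σ) v = vertexType σ (v + u) := by
  rw [vertexType_eq_iff]
  have h := (vertexType_eq_iff σ (v + u) _).1 rfl
  simpa [HasType, shiftConfig, west, south, east, north, sub_add_eq_add_sub, Prod.add_def] using h

/-- Exchange of the two colours. -/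
def Colour.swap : Colour → Colour
  | .black => .white
  | .white => .black

/-- The reflection exchanging the two coordinate axes, acting on configurations. -/
def transposeConfig (σ : Config R) : Config R :=
  ⟨fun e => σ.1 (e.1.swap, e.2.swap), fun v => by
    have h := σ.2 v.swap
    simp only [inDegree, outDegree, west, south, east, north, Colour.swap, Prod.swap] at h ⊢
    omega⟩

/-- Reflection as a permutation of the configurations. -/
def transposeEquiv : Config R ≃ Config R where
  toFun := transposeConfig
  invFun := transposeConfig
  left_inv σ := by
    ext ⟨c, v⟩
    cases c <;> simp [transposeConfig, Colour.swap]
  right_inv σ := by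
    ext ⟨c, v⟩
    cases c <;> simp [transposeConfig, Colour.swap]

/-- The effect of the reflection on vertex types. -/
def VertexType.transpose : VertexType → VertexType
  | .b₁ => .b₂
  | .b₂ => .b₁
  | .c₁ => .c₂
  | .c₂ => .c₁
  | t => t

theorem vertexType_transposeConfig (σ : Config R) (v : R × R) :
    vertexType (transposeConfig σ) v = (vertexType σ v.swap).transpose := by
  rw [vertexType_eq_iff]
  have h := (vertexType_eq_iff σ v.swap _).1 rfl
  generalize vertexType σ v.swap = t at h ⊢
  cases t <;>
    simpa [HasType, transposeConfig, west, south, east, north, Colour.swap, VertexType.transpose,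
      and_comm, and_left_comm, and_assoc] using h

end symmetries

section torus
variable {n : ℕ} [NeZero n]

theorem mem_typeEvent {k : ℕ} (v : Fin k → ZMod n × ZMod n) (t : Fin k → VertexType)
    (σ : Config (ZMod n)) : σ ∈ typeEvent v t ↔ ∀ i, vertexType σ (v i) = t i := by
  classical
  simp [typeEvent]

theorem weight_shiftConfig (a : VertexType → ℝ) (u : ZMod n × ZMod n) (σ : Config (ZMod n)) :
    weight a (shiftConfig u σ) = weight a σ := by
  simp only [weight, vertexType_shiftConfig]
  exact Equiv.prod_comp (Equiv.addRight u) fun v => a (vertexType σ v)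

theorem verticalCount_shiftConfig (u : ZMod n × ZMod n) (σ : Config (ZMod n)) :
    verticalCount (shiftConfig u σ) = verticalCount σ := by
  rw [← sum_occ_row σ (-1 + u.2), verticalCount]
  exact Equiv.sum_comp (Equiv.addRight u.1) fun x => occ σ (.white, (x, -1 + u.2))

theorem weight_transposeConfig (α β γ : ℝ) (σ : Config (ZMod n)) :
    weight (freeFermionWeight β α γ) (transposeConfig σ) = weight (freeFermionWeight α β γ) σ := by
  simp only [weight, vertexType_transposeConfig]
  have h : ∀ t : VertexType, freeFermionWeight β α γ t.transpose = freeFermionWeight α β γ t := by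
    intro t
    cases t <;> simp [freeFermionWeight, VertexType.transpose, mul_comm]
  simp only [h]
  exact Equiv.prod_comp (Equiv.prodComm (ZMod n) (ZMod n))
    fun v => freeFermionWeight α β γ (vertexType σ v)

theorem verticalCount_transposeConfig (σ : Config (ZMod n)) :
    verticalCount (transposeConfig σ) = horizontalCount σ := rfl

theorem tiltedMean_occ_shift (α β γ s : ℝ) (q : Bool) (c : Colour) (v u : ZMod n × ZMod n) :
    tiltedMean α β γ s (fun σ => defect q (occ σ (c, v + u)) 1) =
      tiltedMean α β γ s (fun σ => defect q (occ σ (c, v)) 1) := by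
  rw [tiltedMean, tiltedMean]
  congr 1
  rw [← Equiv.sum_comp (shiftEquiv u) fun σ => weight (freeFermionWeight α β γ) σ *
    s ^ verticalCount σ * defect q (occ σ (c, v)) 1]
  refine Finset.sum_congr rfl fun σ _ => ?_
  change _ = weight _ (shiftConfig u σ) * s ^ verticalCount (shiftConfig u σ) * _
  rw [weight_shiftConfig, verticalCount_shiftConfig]
  rfl

theorem sum_defect {ι : Type*} (S : Finset ι) (q : Bool) (f : ι → ℝ) :
    ∑ i ∈ S, defect q (f i) 1 = defect q (∑ i ∈ S, f i) S.card := by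
  cases q <;> simp [defect]

/-- By translation invariance, the mean defect of one vertical mid-edge is the mean defect of a row
divided by its length. -/
theorem tiltedMean_white (α β γ s : ℝ) (q : Bool) (v : ZMod n × ZMod n) :
    tiltedMean α β γ s (fun σ => defect q (occ σ (.white, v)) 1) =
      tiltedMean α β γ s (fun σ : Config (ZMod n) => defect q (verticalCount σ) n) / n := by
  have hn : (n : ℝ) ≠ 0 := by exact_mod_cast NeZero.ne n
  rw [eq_div_iff hn]
  have h1 : (fun σ : Config (ZMod n) => defect q (verticalCount σ : ℝ) n) =
      fun σ => ∑ x : ZMod n, defect q (occ σ (.white, (x, v.2))) 1 := by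
    funext σ
    rw [sum_defect, Finset.card_univ, ZMod.card, ← sum_occ_row σ v.2]
    push_cast; rfl
  rw [h1, tiltedMean_sum]
  have h2 : ∀ x : ZMod n, tiltedMean α β γ s (fun σ => defect q (occ σ (.white, (x, v.2))) 1) =
      tiltedMean α β γ s (fun σ => defect q (occ σ (.white, v)) 1) := by
    intro x
    rw [← tiltedMean_occ_shift α β γ s q .white v (x - v.1, 0)]
    simp [Prod.add_def]
  rw [Finset.sum_congr rfl fun x _ => h2 x, Finset.sum_const, Finset.card_univ, ZMod.card,
    nsmul_eq_mul, mul_comm]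

/-- By translation invariance, the mean defect of one horizontal mid-edge is the mean defect of a
column divided by its length. -/
theorem tiltedMean_black (α β γ s : ℝ) (q : Bool) (v : ZMod n × ZMod n) :
    tiltedMean α β γ s (fun σ => defect q (occ σ (.black, v)) 1) =
      tiltedMean α β γ s (fun σ : Config (ZMod n) => defect q (horizontalCount σ) n) / n := by
  have hn : (n : ℝ) ≠ 0 := by exact_mod_cast NeZero.ne n
  rw [eq_div_iff hn]
  have h1 : (fun σ : Config (ZMod n) => defect q (horizontalCount σ : ℝ) n) =
      fun σ => ∑ y : ZMod n, defect q (occ σ (.black, (v.1, y))) 1 := by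
    funext σ
    rw [sum_defect, Finset.card_univ, ZMod.card, ← sum_occ_column σ v.1]
    push_cast; rfl
  rw [h1, tiltedMean_sum]
  have h2 : ∀ y : ZMod n, tiltedMean α β γ s (fun σ => defect q (occ σ (.black, (v.1, y))) 1) =
      tiltedMean α β γ s (fun σ => defect q (occ σ (.black, v)) 1) := by
    intro y
    rw [← tiltedMean_occ_shift α β γ s q .black v (0, y - v.2)]
    simp [Prod.add_def]
  rw [Finset.sum_congr rfl fun x _ => h2 x, Finset.sum_const, Finset.card_univ, ZMod.card,
    nsmul_eq_mul, mul_comm]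

theorem occ_le_one (σ : Config (ZMod n)) (e : MidEdge (ZMod n)) : occ σ e ≤ 1 := Bool.toNat_le _

theorem verticalCount_le (σ : Config (ZMod n)) : verticalCount σ ≤ n := by
  refine (Finset.sum_le_card_nsmul _ _ 1 fun x _ => occ_le_one σ _).trans (le_of_eq ?_)
  simp

theorem horizontalCount_le (σ : Config (ZMod n)) : horizontalCount σ ≤ n := by
  refine (Finset.sum_le_card_nsmul _ _ 1 fun x _ => occ_le_one σ _).trans (le_of_eq ?_)
  simp

theorem defect_nonneg {q : Bool} {a m : ℝ} (h0 : 0 ≤ a) (h1 : a ≤ m) : 0 ≤ defect q a m := by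
  cases q <;> simp [defect, h0, h1]

end torus

/-! ### Frozen phases -/

section limits
variable {α β γ : ℝ} (hα : 0 < α) (hβ : 0 < β) (hγ : 0 < γ) (hαβγ : α * β < γ ^ 2)
include hα hβ hγ hαβγ

/-- Under every tilt the density of vertical mid-edges without their frozen value tends to zero. -/
theorem tendsto_vertical_defect {q : Bool} (hdom : Dominated q α β γ) {s : ℝ} (hs : 0 < s) :
    Tendsto (fun n : ℕ => tiltedMean α β γ s
      (fun σ : Config (ZMod (n + 1)) => defect q (verticalCount σ) (n + 1 : ℕ)) / (n + 1 : ℕ))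
      atTop (𝓝 0) := by
  obtain ⟨ε, hε, h⟩ := exists_exp_moment hα hβ hγ hαβγ hdom hs
  exact tendsto_tiltedMean_div hα hβ hγ hαβγ hs hε
    (fun n σ => defect q (verticalCount σ) (n + 1 : ℕ))
    (fun n σ => defect_nonneg (Nat.cast_nonneg _) (by exact_mod_cast verticalCount_le σ)) h

/-- Under a tilt in the direction of the frozen phase, probabilities grow at most
subexponentially; hence the horizontal mid-edges remain frozen under such a tilt. -/
theorem tendsto_horizontal_defect {q p : Bool} (hdom : Dominated q α β γ)
    (hdom' : Dominated p β α γ) {s : ℝ} (hs : 0 < s) (hsq : if q then 1 ≤ s else s ≤ 1) :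
    Tendsto (fun n : ℕ => tiltedMean α β γ s
      (fun σ : Config (ZMod (n + 1)) => defect p (horizontalCount σ) (n + 1 : ℕ)) / (n + 1 : ℕ))
      atTop (𝓝 0) := by
  obtain ⟨ε, hε, h⟩ := exists_exp_moment hβ hα hγ (by rwa [mul_comm]) hdom' one_pos
  obtain ⟨ε', hε', h'⟩ := exists_tiltedSum_compare hα hβ hγ hαβγ hdom one_pos hs
  have hεε : Tendsto (fun n => ε n + ε' n) atTop (𝓝 0) := by simpa using hε.add hε'
  refine tendsto_tiltedMean_div hα hβ hγ hαβγ hs hεε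
    (fun n σ => defect p (horizontalCount σ) (n + 1 : ℕ))
    (fun n σ => defect_nonneg (Nat.cast_nonneg _) (by exact_mod_cast horizontalCount_le σ))
    fun n => ?_
  have h1 := h n
  have h2 := h' n
  simp only [one_pow, mul_one, one_mul] at h1 h2
  rw [← transposeEquiv.sum_comp] at h1
  have hT : tiltedSum β α γ (Finset.univ : Finset (Config (ZMod (n + 1)))) 1 =
      tiltedSum α β γ (Finset.univ : Finset (Config (ZMod (n + 1)))) 1 := by
    simp only [tiltedSum, one_pow, mul_one]
    rw [← transposeEquiv.sum_comp]
    exact Finset.sum_congr rfl fun σ _ => weight_transposeConfig α β γ σ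
  rw [hT] at h1
  have h3 : ∑ σ : Config (ZMod (n + 1)), weight (freeFermionWeight α β γ) σ *
      Real.exp (defect p (horizontalCount σ) (n + 1 : ℕ)) ≤ Real.exp ((n + 1 : ℕ) * ε n) *
        tiltedSum α β γ (Finset.univ : Finset (Config (ZMod (n + 1)))) 1 := by
    refine le_trans (le_of_eq (Finset.sum_congr rfl fun σ _ => ?_)) h1
    change _ = weight _ (transposeConfig σ) *
      Real.exp (defect p (verticalCount (transposeConfig σ)) _)
    rw [weight_transposeConfig, verticalCount_transposeConfig]
  have hpow : ∀ σ : Config (ZMod (n + 1)), s ^ verticalCount σ ≤ s ^ (q.toNat * (n + 1)) := by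
    intro σ
    cases q
    · simp only [Bool.false_eq_true, if_false] at hsq
      simpa using pow_le_one₀ hs.le hsq
    · simp only [if_true] at hsq
      rw [Bool.toNat_true, one_mul]
      exact pow_le_pow_right₀ hsq (verticalCount_le σ)
  calc _ ≤ s ^ (q.toNat * (n + 1)) * ∑ σ : Config (ZMod (n + 1)),
        weight (freeFermionWeight α β γ) σ *
          Real.exp (defect p (horizontalCount σ) (n + 1 : ℕ)) := by
        rw [Finset.mul_sum]
        refine Finset.sum_le_sum fun σ _ => ?_
        have hw := weight_pos (freeFermionWeight_pos hα hβ hγ hαβγ) σ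
        have := mul_le_mul_of_nonneg_left (hpow σ)
          (mul_pos hw (Real.exp_pos (defect p (horizontalCount σ) (n + 1 : ℕ)))).le
        linarith
    _ ≤ s ^ (q.toNat * (n + 1)) * (Real.exp ((n + 1 : ℕ) * ε n) *
        tiltedSum α β γ (Finset.univ : Finset (Config (ZMod (n + 1)))) 1) :=
        mul_le_mul_of_nonneg_left h3 (by positivity)
    _ = Real.exp ((n + 1 : ℕ) * ε n) *
        (tiltedSum α β γ (Finset.univ : Finset (Config (ZMod (n + 1)))) 1 *
          s ^ (q.toNat * (n + 1))) := by ring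
    _ ≤ Real.exp ((n + 1 : ℕ) * ε n) * (Real.exp ((n + 1 : ℕ) * ε' n) *
        tiltedSum α β γ (Finset.univ : Finset (Config (ZMod (n + 1)))) s) :=
        mul_le_mul_of_nonneg_left h2 (Real.exp_pos _).le
    _ = _ := by rw [mul_add, Real.exp_add]; ring

end limits

/-- The pattern of arrows around a vertex in a frozen phase is that of type `t`, where `p` and `q`
say whether the horizontal, respectively vertical, mid-edges are occupied. -/
def FrozenType (p q : Bool) (t : VertexType) : Prop :=
  (!p, !q, !p, !q) = arrows t

/-- The number of mid-edges around `v` that do not have their frozen value. -/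
noncomputable def localDefect {n : ℕ} [NeZero n] (p q : Bool) (σ : Config (ZMod n))
    (v : ZMod n × ZMod n) : ℝ :=
  defect p (occ σ (west v)) 1 + defect q (occ σ (south v)) 1 + defect p (occ σ (east v)) 1 +
    defect q (occ σ (north v)) 1

theorem defect_occ {n : ℕ} [NeZero n] (q : Bool) (σ : Config (ZMod n)) (e : MidEdge (ZMod n)) :
    defect q (occ σ e) 1 = if σ.1 e = !q then 0 else 1 := by
  unfold defect occ
  cases q <;> cases σ.1 e <;> simp

theorem localDefect_nonneg {n : ℕ} [NeZero n] (p q : Bool) (σ : Config (ZMod n))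
    (v : ZMod n × ZMod n) : 0 ≤ localDefect p q σ v := by
  simp only [localDefect, defect_occ]
  positivity

/-- If the type of a vertex disagrees with the frozen prediction, an adjacent mid-edge is
defective. -/
theorem one_le_localDefect {n : ℕ} [NeZero n] (p q : Bool) (σ : Config (ZMod n))
    (v : ZMod n × ZMod n) (t : VertexType) (h : ¬ (vertexType σ v = t ↔ FrozenType p q t)) :
    1 ≤ localDefect p q σ v := by
  by_contra hlt
  refine h ?_
  rw [vertexType_eq_iff, hasType_iff, FrozenType]
  simp only [localDefect, defect_occ] at hlt
  split_ifs at hlt with h1 h2 h3 h4 <;> norm_num at hlt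
  rw [h1, h2, h3, h4]

section limits
variable {α β γ : ℝ} (hα : 0 < α) (hβ : 0 < β) (hγ : 0 < γ) (hαβγ : α * β < γ ^ 2)
include hα hβ hγ hαβγ

open Classical in
/-- In a frozen phase every cylinder event becomes deterministic. -/
theorem tendsto_tiltedSum_of_dominated {q p : Bool} (hdom : Dominated q α β γ)
    (hdom' : Dominated p β α γ) {s : ℝ} (hs : 0 < s) (hsq : if q then 1 ≤ s else s ≤ 1)
    {k : ℕ} (v : Fin k → ℤ × ℤ) (t : Fin k → VertexType) :
    Tendsto (fun n : ℕ => tiltedSum α β γ (torusEvent n v t) s /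
      tiltedSum α β γ (Finset.univ : Finset (Config (ZMod (n + 1)))) s) atTop
      (𝓝 (if ∀ i, FrozenType p q (t i) then 1 else 0)) := by
  set χ : ℝ := if ∀ i, FrozenType p q (t i) then 1 else 0 with hχ
  have hH := tendsto_horizontal_defect hα hβ hγ hαβγ hdom hdom' hs hsq
  have hV := tendsto_vertical_defect hα hβ hγ hαβγ hdom hs
  have hlim := ((hH.add hV).const_mul 2).const_mul (k : ℝ)
  simp only [add_zero, mul_zero] at hlim
  rw [tendsto_iff_norm_sub_tendsto_zero]
  refine squeeze_zero (fun _ => norm_nonneg _) (fun n => ?_) hlim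
  -- the indicator `I` of the event differs from its frozen value `χ` only if some defect is present
  set D : Config (ZMod (n + 1)) → ℝ := fun σ =>
    ∑ i, localDefect p q σ (castVertex (n + 1) (v i)) with hD
  set I : Config (ZMod (n + 1)) → ℝ := fun σ => if σ ∈ torusEvent n v t then 1 else 0 with hI
  have hDmean : tiltedMean α β γ s D = k * (2 * (tiltedMean α β γ s
      (fun σ : Config (ZMod (n + 1)) => defect p (horizontalCount σ) (n + 1 : ℕ)) / (n + 1 : ℕ) +
      tiltedMean α β γ s (fun σ : Config (ZMod (n + 1)) =>
        defect q (verticalCount σ) (n + 1 : ℕ)) / (n + 1 : ℕ))) := by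
    have hone : ∀ w : ZMod (n + 1) × ZMod (n + 1),
        tiltedMean α β γ s (fun σ => localDefect p q σ w) = 2 * (tiltedMean α β γ s
      (fun σ : Config (ZMod (n + 1)) => defect p (horizontalCount σ) (n + 1 : ℕ)) / (n + 1 : ℕ) +
      tiltedMean α β γ s (fun σ : Config (ZMod (n + 1)) =>
        defect q (verticalCount σ) (n + 1 : ℕ)) / (n + 1 : ℕ)) := by
      intro w
      have hadd : ∀ g h : Config (ZMod (n + 1)) → ℝ, tiltedMean α β γ s (fun σ => g σ + h σ) =
          tiltedMean α β γ s g + tiltedMean α β γ s h := by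
        intro g h
        simp only [tiltedMean, mul_add, Finset.sum_add_distrib, add_div]
      simp only [localDefect]
      rw [hadd, hadd, hadd]
      simp only [west, south, east, north]
      rw [tiltedMean_black, tiltedMean_black, tiltedMean_white, tiltedMean_white]
      ring
    rw [hD, tiltedMean_sum, Finset.sum_congr rfl fun i _ => hone _, Finset.sum_const,
      Finset.card_univ, Fintype.card_fin, nsmul_eq_mul]
  have hImean : tiltedSum α β γ (torusEvent n v t) s /
      tiltedSum α β γ (Finset.univ : Finset (Config (ZMod (n + 1)))) s = tiltedMean α β γ s I := by
    rw [tiltedMean, tiltedSum]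
    congr 1
    simp only [hI, mul_ite, mul_one, mul_zero]
    rw [Finset.sum_ite_mem, Finset.univ_inter]
  have hpoint : ∀ σ, |I σ - χ| ≤ D σ := by
    intro σ
    have hD0 : ∀ i, 0 ≤ localDefect p q σ (castVertex (n + 1) (v i)) :=
      fun i => localDefect_nonneg _ _ _ _
    by_cases hall : ∀ i, vertexType σ (castVertex (n + 1) (v i)) = t i ↔ FrozenType p q (t i)
    · have hmem : σ ∈ torusEvent n v t ↔ ∀ i, FrozenType p q (t i) := by
        exact (mem_typeEvent _ _ _).trans (forall_congr' hall)
      simp only [hI, hχ, hmem, sub_self, abs_zero]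
      exact Finset.sum_nonneg fun i _ => hD0 i
    · obtain ⟨i, hi⟩ := not_forall.1 hall
      have h1 := one_le_localDefect p q σ _ (t i) hi
      have h2 : localDefect p q σ (castVertex (n + 1) (v i)) ≤ D σ :=
        Finset.single_le_sum (f := fun i => localDefect p q σ (castVertex (n + 1) (v i)))
          (fun i _ => hD0 i) (Finset.mem_univ i)
      refine le_trans ?_ (h1.trans h2)
      simp only [hI, hχ]
      split_ifs <;> norm_num
  rw [hImean, ← hDmean, Real.norm_eq_abs, abs_le]
  have hsub : tiltedMean α β γ s (fun σ => I σ - χ) = tiltedMean α β γ s I - χ := by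
    have hconst := tiltedMean_const (n := n + 1) hα hβ hγ hαβγ hs χ
    rw [tiltedMean] at hconst
    simp only [tiltedMean, mul_sub, Finset.sum_sub_distrib, sub_div]
    rw [hconst]
  have hneg : tiltedMean α β γ s (fun σ => -D σ) = -tiltedMean α β γ s D := by
    simp only [tiltedMean, mul_neg, Finset.sum_neg_distrib, neg_div]
  rw [← hsub, ← hneg]
  exact ⟨tiltedMean_mono hα hβ hγ hαβγ hs fun σ => (abs_le.1 (hpoint σ)).1,
    tiltedMean_mono hα hβ hγ hαβγ hs fun σ => (abs_le.1 (hpoint σ)).2⟩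

/-- Under a tilt in the direction of the frozen phase there are no resonances. -/
theorem tendsto_tiltedSum_of_dominated_of_tilt {q : Bool} (hdom : Dominated q α β γ)
    {k : ℕ} {v : Fin k → ℤ × ℤ} (hv : Function.Injective v) (t : Fin k → VertexType) {s : ℝ}
    (hs : s = if q then 2 else 1 / 2) :
    Tendsto (fun n : ℕ => ((tiltedSum α β γ (torusEvent n v t) s /
      tiltedSum α β γ (Finset.univ : Finset (Config (ZMod (n + 1)))) s : ℝ) : ℂ)) atTop
      (𝓝 (limitValue α β γ v t)) := by
  have hs0 : 0 < s := by rw [hs]; split_ifs <;> norm_num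
  refine tendsto_tiltedSum_of_deviation hα hβ hγ hαβγ v t hs0 fun ε hε η hη => ?_
  have hηs : ‖η‖ = s := by
    rcases hη with rfl | rfl <;> simp [abs_of_pos hs0]
  choose τ hτ hτε using fun n : ℕ => exists_sign_twist hε (n + 1)
  have hgood : ∀ n, ∀ k : ZMod (n + 1), 1 / 2 *
      max ‖coeffA α (circlePoint (τ n / (n + 1 : ℕ)) * rootChar k)‖
        ‖coeffB α β γ (circlePoint (τ n / (n + 1 : ℕ)) * rootChar k)‖ ^ (n + 1) ≤
      ‖coeffA α (circlePoint (τ n / (n + 1 : ℕ)) * rootChar k) ^ (n + 1) +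
        coeffB α β γ (circlePoint (τ n / (n + 1 : ℕ)) * rootChar k) ^ (n + 1) * η‖ := by
    intro n k
    have h := hdom.pow (n := n + 1) (τ n) k
    have h0 := hdom (((k.val : ℕ) + τ n) / (n + 1 : ℕ))
    rw [← twisted_rootChar, ZMod.natCast_zmod_val] at h0
    set a := coeffA α (circlePoint (τ n / (n + 1 : ℕ)) * rootChar k)
    set b := coeffB α β γ (circlePoint (τ n / (n + 1 : ℕ)) * rootChar k)
    have e1 : ‖a ^ (n + 1)‖ - ‖b ^ (n + 1)‖ * s ≤ ‖a ^ (n + 1) + b ^ (n + 1) * η‖ := by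
      have := norm_sub_norm_le (a ^ (n + 1)) (-(b ^ (n + 1) * η))
      rwa [norm_neg, norm_mul, hηs, sub_neg_eq_add] at this
    have e2 : ‖b ^ (n + 1)‖ * s - ‖a ^ (n + 1)‖ ≤ ‖a ^ (n + 1) + b ^ (n + 1) * η‖ := by
      have := norm_sub_norm_le (b ^ (n + 1) * η) (-(a ^ (n + 1)))
      rwa [norm_neg, norm_mul, hηs, sub_neg_eq_add, add_comm (_ * η)] at this
    cases q
    · simp only [Bool.false_eq_true, if_false] at h h0 hs
      rw [max_eq_left h0, ← norm_pow]
      rw [hs] at e1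
      linarith
    · simp only [if_true] at h h0 hs
      rw [max_eq_right h0, ← norm_pow]
      rw [hs] at e2
      have := norm_nonneg (b ^ (n + 1))
      linarith
  obtain ⟨d, hd, hdev⟩ := exists_deviation_eq hα hβ hγ hαβγ hv t hτ hτε
    (by norm_num : (0 : ℝ) < 1 / 2) hs0 (η := fun _ => η) (fun _ => hηs.ge) (fun _ => hηs.le) hgood
  refine squeeze_zero' (Eventually.of_forall fun n => div_nonneg (norm_nonneg _)
    (tiltedSum_nonneg hα hβ hγ hαβγ _ hs0.le)) ?_ (by simpa using hd.norm)
  filter_upwards [hdev] with n hn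
  rw [div_le_iff₀ (tiltedSum_univ_pos hα hβ hγ hαβγ hs0), hn, norm_mul]
  refine mul_le_mul_of_nonneg_left ?_ (norm_nonneg _)
  have := norm_signedSum_le (n := n + 1) hα hβ hγ hαβγ Finset.univ (ε := ε)
    (by rcases hε with rfl | rfl <;> simp) η
  rwa [hηs] at this

/-- The tilted and the untilted probabilities have the same frozen limit, and the tilted ones
converge to the predicted value. -/
theorem tendsto_tiltedSum_of_not_rough
    (h : 2 * (α + β * (γ ^ 2 - α * β)) ≤ |1 + α ^ 2 - β ^ 2 - (γ ^ 2 - α * β) ^ 2|)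
    {k : ℕ} {v : Fin k → ℤ × ℤ} (hv : Function.Injective v) (t : Fin k → VertexType) :
    Tendsto (fun n : ℕ => ((tiltedSum α β γ (torusEvent n v t) 1 /
      tiltedSum α β γ (Finset.univ : Finset (Config (ZMod (n + 1)))) 1 : ℝ) : ℂ)) atTop
      (𝓝 (limitValue α β γ v t)) := by
  obtain ⟨q, hdom⟩ := exists_dominated hα hβ hαβγ h
  obtain ⟨p, hdom'⟩ := exists_dominated hβ hα (by rwa [mul_comm])
    (not_rough_transpose hα hβ hαβγ h)
  set s : ℝ := if q then 2 else 1 / 2 with hs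
  have hs0 : 0 < s := by rw [hs]; split_ifs <;> norm_num
  have hsq : if q then 1 ≤ s else s ≤ 1 := by
    rw [hs]; cases q <;> norm_num
  have h1 := tendsto_tiltedSum_of_dominated hα hβ hγ hαβγ hdom hdom' one_pos
    (by cases q <;> simp) v t
  have h2 := tendsto_tiltedSum_of_dominated hα hβ hγ hαβγ hdom hdom' hs0 hsq v t
  have h3 := tendsto_tiltedSum_of_dominated_of_tilt hα hβ hγ hαβγ hdom hv t hs
  have h4 := tendsto_nhds_unique h3 ((Complex.continuous_ofReal.tendsto _).comp h2)
  rw [h4]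
  exact (Complex.continuous_ofReal.tendsto _).comp h1

/-- Probabilities of cylinder events converge as the size of the torus tends to infinity. -/
theorem tendsto_tiltedSum {k : ℕ} {v : Fin k → ℤ × ℤ} (hv : Function.Injective v)
    (t : Fin k → VertexType) :
    Tendsto (fun n : ℕ => ((tiltedSum α β γ (torusEvent n v t) 1 /
      tiltedSum α β γ (Finset.univ : Finset (Config (ZMod (n + 1)))) 1 : ℝ) : ℂ)) atTop
      (𝓝 (limitValue α β γ v t)) := by
  rcases lt_or_ge |1 + α ^ 2 - β ^ 2 - (γ ^ 2 - α * β) ^ 2| (2 * (α + β * (γ ^ 2 - α * β)))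
    with h | h
  · exact tendsto_tiltedSum_of_rough hα hβ hγ hαβγ h hv t
  · exact tendsto_tiltedSum_of_not_rough hα hβ hγ hαβγ h hv t

end limits

/-! ### Cylinder events and weak convergence -/

instance : CompactSpace (Config ℤ) := by
  refine isCompact_iff_compactSpace.1 (IsClosed.isCompact ?_)
  have h : {o : MidEdge ℤ → Bool | ∀ v : ℤ × ℤ, inDegree o v = 2 ∧ outDegree o v = 2} =
      ⋂ v, ({o | inDegree o v = 2} ∩ {o | outDegree o v = 2}) := by
    ext o; simp
  have hb : Continuous Bool.toNat := continuous_of_discreteTopology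
  have hn : Continuous fun b : Bool => (!b).toNat := continuous_of_discreteTopology
  change IsClosed {o : MidEdge ℤ → Bool | ∀ v : ℤ × ℤ, inDegree o v = 2 ∧ outDegree o v = 2}
  rw [h]
  refine isClosed_iInter fun v => IsClosed.inter (isClosed_eq ?_ continuous_const)
    (isClosed_eq ?_ continuous_const)
  · unfold inDegree
    exact (((hb.comp (continuous_apply _)).add (hb.comp (continuous_apply _))).add
      (hn.comp (continuous_apply _))).add (hn.comp (continuous_apply _))
  · unfold outDegree
    exact (((hn.comp (continuous_apply _)).add (hn.comp (continuous_apply _))).add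
      (hb.comp (continuous_apply _))).add (hb.comp (continuous_apply _))

instance : SecondCountableTopology (Config ℤ) :=
  TopologicalSpace.Subtype.secondCountableTopology _

theorem isClopen_vertexType (v : ℤ × ℤ) (t : VertexType) :
    IsClopen {σ : Config ℤ | vertexType σ v = t} := by
  have h : {σ : Config ℤ | vertexType σ v = t} =
      (fun σ : Config ℤ => (σ.1 (west v), σ.1 (south v), σ.1 (east v), σ.1 (north v))) ⁻¹'
        {arrows t} := by
    ext σ
    exact (vertexType_eq_iff σ v t).trans (hasType_iff σ.1 v t)
  rw [h]
  have hc : ∀ e, Continuous fun σ : Config ℤ => σ.1 e :=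
    fun e => (continuous_apply e).comp continuous_subtype_val
  exact (isClopen_discrete _).preimage
    ((hc _).prodMk ((hc _).prodMk ((hc _).prodMk (hc _))))

theorem isClopen_cylinder {k : ℕ} (v : Fin k → ℤ × ℤ) (t : Fin k → VertexType) :
    IsClopen {σ : Config ℤ | ∀ i, vertexType σ (v i) = t i} := by
  rw [show {σ : Config ℤ | ∀ i, vertexType σ (v i) = t i} =
    ⋂ i, {σ : Config ℤ | vertexType σ (v i) = t i} by ext; simp]
  exact isClopen_iInter_of_finite fun i => isClopen_vertexType _ _

/-- The events prescribing vertex types at finitely many vertices. -/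
def cylinders : Set (Set (Config ℤ)) :=
  {A | ∃ (F : Finset (ℤ × ℤ)) (f : ℤ × ℤ → VertexType), A = {σ | ∀ w ∈ F, vertexType σ w = f w}}

theorem exists_fin_of_mem_cylinders {A : Set (Config ℤ)} (hA : A ∈ cylinders) :
    ∃ (k : ℕ) (v : Fin k → ℤ × ℤ) (t : Fin k → VertexType), Function.Injective v ∧
      A = {σ | ∀ i, vertexType σ (v i) = t i} := by
  obtain ⟨F, f, rfl⟩ := hA
  refine ⟨F.card, fun i => F.equivFin.symm i, fun i => f (F.equivFin.symm i), fun i j h => ?_, ?_⟩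
  · exact F.equivFin.symm.injective (Subtype.ext h)
  · ext σ
    refine ⟨fun h i => h _ (F.equivFin.symm i).2, fun h w hw => ?_⟩
    have := h (F.equivFin ⟨w, hw⟩)
    simpa using this

theorem isPiSystem_cylinders : IsPiSystem cylinders := by
  rintro _ ⟨F, f, rfl⟩ _ ⟨G, g, rfl⟩ ⟨σ, hF, hG⟩
  classical
  refine ⟨F ∪ G, vertexType σ, ?_⟩
  ext τ
  simp only [Set.mem_inter_iff, Set.mem_ofPred_eq, Finset.mem_union] at hF hG ⊢
  constructor
  · rintro ⟨h1, h2⟩ w (hw | hw)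
    · rw [h1 w hw, hF w hw]
    · rw [h2 w hw, hG w hw]
  · intro h
    exact ⟨fun w hw => (h w (Or.inl hw)).trans (hF w hw),
      fun w hw => (h w (Or.inr hw)).trans (hG w hw)⟩

theorem generateFrom_cylinders :
    (inferInstance : MeasurableSpace (Config ℤ)) = MeasurableSpace.generateFrom cylinders := by
  refine le_antisymm ?_ (MeasurableSpace.generateFrom_le fun A hA => ?_)
  · have hP : ∀ (v : ℤ × ℤ) (P : VertexType → Prop),
        MeasurableSet[MeasurableSpace.generateFrom cylinders] {σ : Config ℤ | P (vertexType σ v)} := by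
      intro v P
      rw [show {σ : Config ℤ | P (vertexType σ v)} =
        ⋃ t ∈ {t | P t}, {σ : Config ℤ | vertexType σ v = t} by ext; simp]
      refine MeasurableSet.biUnion (Set.to_countable _) fun t _ =>
        MeasurableSpace.measurableSet_generateFrom ⟨{v}, fun _ => t, ?_⟩
      ext; simp
    have h : @Measurable (Config ℤ) (MidEdge ℤ → Bool) (MeasurableSpace.generateFrom cylinders) _
        Subtype.val := by
      refine (@measurable_pi_iff _ _ _ (MeasurableSpace.generateFrom cylinders) _ _).2
        fun e s _ => ?_
      obtain ⟨c, v⟩ := e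
      have harr := fun σ : Config ℤ => arrows_vertexType σ v
      cases c
      · convert hP v fun t => (arrows t).2.2.1 ∈ s using 1
        ext σ
        simp only [harr]
        rfl
      · convert hP v fun t => (arrows t).2.2.2 ∈ s using 1
        ext σ
        simp only [harr]
        rfl
    rintro _ ⟨u, hu, rfl⟩
    exact h hu
  · obtain ⟨k, v, t, _, rfl⟩ := exists_fin_of_mem_cylinders hA
    exact (isClopen_cylinder v t).isOpen.measurableSet

theorem vertexType_periodicExtension {n : ℕ} (σ : Config (ZMod n)) (v : ℤ × ℤ) :
    vertexType (periodicExtension σ) v = vertexType σ (castVertex n v) := by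
  rw [vertexType_eq_iff]
  have h := (vertexType_eq_iff σ (castVertex n v) _).1 rfl
  simpa [HasType, periodicExtension, castVertex, west, south, east, north] using h

theorem periodicMeasure_cylinder {α β γ : ℝ} (hα : 0 < α) (hβ : 0 < β) (hγ : 0 < γ)
    (hαβγ : α * β < γ ^ 2) (n : ℕ) {k : ℕ} (v : Fin k → ℤ × ℤ) (t : Fin k → VertexType) :
    ((periodicMeasure (freeFermionWeight α β γ) (freeFermionWeight_pos hα hβ hγ hαβγ) (n + 1) :
      ProbabilityMeasure (Config ℤ)) : Measure (Config ℤ)).real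
        {σ | ∀ i, vertexType σ (v i) = t i} =
      tiltedSum α β γ (torusEvent n v t) 1 /
        tiltedSum α β γ (Finset.univ : Finset (Config (ZMod (n + 1)))) 1 := by
  classical
  have hA := (isClopen_cylinder v t).isOpen.measurableSet
  have hpre : periodicExtension ⁻¹' {σ : Config ℤ | ∀ i, vertexType σ (v i) = t i} =
      ((torusEvent n v t : Finset (Config (ZMod (n + 1)))) : Set (Config (ZMod (n + 1)))) := by
    ext σ
    simp only [Set.mem_preimage, Set.mem_ofPred_eq, vertexType_periodicExtension, Finset.mem_coe]
    exact (mem_typeEvent _ _ _).symm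
  have hZ : tiltedSum α β γ (Finset.univ : Finset (Config (ZMod (n + 1)))) 1 =
      partitionFunction (freeFermionWeight α β γ) (n + 1) := by
    simp [tiltedSum, partitionFunction]
  have hZpos := partitionFunction_pos (freeFermionWeight_pos hα hβ hγ hαβγ) (n + 1)
  have hw := fun σ : Config (ZMod (n + 1)) =>
    (div_pos (weight_pos (freeFermionWeight_pos hα hβ hγ hαβγ) σ) hZpos).le
  rw [measureReal_def, periodicMeasure, ProbabilityMeasure.toMeasure_map,
    Measure.map_apply measurable_periodicExtension hA, hpre, torusMeasure]
  simp only [ProbabilityMeasure.coe_mk, Measure.coe_finsetSum, Finset.sum_apply, Measure.smul_apply,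
    smul_eq_mul]
  have hm : MeasurableSet ((torusEvent n v t : Finset (Config (ZMod (n + 1)))) :
      Set (Config (ZMod (n + 1)))) := by
    rw [← hpre]
    exact measurable_periodicExtension hA
  have hind : ∀ σ : Config (ZMod (n + 1)),
      ENNReal.ofReal (weight (freeFermionWeight α β γ) σ /
        partitionFunction (freeFermionWeight α β γ) (n + 1)) *
        (Measure.dirac σ) ((torusEvent n v t : Finset (Config (ZMod (n + 1)))) : Set _) =
      ENNReal.ofReal (if σ ∈ torusEvent n v t then weight (freeFermionWeight α β γ) σ /
        partitionFunction (freeFermionWeight α β γ) (n + 1) else 0) := by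
    intro σ
    rw [Measure.dirac_apply' _ hm, Set.indicator_apply]
    simp only [Finset.mem_coe]
    split_ifs <;> simp
  simp only [hind]
  rw [← ENNReal.ofReal_sum_of_nonneg fun σ _ => by split_ifs <;> simp [hw σ],
    ENNReal.toReal_ofReal (Finset.sum_nonneg fun σ _ => by split_ifs <;> simp [hw σ]),
    Finset.sum_ite_mem, Finset.univ_inter, ← Finset.sum_div, hZ]
  simp [tiltedSum]

section limits
variable {α β γ : ℝ} (hα : 0 < α) (hβ : 0 < β) (hγ : 0 < γ) (hαβγ : α * β < γ ^ 2)

/-- A limit along any filter has the predicted cylinder probabilities, as cylinder events are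
clopen. -/
theorem limit_cylinder {P : ProbabilityMeasure (Config ℤ)} {L : Filter ℕ} [L.NeBot]
    (hL : L ≤ atTop) (hP : Tendsto (fun n : ℕ => periodicMeasure (freeFermionWeight α β γ)
      (freeFermionWeight_pos hα hβ hγ hαβγ) (n + 1)) L (𝓝 P))
    {k : ℕ} {v : Fin k → ℤ × ℤ} (hv : Function.Injective v) (t : Fin k → VertexType) :
    (((P : Measure (Config ℤ)).real {σ | ∀ i, vertexType σ (v i) = t i} : ℝ) : ℂ) =
      limitValue α β γ v t := by
  have h1 := ProbabilityMeasure.tendsto_measure_of_null_frontier_of_tendsto' hP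
    (E := {σ | ∀ i, vertexType σ (v i) = t i}) (by
      rw [(isClopen_cylinder v t).frontier_eq, measure_empty])
  have h2 := (Complex.continuous_ofReal.tendsto _).comp
    ((ENNReal.tendsto_toReal (measure_ne_top _ _)).comp h1)
  refine tendsto_nhds_unique h2 (((tendsto_tiltedSum hα hβ hγ hαβγ hv t).mono_left hL).congr
    fun n => ?_)
  rw [← periodicMeasure_cylinder hα hβ hγ hαβγ n v t]
  rfl

/-- Two limits along possibly different filters agree on the π-system of cylinders. -/
theorem limit_unique {P Q : ProbabilityMeasure (Config ℤ)} {L M : Filter ℕ} [L.NeBot] [M.NeBot]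
    (hL : L ≤ atTop) (hM : M ≤ atTop)
    (hP : Tendsto (fun n : ℕ => periodicMeasure (freeFermionWeight α β γ)
      (freeFermionWeight_pos hα hβ hγ hαβγ) (n + 1)) L (𝓝 P))
    (hQ : Tendsto (fun n : ℕ => periodicMeasure (freeFermionWeight α β γ)
      (freeFermionWeight_pos hα hβ hγ hαβγ) (n + 1)) M (𝓝 Q)) : P = Q := by
  have key : (P : Measure (Config ℤ)) = (Q : Measure (Config ℤ)) := by
    refine ext_of_generate_finite cylinders generateFrom_cylinders isPiSystem_cylinders
      (fun A hA => ?_) (by rw [measure_univ, measure_univ])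
    obtain ⟨k, v, t, hv, rfl⟩ := exists_fin_of_mem_cylinders hA
    have h1 := (limit_cylinder hα hβ hγ hαβγ hL hP hv t).trans
      (limit_cylinder hα hβ hγ hαβγ hM hQ hv t).symm
    rw [Complex.ofReal_inj] at h1
    exact (measureReal_eq_measureReal_iff).1 h1
  exact Subtype.ext key

/-- By compactness there is a cluster point, and all cluster points coincide. -/
theorem existsUnique_infiniteVolumeMeasure :
    ∃! P : ProbabilityMeasure (Config ℤ), IsInfiniteVolumeMeasure (freeFermionWeight α β γ)
      (freeFermionWeight_pos hα hβ hγ hαβγ) P := by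
  obtain ⟨P, hP⟩ := exists_clusterPt_of_compactSpace (map (fun n : ℕ =>
    periodicMeasure (freeFermionWeight α β γ) (freeFermionWeight_pos hα hβ hγ hαβγ) (n + 1)) atTop)
  obtain ⟨U, hU, hUP⟩ := mapClusterPt_iff_ultrafilter.1 hP
  refine ⟨P, le_nhds_of_unique_clusterPt fun Q hQ => ?_, fun Q hQ => ?_⟩
  · obtain ⟨V, hV, hVQ⟩ := mapClusterPt_iff_ultrafilter.1 hQ
    exact limit_unique hα hβ hγ hαβγ hV hU hVQ hUP
  · exact limit_unique hα hβ hγ hαβγ le_rfl hU hQ hUP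

end limits

/-! ### Absolute convergence of the double integral -/

/-- The singular function `|sin ((θ - ψ) / 2)| ^ (-p)`, which is proportional to a negative power
of the distance of two points of the unit circle. -/
noncomputable def sinPower (p ψ θ : ℝ) : ℝ := |Real.sin ((θ - ψ) / 2)| ^ (-p)

theorem sinPower_nonneg (p ψ θ : ℝ) : 0 ≤ sinPower p ψ θ := Real.rpow_nonneg (abs_nonneg _) _

theorem sinPower_periodic (p ψ : ℝ) : Function.Periodic (sinPower p ψ) (2 * Real.pi) := by
  intro θ
  have : (θ + 2 * Real.pi - ψ) / 2 = (θ - ψ) / 2 + Real.pi := by ring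
  rw [sinPower, this, Real.sin_add_pi, abs_neg, sinPower]

theorem measurable_sinPower (p ψ : ℝ) : Measurable (sinPower p ψ) := by
  unfold sinPower
  fun_prop

/-- Near its two zeros on a period, `|sin (θ / 2)|` is bounded below by a linear function. -/
theorem intervalIntegrable_sinPower {p : ℝ} (hp0 : 0 < p) (hp1 : p < 1) (ψ a b : ℝ) :
    IntervalIntegrable (sinPower p ψ) volume a b := by
  have hpi := Real.pi_pos
  have h0 : IntervalIntegrable (sinPower p 0) volume 0 (2 * Real.pi) := by
    have g1 : IntervalIntegrable (fun x : ℝ => x ^ (-p)) volume 0 (2 * Real.pi) :=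
      intervalIntegral.intervalIntegrable_rpow' (by linarith)
    have g2 : IntervalIntegrable (fun x : ℝ => (2 * Real.pi - x) ^ (-p)) volume 0 (2 * Real.pi) := by
      have := g1.symm.comp_sub_left (2 * Real.pi)
      simpa using this
    refine (((g1.add g2).const_mul (Real.pi ^ p))).mono_fun'
      (measurable_sinPower p 0).aestronglyMeasurable ?_
    rw [Set.uIoc_of_le (by positivity)]
    refine (ae_restrict_iff' measurableSet_Ioc).2 (Eventually.of_forall fun θ hθ => ?_)
    obtain ⟨hθ0, hθ1⟩ := hθ
    have hA : ∀ u : ℝ, 0 < u → u ≤ Real.pi → |Real.sin (u / 2)| ^ (-p) ≤ Real.pi ^ p * u ^ (-p) := by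
      intro u hu0 hu1
      have h1 := Real.mul_le_sin (x := u / 2) (by linarith) (by linarith)
      have h2 : 2 / Real.pi * (u / 2) = u / Real.pi := by field_simp
      rw [h2] at h1
      refine (Real.rpow_le_rpow_of_nonpos (by positivity) (h1.trans (le_abs_self _))
        (by linarith)).trans (le_of_eq ?_)
      rw [Real.div_rpow hu0.le hpi.le, Real.rpow_neg hpi.le, div_inv_eq_mul, mul_comm]
    have e1 : 0 ≤ Real.pi ^ p * θ ^ (-p) := by positivity
    have e2 : 0 ≤ Real.pi ^ p * (2 * Real.pi - θ) ^ (-p) :=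
      mul_nonneg (by positivity) (Real.rpow_nonneg (by linarith) _)
    change ‖sinPower p 0 θ‖ ≤ Real.pi ^ p * (θ ^ (-p) + (2 * Real.pi - θ) ^ (-p))
    rw [Real.norm_of_nonneg (sinPower_nonneg _ _ _), sinPower, sub_zero, mul_add]
    rcases le_total θ Real.pi with h | h
    · exact (hA θ hθ0 h).trans (le_add_of_nonneg_right e2)
    · rcases eq_or_lt_of_le hθ1 with h' | h'
      · have : Real.sin (θ / 2) = 0 := by rw [h', mul_div_cancel_left₀ _ two_ne_zero, Real.sin_pi]
        rw [this, abs_zero, Real.zero_rpow (by linarith)]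
        exact add_nonneg e1 e2
      · have h3 : Real.sin (θ / 2) = Real.sin ((2 * Real.pi - θ) / 2) := by
          rw [← Real.sin_pi_sub]; congr 1; ring
        rw [h3]
        exact (hA _ (by linarith) (by linarith)).trans (le_add_of_nonneg_left e1)
  have h1 := (sinPower_periodic p 0).intervalIntegrable₀ (by positivity) h0 (a - ψ) (b - ψ)
  have h2 := h1.comp_sub_right ψ
  simp only [sub_add_cancel] at h2
  refine h2.congr fun x _ => ?_
  simp [sinPower]

/-- The integral over a period does not depend on the position of the singularity. -/
theorem integral_sinPower (p ψ : ℝ) : ∫ θ in (0 : ℝ)..2 * Real.pi, sinPower p ψ θ =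
    ∫ θ in (0 : ℝ)..2 * Real.pi, sinPower p 0 θ := by
  have h : ∀ θ, sinPower p ψ θ = sinPower p 0 (θ - ψ) := fun θ => by simp [sinPower]
  simp only [h]
  rw [intervalIntegral.integral_comp_sub_right (fun θ => sinPower p 0 θ)]
  have := (sinPower_periodic p 0).intervalIntegral_add_eq (0 - ψ) 0
  rw [zero_add] at this
  rw [← this]
  congr 1
  ring

theorem countable_sin_eq_zero (ψ : ℝ) : {θ : ℝ | Real.sin ((θ - ψ) / 2) = 0}.Countable := by
  refine (Set.countable_range fun n : ℤ => ψ + 2 * (n * Real.pi)).mono ?_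
  intro θ hθ
  obtain ⟨n, hn⟩ := Real.sin_eq_zero_iff.1 hθ
  exact ⟨n, by simp only; linarith⟩

/-- `|a + b w|` is at least a multiple of the distance of `w` from the point of the circle where it
is minimal. -/
theorem exists_norm_add_mul_ge (a b : ℂ) : ∃ ψ : ℝ, ∀ θ : ℝ,
    max ‖a‖ ‖b‖ * |Real.sin ((θ - ψ) / 2)| ≤ ‖a + b * circlePoint (θ / (2 * Real.pi))‖ := by
  refine ⟨Complex.arg a - Complex.arg b + Real.pi, fun θ => ?_⟩
  have hpi := Real.pi_ne_zero
  set ψ := Complex.arg a - Complex.arg b + Real.pi with hψ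
  have hw : circlePoint (θ / (2 * Real.pi)) = Complex.exp (θ * Complex.I) := by
    rw [circlePoint, mul_div_cancel₀ _ (by positivity)]
  have h1 : ‖a + b * circlePoint (θ / (2 * Real.pi))‖ ^ 2 =
      (‖a‖ - ‖b‖) ^ 2 + 4 * ‖a‖ * ‖b‖ * Real.sin ((θ - ψ) / 2) ^ 2 := by
    have hs : Real.sin ((θ - ψ) / 2) ^ 2 =
        (1 + Real.cos (Complex.arg b + θ - Complex.arg a)) / 2 := by
      rw [Real.sin_sq_eq_half_sub]
      have e : 2 * ((θ - ψ) / 2) = (Complex.arg b + θ - Complex.arg a) - Real.pi := by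
        rw [hψ]; ring
      rw [e, Real.cos_sub_pi]
      ring
    have ha : a = ‖a‖ * Complex.exp (Complex.arg a * Complex.I) :=
      (Complex.norm_mul_exp_arg_mul_I a).symm
    have hb : b * Complex.exp (θ * Complex.I) =
        ‖b‖ * Complex.exp ((Complex.arg b + θ : ℝ) * Complex.I) := by
      conv_lhs => rw [← Complex.norm_mul_exp_arg_mul_I b]
      push_cast
      rw [add_mul, Complex.exp_add]
      ring
    rw [hw, hb, hs, Real.cos_sub]
    set μ := Complex.arg a
    set ν := Complex.arg b + θ
    conv_lhs => rw [ha]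
    rw [Complex.exp_mul_I, Complex.exp_mul_I, ← Complex.ofReal_cos, ← Complex.ofReal_sin,
      ← Complex.ofReal_cos, ← Complex.ofReal_sin, ← Complex.normSq_eq_norm_sq, Complex.normSq_apply]
    simp only [Complex.add_re, Complex.add_im, Complex.mul_re, Complex.mul_im, Complex.ofReal_re,
      Complex.ofReal_im, Complex.I_re, Complex.I_im]
    have c1 := Real.sin_sq_add_cos_sq μ
    have c2 := Real.sin_sq_add_cos_sq ν
    linear_combination ‖a‖ ^ 2 * c1 + ‖b‖ ^ 2 * c2
  refine le_of_sq_le_sq ?_ (norm_nonneg _)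
  rw [h1, mul_pow, sq_abs]
  set s := Real.sin ((θ - ψ) / 2) ^ 2 with hs
  have hs0 : 0 ≤ s := sq_nonneg _
  have hs1 : s ≤ 1 := Real.sin_sq_le_one _
  have key : ∀ A B : ℝ, 0 ≤ B → B ≤ A → A ^ 2 * s ≤ (A - B) ^ 2 + 4 * A * B * s := by
    intro A B hB hBA
    rcases le_total A (4 * B) with h | h
    · nlinarith [sq_nonneg (A - B), mul_nonneg (mul_nonneg (hB.trans hBA) (sub_nonneg.2 h)) hs0]
    · nlinarith [mul_nonneg (mul_nonneg (hB.trans hBA) (sub_nonneg.2 h)) (sub_nonneg.2 hs1),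
        mul_nonneg hB (hB.trans hBA)]
  rcases le_total ‖a‖ ‖b‖ with h | h
  · rw [max_eq_right h]
    have := key ‖b‖ ‖a‖ (norm_nonneg _) h
    nlinarith
  · rw [max_eq_left h]
    exact key ‖a‖ ‖b‖ (norm_nonneg _) h

/-- A level `c` that the cosine does not attain is replaced by its nearest value `±1`. -/
theorem exists_cos_sub_ge (c : ℝ) : ∃ ψ : ℝ, ∀ θ : ℝ,
    |Real.sin ((θ - ψ) / 2)| * |Real.sin ((θ + ψ) / 2)| ≤ |Real.cos θ - c| := by
  have hmain : ∀ ψ θ : ℝ, |Real.sin ((θ - ψ) / 2)| * |Real.sin ((θ + ψ) / 2)| ≤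
      |Real.cos θ - Real.cos ψ| := by
    intro ψ θ
    rw [Real.cos_sub_cos, abs_mul, abs_mul, abs_neg, abs_two]
    have := mul_nonneg (abs_nonneg (Real.sin ((θ + ψ) / 2))) (abs_nonneg (Real.sin ((θ - ψ) / 2)))
    nlinarith
  rcases le_total c (-1) with h | h
  · refine ⟨Real.pi, fun θ => (hmain _ θ).trans ?_⟩
    have := Real.neg_one_le_cos θ
    rw [Real.cos_pi, abs_of_nonneg (by linarith), abs_of_nonneg (by linarith)]
    linarith
  · rcases le_total 1 c with h' | h'
    · refine ⟨0, fun θ => (hmain _ θ).trans ?_⟩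
      have := Real.cos_le_one θ
      rw [Real.cos_zero, abs_of_nonpos (by linarith), abs_of_nonpos (by linarith)]
      linarith
    · refine ⟨Real.arccos c, fun θ => ?_⟩
      have := hmain (Real.arccos c) θ
      rwa [Real.cos_arccos h h'] at this

/-- Interpolation between two lower bounds for `x`. The exponents are chosen such that all powers on
the right remain integrable if `s₁`, `s₂` and `u` have simple zeros, even if `s₁ = s₂`. -/
theorem inv_le_of_lower_bounds {x u s₁ s₂ k d : ℝ} (hk : 0 < k) (hd : 0 < d) (hu : 0 < u)
    (h1 : 0 < s₁) (h2 : 0 < s₂) (hx1 : k * (s₁ * s₂) ≤ x) (hx2 : d * u ≤ x) :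
    x⁻¹ ≤ k ^ (-(1 / 4) : ℝ) * d ^ (-(3 / 4) : ℝ) *
      ((s₁ ^ (-(1 / 2) : ℝ) + s₂ ^ (-(1 / 2) : ℝ)) * u ^ (-(3 / 4) : ℝ)) := by
  have hx : 0 < x := lt_of_lt_of_le (by positivity) hx2
  have e : x⁻¹ = x ^ (-(1 / 4) : ℝ) * x ^ (-(3 / 4) : ℝ) := by
    rw [← Real.rpow_add hx, ← Real.rpow_neg_one]; norm_num
  have b1 : x ^ (-(1 / 4) : ℝ) ≤ k ^ (-(1 / 4) : ℝ) * (s₁ ^ (-(1 / 2) : ℝ) + s₂ ^ (-(1 / 2) : ℝ)) := by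
    refine (Real.rpow_le_rpow_of_nonpos (by positivity) hx1 (by norm_num)).trans ?_
    rw [Real.mul_rpow hk.le (by positivity), Real.mul_rpow h1.le h2.le]
    refine mul_le_mul_of_nonneg_left ?_ (by positivity)
    have q : ∀ s : ℝ, 0 < s → s ^ (-(1 / 2) : ℝ) = (s ^ (-(1 / 4) : ℝ)) ^ 2 := fun s hs => by
      rw [← Real.rpow_natCast, ← Real.rpow_mul hs.le]; norm_num
    rw [q s₁ h1, q s₂ h2]
    nlinarith [sq_nonneg (s₁ ^ (-(1 / 4) : ℝ) - s₂ ^ (-(1 / 4) : ℝ)),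
      sq_nonneg (s₁ ^ (-(1 / 4) : ℝ)), sq_nonneg (s₂ ^ (-(1 / 4) : ℝ))]
  have b2 : x ^ (-(3 / 4) : ℝ) ≤ d ^ (-(3 / 4) : ℝ) * u ^ (-(3 / 4) : ℝ) := by
    refine (Real.rpow_le_rpow_of_nonpos (by positivity) hx2 (by norm_num)).trans ?_
    rw [Real.mul_rpow hd.le hu.le]
  rw [e]
  refine (mul_le_mul b1 b2 (by positivity) (by positivity)).trans (le_of_eq (by ring))

/-- The kernel integrand without half-integer powers and without the differentials. -/
noncomputable def symbolIntegrand (α β γ : ℝ) (x y : MidEdge ℤ) (w₁ w₂ : ℂ) : ℂ :=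
  w₁ ^ (y.2.1 - x.2.1) * w₂ ^ (y.2.2 - x.2.2) *
    ((adjConst α γ y.1 x.1 w₁ + adjLin β γ y.1 x.1 * w₂) / (coeffA α w₁ + coeffB α β γ w₁ * w₂))

theorem norm_symbolIntegrand_le (α β γ : ℝ) (x y : MidEdge ℤ) {w₁ w₂ : ℂ} (h1 : ‖w₁‖ = 1)
    (h2 : ‖w₂‖ = 1) : ‖symbolIntegrand α β γ x y w₁ w₂‖ ≤
      (1 + |α| + |γ| + ‖adjLin β γ y.1 x.1‖) * ‖coeffA α w₁ + coeffB α β γ w₁ * w₂‖⁻¹ := by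
  rw [symbolIntegrand, norm_mul, norm_mul, norm_zpow, norm_zpow, h1, h2, one_zpow, one_zpow,
    one_mul, one_mul, norm_div, div_eq_mul_inv]
  refine mul_le_mul_of_nonneg_right ((norm_add_le _ _).trans ?_) (inv_nonneg.2 (norm_nonneg _))
  rw [norm_mul, h2, mul_one]
  exact add_le_add (norm_adjConst_le _ _ _ _ h1) le_rfl

/-- The integrand as a function of two angles. -/
noncomputable def angleIntegrand (α β γ : ℝ) (x y : MidEdge ℤ) (p : ℝ × ℝ) : ℂ :=
  symbolIntegrand α β γ x y (circlePoint (p.1 / (2 * Real.pi))) (circlePoint (p.2 / (2 * Real.pi)))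

theorem measurable_angleIntegrand (α β γ : ℝ) (x y : MidEdge ℤ) :
    Measurable (angleIntegrand α β γ x y) := by
  have hc := continuous_circlePoint.measurable
  have h1 : Measurable fun p : ℝ × ℝ => circlePoint (p.1 / (2 * Real.pi)) :=
    hc.comp (measurable_fst.div_const _)
  have h2 : Measurable fun p : ℝ × ℝ => circlePoint (p.2 / (2 * Real.pi)) :=
    hc.comp (measurable_snd.div_const _)
  unfold angleIntegrand symbolIntegrand coeffA coeffB
  exact ((h1.pow_const _).mul (h2.pow_const _)).mul
    ((((continuous_adjConst α γ y.1 x.1).measurable.comp h1).add (h2.const_mul _)).div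
      (((h1.const_mul _).const_add _).add ((((h1.const_mul _).const_sub _)).mul h2)))

/-- Integrability of the kernel on the torus: in each frequency `Δ` vanishes to an order that is
compensated by interpolating between two lower bounds of `|Δ|`. -/
theorem integrableOn_angleIntegrand {α β γ : ℝ} (hα : 0 < α) (hβ : 0 < β) (hγ : 0 < γ)
    (hαβγ : α * β < γ ^ 2) (x y : MidEdge ℤ) :
    IntegrableOn (angleIntegrand α β γ x y)
      (Set.Icc 0 (2 * Real.pi) ×ˢ Set.Icc 0 (2 * Real.pi)) (volume.prod volume) := by
  have hpi := Real.pi_pos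
  have hslope := slope_pos hα hβ hαβγ
  have hδ : 0 < γ ^ 2 - α * β := by linarith
  set A₀ := 1 + α ^ 2 - β ^ 2 - (γ ^ 2 - α * β) ^ 2 with hA₀
  set A₁ := 2 * (α + β * (γ ^ 2 - α * β)) with hA₁
  set M := 1 + |α| + |β| + |γ ^ 2 - α * β| with hM
  have hMpos : 0 < M := by positivity
  set d := γ ^ 2 / (γ ^ 2 - α * β + α) with hd
  have hdpos : 0 < d := by positivity
  obtain ⟨φ, hφ⟩ := exists_cos_sub_ge (-A₀ / A₁)
  set k := A₁ / (2 * M) with hk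
  have hkpos : 0 < k := by positivity
  set C := 1 + |α| + |γ| + ‖adjLin β γ y.1 x.1‖ with hC
  have hCpos : 0 < C := by positivity
  have hint : ∀ p, 0 < p → p < 1 → ∀ ψ, IntegrableOn (sinPower p ψ) (Set.Icc 0 (2 * Real.pi)) :=
    fun p h0 h1 ψ => (intervalIntegrable_iff_integrableOn_Icc_of_le (by positivity)).1
      (intervalIntegrable_sinPower h0 h1 ψ 0 (2 * Real.pi))
  set J := ∫ θ in (0 : ℝ)..2 * Real.pi, sinPower (3 / 4) 0 θ with hJ
  -- the bound for a fixed first frequency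
  have hpoint : ∀ θ, Real.sin ((θ - φ) / 2) ≠ 0 → Real.sin ((θ - -φ) / 2) ≠ 0 →
      ∃ ψ, ∀ θ', Real.sin ((θ' - ψ) / 2) ≠ 0 → ‖angleIntegrand α β γ x y (θ, θ')‖ ≤
        C * (k ^ (-(1 / 4) : ℝ) * d ^ (-(3 / 4) : ℝ) *
          ((sinPower (1 / 2) φ θ + sinPower (1 / 2) (-φ) θ) * sinPower (3 / 4) ψ θ')) := by
    intro θ hs1 hs2
    set w := circlePoint (θ / (2 * Real.pi)) with hw
    obtain ⟨ψ, hψ⟩ := exists_norm_add_mul_ge (coeffA α w) (coeffB α β γ w)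
    refine ⟨ψ, fun θ' hs3 => ?_⟩
    set w' := circlePoint (θ' / (2 * Real.pi)) with hw'
    have hn' : ‖w'‖ = 1 := norm_circlePoint _
    refine (norm_symbolIntegrand_le α β γ x y (norm_circlePoint _) hn').trans ?_
    refine mul_le_mul_of_nonneg_left ?_ hCpos.le
    refine inv_le_of_lower_bounds hkpos hdpos (abs_pos.2 hs3) (abs_pos.2 hs1) (abs_pos.2 hs2) ?_ ?_
    · have h1 := normSq_coeff_sub α β γ (θ / (2 * Real.pi))
      rw [mul_div_cancel₀ _ (by positivity : (2 * Real.pi) ≠ 0), ← hw, ← hA₀, ← hA₁] at h1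
      obtain ⟨m1, m2⟩ := norm_coeff_le α β γ (θ / (2 * Real.pi))
      rw [← hw, ← hM] at m1 m2
      have h2 : |‖coeffA α w‖ - ‖coeffB α β γ w‖| ≤ ‖coeffA α w + coeffB α β γ w * w'‖ := by
        have := abs_norm_sub_norm_le (coeffA α w) (-(coeffB α β γ w * w'))
        rwa [norm_neg, norm_mul, hn', mul_one, sub_neg_eq_add] at this
      have h3 : |‖coeffA α w‖ ^ 2 - ‖coeffB α β γ w‖ ^ 2| ≤
          |‖coeffA α w‖ - ‖coeffB α β γ w‖| * (2 * M) := by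
        rw [sq_sub_sq, abs_mul, mul_comm, abs_of_nonneg (a := ‖coeffA α w‖ + _) (by positivity)]
        exact mul_le_mul_of_nonneg_left (by linarith) (abs_nonneg _)
      have h4 : A₁ * |Real.cos θ - -A₀ / A₁| = |‖coeffA α w‖ ^ 2 - ‖coeffB α β γ w‖ ^ 2| := by
        rw [h1, ← abs_of_pos hslope, ← abs_mul, abs_of_pos hslope]
        congr 1
        field_simp
        ring
      have h5 := mul_le_mul_of_nonneg_left (hφ θ) hslope.le
      rw [sub_neg_eq_add, hk, div_mul_eq_mul_div, div_le_iff₀ (by positivity)]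
      calc _ ≤ A₁ * |Real.cos θ - -A₀ / A₁| := h5
        _ ≤ _ := by
          rw [h4]
          exact h3.trans (mul_le_mul_of_nonneg_right h2 (by positivity))
    · exact (mul_le_mul_of_nonneg_right (le_max_coeff hα hγ hαβγ w) (abs_nonneg _)).trans (hψ θ')
  have hmeas := measurable_angleIntegrand α β γ x y
  have hae1 : ∀ ψ : ℝ, ∀ᵐ θ ∂(volume.restrict (Set.Icc 0 (2 * Real.pi))),
      Real.sin ((θ - ψ) / 2) ≠ 0 := fun ψ =>
    ae_restrict_of_ae ((countable_sin_eq_zero ψ).ae_notMem volume)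
  have hinner : ∀ θ, Real.sin ((θ - φ) / 2) ≠ 0 → Real.sin ((θ - -φ) / 2) ≠ 0 →
      IntegrableOn (fun θ' => angleIntegrand α β γ x y (θ, θ')) (Set.Icc 0 (2 * Real.pi)) ∧
      ∫ θ' in Set.Icc 0 (2 * Real.pi), ‖angleIntegrand α β γ x y (θ, θ')‖ ≤
        C * (k ^ (-(1 / 4) : ℝ) * d ^ (-(3 / 4) : ℝ) *
          ((sinPower (1 / 2) φ θ + sinPower (1 / 2) (-φ) θ) * J)) := by
    intro θ hs1 hs2
    obtain ⟨ψ, hψ⟩ := hpoint θ hs1 hs2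
    have hb : IntegrableOn (fun θ' => C * (k ^ (-(1 / 4) : ℝ) * d ^ (-(3 / 4) : ℝ) *
          ((sinPower (1 / 2) φ θ + sinPower (1 / 2) (-φ) θ) * sinPower (3 / 4) ψ θ')))
        (Set.Icc 0 (2 * Real.pi)) :=
      ((((hint (3 / 4) (by norm_num) (by norm_num) ψ).const_mul _).const_mul _).const_mul _)
    have hm : AEStronglyMeasurable (fun θ' => angleIntegrand α β γ x y (θ, θ'))
        (volume.restrict (Set.Icc 0 (2 * Real.pi))) :=
      (hmeas.comp measurable_prodMk_left).aestronglyMeasurable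
    have hi : IntegrableOn (fun θ' => angleIntegrand α β γ x y (θ, θ')) (Set.Icc 0 (2 * Real.pi)) := by
      refine Integrable.mono' hb hm ?_
      filter_upwards [hae1 ψ] with θ' h
      exact hψ θ' h
    refine ⟨hi, ?_⟩
    refine (integral_mono_ae hi.norm hb ?_).trans (le_of_eq ?_)
    · filter_upwards [hae1 ψ] with θ' h
      exact hψ θ' h
    · rw [integral_const_mul, integral_const_mul, integral_const_mul, hJ, ← integral_sinPower _ ψ,
        intervalIntegral.integral_of_le (by positivity), integral_Icc_eq_integral_Ioc]
  rw [IntegrableOn, ← Measure.prod_restrict, integrable_prod_iff hmeas.aestronglyMeasurable]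
  constructor
  · filter_upwards [hae1 φ, hae1 (-φ)] with θ h1 h2
    exact (hinner θ h1 h2).1
  · have hb : IntegrableOn (fun θ => C * (k ^ (-(1 / 4) : ℝ) * d ^ (-(3 / 4) : ℝ) *
          ((sinPower (1 / 2) φ θ + sinPower (1 / 2) (-φ) θ) * J))) (Set.Icc 0 (2 * Real.pi)) :=
      (((((hint (1 / 2) (by norm_num) (by norm_num) φ).add
        (hint (1 / 2) (by norm_num) (by norm_num) (-φ))).mul_const _).const_mul _).const_mul _)
    refine Integrable.mono' hb
      (hmeas.norm.stronglyMeasurable.integral_prod_right).aestronglyMeasurable ?_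
    filter_upwards [hae1 φ, hae1 (-φ)] with θ h1 h2
    rw [Real.norm_of_nonneg (integral_nonneg fun _ => norm_nonneg _)]
    exact (hinner θ h1 h2).2

/-! ### The kernel as a one-dimensional integral -/

theorem cpow_eq_zpow {w : ℂ} {q : ℂ} {m : ℤ} (hq : q = m) : w ^ q = w ^ m := by
  rw [hq, Complex.cpow_intCast]

theorem cpow_half_mul_self {w : ℂ} (hw : w ≠ 0) : w ^ (1 / 2 : ℂ) * w ^ (1 / 2 : ℂ) = w := by
  rw [← Complex.cpow_add _ _ hw]
  norm_num

theorem cpow_add_half {w : ℂ} (hw : w ≠ 0) {q : ℂ} {m : ℤ} (hq : q = m + 1 / 2) :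
    w ^ q * w ^ (1 / 2 : ℂ) = w ^ (m + 1) := by
  rw [hq, Complex.cpow_add _ _ hw, mul_assoc, cpow_half_mul_self hw, Complex.cpow_intCast,
    zpow_add_one₀ hw]

theorem cpow_sub_half {w : ℂ} (hw : w ≠ 0) {q : ℂ} {m : ℤ} (hq : q = m - 1 / 2) :
    w ^ q * w ^ (1 / 2 : ℂ) = w ^ m := by
  rw [← Complex.cpow_add _ _ hw, ← Complex.cpow_intCast]
  congr 1
  rw [hq]; ring

/-- The principal square roots in the off-diagonal entries combine to integer powers. -/
theorem det_kernelMatrix (α β γ : ℝ) {w₁ w₂ : ℂ} (h₁ : w₁ ≠ 0) (h₂ : w₂ ≠ 0) :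
    (kernelMatrix α β γ w₁ w₂).det = coeffA α w₁ + coeffB α β γ w₁ * w₂ := by
  rw [det_colour]
  simp only [kernelMatrix, coeffA, coeffB]
  linear_combination (-(γ : ℂ) ^ 2 * (w₂ ^ (1 / 2 : ℂ) * w₂ ^ (1 / 2 : ℂ))) * cpow_half_mul_self h₁ -
    (γ : ℂ) ^ 2 * w₁ * cpow_half_mul_self h₂

/-- The inverse as a quotient; both sides vanish for a singular matrix. -/
theorem inv_colour_eq_div (M : Matrix Colour Colour ℂ) (c c' : Colour) :
    M⁻¹ c c' = adjugateColour M c c' / M.det := by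
  by_cases h : M.det = 0
  · rw [h, div_zero, Matrix.nonsing_inv_apply_not_isUnit _ (by simp [h])]
    rfl
  · exact inv_colour M h c c'

/-- The half-integer powers in the exponents and in the off-diagonal entries combine to integer
powers, because the coordinates of mid-edges of different colours differ by half-integers. -/
theorem kernelIntegrand_eq (α β γ : ℝ) (x y : MidEdge ℤ) {w : Fin 2 → ℂ} (h₁ : w 0 ≠ 0)
    (h₂ : w 1 ≠ 0) : kernelIntegrand α β γ x y w =
      1 / (2 * Real.pi * Complex.I * w 0) * (1 / (2 * Real.pi * Complex.I * w 1)) *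
        symbolIntegrand α β γ x y (w 0) (w 1) := by
  rw [kernelIntegrand, symbolIntegrand, inv_colour_eq_div, det_kernelMatrix _ _ _ h₁ h₂]
  congr 1
  rw [mul_div_assoc', mul_div_assoc']
  congr 1
  obtain ⟨c, x₁, x₂⟩ := x
  obtain ⟨c', y₁, y₂⟩ := y
  cases c <;> cases c' <;> simp only [coord₁, coord₂, adjugateColour, kernelMatrix, adjConst, adjLin]
  · rw [cpow_eq_zpow (m := y₁ - x₁) (by push_cast; ring),
      cpow_eq_zpow (m := y₂ - x₂) (by push_cast; ring)]
  · have e1 := cpow_sub_half h₁ (q := (((y₁ : ℚ) - (x₁ + 1 / 2) : ℚ) : ℂ)) (m := y₁ - x₁)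
      (by push_cast; ring)
    have e2 := cpow_add_half h₂ (q := ((((y₂ : ℚ) + 1 / 2) - x₂ : ℚ) : ℂ)) (m := y₂ - x₂)
      (by push_cast; ring)
    rw [zpow_add_one₀ h₂] at e2
    linear_combination (-(γ : ℂ)) * (w 1 ^ ((((y₂ : ℚ) + 1 / 2) - x₂ : ℚ) : ℂ) *
      w 1 ^ (1 / 2 : ℂ)) * e1 - (γ : ℂ) * (w 0) ^ (y₁ - x₁) * e2
  · have e1 := cpow_add_half h₁ (q := ((((y₁ : ℚ) + 1 / 2) - x₁ : ℚ) : ℂ)) (m := y₁ - x₁)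
      (by push_cast; ring)
    have e2 := cpow_sub_half h₂ (q := (((y₂ : ℚ) - (x₂ + 1 / 2) : ℚ) : ℂ)) (m := y₂ - x₂)
      (by push_cast; ring)
    rw [zpow_add_one₀ h₁] at e1
    linear_combination (-(γ : ℂ)) * (w 1 ^ (((y₂ : ℚ) - (x₂ + 1 / 2) : ℚ) : ℂ) *
      w 1 ^ (1 / 2 : ℂ)) * e1 - (γ : ℂ) * (w 0) ^ (y₁ - x₁) * w 0 * e2
  · rw [cpow_eq_zpow (m := y₁ - x₁) (by push_cast; ring),
      cpow_eq_zpow (m := y₂ - x₂) (by push_cast; ring)]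
    ring

theorem torusMap_eq_circlePoint (θ : Fin 2 → ℝ) (i : Fin 2) :
    torusMap 0 1 θ i = circlePoint (θ i / (2 * Real.pi)) := by
  have : (2 * Real.pi : ℝ) ≠ 0 := by positivity
  rw [torusMap, circlePoint, mul_div_cancel₀ _ this]
  simp

theorem finTwoArrow_preimage_Icc :
    MeasurableEquiv.finTwoArrow ⁻¹' (Set.Icc 0 (2 * Real.pi) ×ˢ Set.Icc 0 (2 * Real.pi)) =
      Set.Icc (0 : Fin 2 → ℝ) fun _ => 2 * Real.pi := by
  ext θ
  simp [Pi.le_def, Fin.forall_fin_two, MeasurableEquiv.finTwoArrow]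

theorem torusIntegrable_kernelIntegrand {α β γ : ℝ} (hα : 0 < α) (hβ : 0 < β) (hγ : 0 < γ)
    (hαβγ : α * β < γ ^ 2) (x y : MidEdge ℤ) :
    TorusIntegrable (kernelIntegrand α β γ x y) 0 1 := by
  have h1 := integrableOn_angleIntegrand hα hβ hγ hαβγ x y
  have he := (volume_preserving_finTwoArrow ℝ)
  have hS := finTwoArrow_preimage_Icc
  have h2 := (he.integrableOn_comp_preimage MeasurableEquiv.finTwoArrow.measurableEmbedding).2 h1
  rw [hS] at h2
  have hc : ∀ i : Fin 2, Continuous fun θ : Fin 2 → ℝ => circlePoint (θ i / (2 * Real.pi)) :=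
    fun i => continuous_circlePoint.comp ((continuous_apply i).div_const _)
  have h2pi : (2 * Real.pi * Complex.I : ℂ) ≠ 0 := Complex.two_pi_I_ne_zero
  have h3 : (fun θ : Fin 2 → ℝ => kernelIntegrand α β γ x y (torusMap 0 1 θ)) =
      fun θ => (1 / (2 * Real.pi * Complex.I * circlePoint (θ 0 / (2 * Real.pi))) *
        (1 / (2 * Real.pi * Complex.I * circlePoint (θ 1 / (2 * Real.pi))))) •
          (angleIntegrand α β γ x y ∘ MeasurableEquiv.finTwoArrow) θ := by
    funext θ
    rw [kernelIntegrand_eq _ _ _ _ _ (by rw [torusMap_eq_circlePoint]; exact circlePoint_ne_zero _)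
      (by rw [torusMap_eq_circlePoint]; exact circlePoint_ne_zero _), torusMap_eq_circlePoint,
      torusMap_eq_circlePoint]
    rfl
  rw [TorusIntegrable, h3]
  refine h2.integrable.bdd_mul (c := (1 / (2 * Real.pi)) * (1 / (2 * Real.pi))) ?_ ?_
  · refine Continuous.aestronglyMeasurable ?_
    exact (continuous_const.div (continuous_const.mul (hc 0)) fun θ =>
      mul_ne_zero h2pi (circlePoint_ne_zero _)).mul
      (continuous_const.div (continuous_const.mul (hc 1)) fun θ =>
      mul_ne_zero h2pi (circlePoint_ne_zero _))
  · refine Eventually.of_forall fun θ => le_of_eq ?_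
    have := abs_of_pos Real.pi_pos
    simp [norm_circlePoint, this]

/-- Laurent coefficients of `1 / (a + b w)` on the unit circle, as a limit of averages over roots
of unity. -/
theorem integral_circlePoint_zpow_div {a b : ℂ} (hab : ‖a‖ ≠ ‖b‖) (j : ℤ) :
    ∫ θ in (0 : ℝ)..1, circlePoint θ ^ j / (a + b * circlePoint θ) = limitCoeff a b j := by
  have hne : ∀ w : ℂ, ‖w‖ = 1 → a + b * w ≠ 0 := by
    intro w hw h
    have : a = -(b * w) := eq_neg_of_add_eq_zero_left h
    exact hab (by rw [this, norm_neg, norm_mul, hw, mul_one])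
  have hcont : Continuous fun θ => circlePoint θ ^ j / (a + b * circlePoint θ) :=
    (continuous_circlePoint.zpow₀ j fun θ => Or.inl (circlePoint_ne_zero θ)).div
      (continuous_const.add (continuous_const.mul continuous_circlePoint))
      fun θ => hne _ (norm_circlePoint θ)
  have hlow : 0 < |‖a‖ - ‖b‖| := abs_pos.2 (sub_ne_zero.2 hab)
  have h1 := tendsto_riemannSum (fun _ => 0) (fun _ => by simp)
    (fun _ θ => circlePoint θ ^ j / (a + b * circlePoint θ))
    (fun θ => circlePoint θ ^ j / (a + b * circlePoint θ)) (1 / |‖a‖ - ‖b‖|)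
    (Eventually.of_forall fun n i _ => by
      rw [norm_div, norm_zpow, norm_circlePoint, one_zpow]
      refine one_div_le_one_div_of_le hlow ?_
      have := abs_norm_sub_norm_le a (-(b * circlePoint ((i + 0) / (n + 1 : ℕ))))
      rwa [norm_neg, norm_mul, norm_circlePoint, mul_one, sub_neg_eq_add] at this)
    (Eventually.of_forall fun θ u hu => (hcont.tendsto θ).comp hu)
  have hη : ∀ n : ℕ, ‖(-1 : ℂ) ^ (n + 1 + 1)‖ = 1 := fun n => by simp
  have h2 := tendsto_circleCoeff hab (tendsto_const_nhds (x := a)) (tendsto_const_nhds (x := b))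
    one_pos (η := fun n => (-1) ^ (n + 1 + 1)) (fun n => (hη n).ge) (fun n => (hη n).le) j
  refine tendsto_nhds_unique h1 (h2.congr' ?_)
  have hlarge : ∀ᶠ n : ℕ in atTop, |j| < ((n + 1 : ℕ) : ℤ) := by
    filter_upwards [eventually_gt_atTop |j|.toNat] with n hn
    push_cast
    omega
  filter_upwards [hlarge] with n hn
  have hz : (1 : ℂ) ^ (n + 1) = (-1) ^ (n + 1 + 1) * (-1) ^ (n + 1 + 1) := by
    rw [← mul_pow]; simp
  have hnz : a ^ (n + 1) + b ^ (n + 1) * (-1) ^ (n + 1 + 1) ≠ 0 := by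
    intro h
    have h' := congrArg norm (eq_neg_of_add_eq_zero_left h)
    rw [norm_neg, norm_mul, hη, mul_one, norm_pow, norm_pow] at h'
    exact hab ((pow_left_inj₀ (norm_nonneg _) (norm_nonneg _) n.succ_ne_zero).1 h')
  have h3 := average_eq_circleCoeff (n := n + 1) hz one_ne_zero a b hnz j hn
  rw [← h3, sum_zmod_eq_range]
  congr 1
  refine Finset.sum_congr rfl fun i _ => ?_
  simp only [one_mul, add_zero, rootChar_eq_circlePoint]

/-- The double contour integral equals its one-dimensional form. -/
theorem kernel_eq_limitKernel {α β γ : ℝ} (hα : 0 < α) (hβ : 0 < β) (hγ : 0 < γ)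
    (hαβγ : α * β < γ ^ 2) (x y : MidEdge ℤ) : kernel α β γ x y = limitKernel α β γ x y := by
  have hpi := Real.pi_pos
  have hT : (2 * Real.pi : ℝ) ≠ 0 := by positivity
  have he := (volume_preserving_finTwoArrow ℝ)
  have hS := finTwoArrow_preimage_Icc
  have hinner : ∀ θ : ℝ, ‖coeffA α (circlePoint (θ / (2 * Real.pi)))‖ ≠
      ‖coeffB α β γ (circlePoint (θ / (2 * Real.pi)))‖ →
      ∫ θ' in Set.Icc 0 (2 * Real.pi), angleIntegrand α β γ x y (θ, θ') =
        2 * Real.pi * limitIntegrand α β γ x y (θ / (2 * Real.pi)) := by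
    intro θ hθ
    set w := circlePoint (θ / (2 * Real.pi)) with hw
    have h1 := intervalIntegral.integral_comp_div (a := 0) (b := 2 * Real.pi)
      (fun φ => symbolIntegrand α β γ x y w (circlePoint φ)) hT
    rw [zero_div, div_self hT] at h1
    rw [integral_Icc_eq_integral_Ioc, ← intervalIntegral.integral_of_le (by positivity)]
    change ∫ θ' in (0 : ℝ)..2 * Real.pi,
      symbolIntegrand α β γ x y w (circlePoint (θ' / (2 * Real.pi))) = _
    rw [h1, Complex.real_smul]
    push_cast
    congr 1
    have hne : ∀ φ, coeffA α w + coeffB α β γ w * circlePoint φ ≠ 0 := by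
      intro φ h
      have h' := congrArg norm (eq_neg_of_add_eq_zero_left h)
      rw [norm_neg, norm_mul, norm_circlePoint, mul_one] at h'
      exact hθ h'
    have hcont : ∀ j : ℤ, Continuous fun φ =>
        circlePoint φ ^ j / (coeffA α w + coeffB α β γ w * circlePoint φ) := fun j =>
      (continuous_circlePoint.zpow₀ j fun θ => Or.inl (circlePoint_ne_zero θ)).div
        (continuous_const.add (continuous_const.mul continuous_circlePoint)) hne
    have h2 : ∀ φ, symbolIntegrand α β γ x y w (circlePoint φ) =
        w ^ (y.2.1 - x.2.1) * adjConst α γ y.1 x.1 w * (circlePoint φ ^ (y.2.2 - x.2.2) /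
          (coeffA α w + coeffB α β γ w * circlePoint φ)) +
        w ^ (y.2.1 - x.2.1) * adjLin β γ y.1 x.1 * (circlePoint φ ^ (y.2.2 - x.2.2 + 1) /
          (coeffA α w + coeffB α β γ w * circlePoint φ)) := by
      intro φ
      rw [symbolIntegrand, zpow_add_one₀ (circlePoint_ne_zero φ)]
      ring
    simp only [h2]
    have hint : ∀ (c : ℂ) (j : ℤ), IntervalIntegrable (fun φ =>
        c * (circlePoint φ ^ j / (coeffA α w + coeffB α β γ w * circlePoint φ))) volume 0 1 :=
      fun c j => (continuous_const.mul (hcont j)).intervalIntegrable _ _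
    rw [intervalIntegral.integral_add (hint _ _) (hint _ _),
      intervalIntegral.integral_const_mul, intervalIntegral.integral_const_mul,
      integral_circlePoint_zpow_div hθ, integral_circlePoint_zpow_div hθ, limitIntegrand, ← hw]
    ring
  have hfun : ∀ θ : Fin 2 → ℝ,
      (∏ i, ((1 : Fin 2 → ℝ) i) * Complex.exp (θ i * Complex.I) * Complex.I : ℂ) •
      kernelIntegrand α β γ x y (torusMap 0 1 θ) = (1 / (2 * Real.pi) ^ 2 : ℂ) *
        angleIntegrand α β γ x y (MeasurableEquiv.finTwoArrow θ) := by
    intro θ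
    have h0 := circlePoint_ne_zero (θ 0 / (2 * Real.pi))
    have h1 := circlePoint_ne_zero (θ 1 / (2 * Real.pi))
    rw [kernelIntegrand_eq _ _ _ _ _ (by rw [torusMap_eq_circlePoint]; exact circlePoint_ne_zero _)
      (by rw [torusMap_eq_circlePoint]; exact circlePoint_ne_zero _), torusMap_eq_circlePoint,
      torusMap_eq_circlePoint]
    have hexp : ∀ i, Complex.exp (θ i * Complex.I) = circlePoint (θ i / (2 * Real.pi)) := fun i => by
      rw [circlePoint, mul_div_cancel₀ _ hT]
    simp only [hexp, Fin.prod_univ_two, Pi.one_apply, Complex.ofReal_one, one_mul, smul_eq_mul]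
    change _ = (1 / (2 * Real.pi) ^ 2 : ℂ) * symbolIntegrand α β γ x y
      (circlePoint (θ 0 / (2 * Real.pi))) (circlePoint (θ 1 / (2 * Real.pi)))
    have hI := Complex.I_ne_zero
    have hpic : (Real.pi : ℂ) ≠ 0 := by exact_mod_cast hpi.ne'
    field_simp
  rw [kernel, torusIntegral]
  simp only [hfun]
  rw [integral_const_mul, ← hS, he.setIntegral_preimage_emb
    MeasurableEquiv.finTwoArrow.measurableEmbedding (angleIntegrand α β γ x y),
    Measure.volume_eq_prod, setIntegral_prod _ (integrableOn_angleIntegrand hα hβ hγ hαβγ x y)]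
  have hcount : {θ : ℝ | ‖coeffA α (circlePoint (θ / (2 * Real.pi)))‖ =
      ‖coeffB α β γ (circlePoint (θ / (2 * Real.pi)))‖}.Countable :=
    (countable_norm_coeff_eq hα hβ hαβγ).preimage (f := fun θ : ℝ => θ / (2 * Real.pi))
      fun a b h => by simpa [div_left_inj' hT] using h
  have hae : ∀ᵐ θ ∂(volume.restrict (Set.Icc 0 (2 * Real.pi))),
      ∫ θ' in Set.Icc 0 (2 * Real.pi), angleIntegrand α β γ x y (θ, θ') =
        2 * Real.pi * limitIntegrand α β γ x y (θ / (2 * Real.pi)) := by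
    filter_upwards [ae_restrict_of_ae (hcount.ae_notMem volume)] with θ hθ
    exact hinner θ hθ
  have h3 := intervalIntegral.integral_comp_div (a := 0) (b := 2 * Real.pi)
      (fun φ => limitIntegrand α β γ x y φ) hT
  rw [zero_div, div_self hT] at h3
  rw [integral_congr_ae hae, integral_const_mul, integral_Icc_eq_integral_Ioc,
    ← intervalIntegral.integral_of_le (by positivity), h3, Complex.real_smul, limitKernel]
  push_cast
  field_simp

end SixVertex

theorem theorem1p1 (α β γ : ℝ) (hα : 0 < α) (hβ : 0 < β) (hγ : 0 < γ) (hαβγ : α * β < γ ^ 2) :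
    -- the infinite-volume measure exists and is unique
    (∃! P : ProbabilityMeasure (SixVertex.Config ℤ),
      SixVertex.IsInfiniteVolumeMeasure (SixVertex.freeFermionWeight α β γ)
        (SixVertex.freeFermionWeight_pos hα hβ hγ hαβγ) P) ∧
    -- the double integrals defining the kernel converge absolutely
    (∀ x y : SixVertex.MidEdge ℤ,
      TorusIntegrable (SixVertex.kernelIntegrand α β γ x y) 0 1) ∧
    -- the correlation formula
    ∀ P : ProbabilityMeasure (SixVertex.Config ℤ),
      SixVertex.IsInfiniteVolumeMeasure (SixVertex.freeFermionWeight α β γ)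
        (SixVertex.freeFermionWeight_pos hα hβ hγ hαβγ) P →
      ∀ (k : ℕ) (v : Fin k → ℤ × ℤ), Function.Injective v →
      ∀ t : Fin k → SixVertex.VertexType,
        (((P : Measure (SixVertex.Config ℤ)).real
            {σ | ∀ i, SixVertex.vertexType σ (v i) = t i} : ℝ) : ℂ) =
          (∏ i, (SixVertex.freeFermionWeight α β γ (t i) : ℂ)) *
            Matrix.det (Matrix.of fun p q : Fin k × Fin 2 =>
              SixVertex.kernel α β γ (SixVertex.source (v p.1) p.2)
                (SixVertex.target (v q.1) (t q.1) q.2)) := by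
  refine ⟨SixVertex.existsUnique_infiniteVolumeMeasure hα hβ hγ hαβγ,
    SixVertex.torusIntegrable_kernelIntegrand hα hβ hγ hαβγ, fun P hP k v hv t => ?_⟩
  simp only [SixVertex.kernel_eq_limitKernel hα hβ hγ hαβγ]
  exact SixVertex.limit_cylinder hα hβ hγ hαβγ le_rfl hP hv t
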